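/- Let $\beta_1,\beta_2$ be real numbers with $\beta_2\le 1\le\beta_1<2\beta_2$, and consider, for $x\in(0,1)$, the system $$\partial_t\omega+u\,\partial_x\omega=\frac{\rho}{x},\qquad \partial_t\rho+u\,\partial_x\rho=0,\qquad \omega(x,0)=\omega_0(x),\quad \rho(x,0)=\rho_0(x),$$ $$u(x,t)=x\int_{\min(\beta_2x,1)}^{\min(\beta_1x,1)}\frac{\omega(y,t)}{y}\,dy-x\int_{\min(\beta_1x,1)}^{1}\frac{\omega(y,t)}{y}\,dy .$$ For an integer $n\ge1$ let $K^n$ be the set of $C^n$ functions whose support is a compact subset of $(0,1)$, with $\|f\|_{K^n}=\|f\|_{C^n}+(\min\operatorname{supp}f)^{-1}$ (the last term being $0$ for $f=0$), and let $K^\infty=\bigcap_{n\ge1}K^n$. Write $f\in C([0,T),K^n)$ if $f(\cdot,t)\in K^n$ for all $t\in[0,T)$, $t\mapsto f(\cdot,t)$ is continuous in the $C^n$ norm, and $\|f(\cdot,t)\|_{K^n}$ is bounded on $[0,T']$ for every $T'<T$. A $K^n$-solution on $[0,T)$ is a pair $(\omega,\rho)\in C([0,T),K^n)\times C([0,T),K^n)$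 satisfying the system pointwise (with the one-sided time derivative at $t=0$). Then there exist non-negative $\omega_0,\rho_0\in K^\infty$ and a time $T\in(0,\infty)$ such that the corresponding solution $(\omega,\rho)$ exists exactly on $[0,T)$ and blows up at time $T$. That is, there is a pair $(\omega,\rho)$ which is a $K^n$-solution on $[0,T)$ with data $(\omega_0,\rho_0)$ for every $n\ge1$; for every $n\ge 1$, any $K^n$-solution with these data on an interval $[0,T')$ satisfies $T'\le T$ and coincides with $(\omega,\rho)$ on $[0,T')$; and $$\int_0^T\|\omega(\cdot,t)\|_{L^\infty}\,dt=\infty,\qquad \int_0^T\|\partial_x\rho(\cdot,t)\|_{L^\infty}\,dt=\infty,\qquad \int_0^T\|\partial_xu(\cdot,t)\|_{L^\infty}\,dt=\infty,$$ where $L^\infty=L^\infty((0,1))$. -/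

import Mathlib

open Set Filter Topology MeasureTheory
open scoped ENNReal

/-- Membership in `K^n((0,1))`: functions of class `C^n` whose support is a compact subset of
`(0,1)`; such functions are regarded as functions on `ℝ`, extended by zero. -/
def MemK (n : ℕ) (f : ℝ → ℝ) : Prop :=
  ContDiff ℝ n f ∧ HasCompactSupport f ∧ tsupport f ⊆ Ioo (0 : ℝ) 1

/-- `K^∞((0,1))`, the intersection of the spaces `K^n((0,1))` over `n ≥ 1`. -/
def MemKInf (f : ℝ → ℝ) : Prop := ∀ n : ℕ, 1 ≤ n → MemK n f

/-- The `C^n` norm: the sum of the sup norms of the derivatives of order at most `n`. -/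
noncomputable def cNorm (n : ℕ) (f : ℝ → ℝ) : ℝ≥0∞ :=
  ∑ k ∈ Finset.range (n + 1), ⨆ x : ℝ, ‖iteratedDeriv k f x‖ₑ

/-- The size `‖f‖_{C^n} + (min supp f)⁻¹` defining `K^n`; the second term is `0` for `f = 0`. -/
noncomputable def kNorm (n : ℕ) (f : ℝ → ℝ) : ℝ≥0∞ :=
  cNorm n f + (⨅ x ∈ tsupport f, ENNReal.ofReal x)⁻¹

/-- `f ∈ C([0,T), K^n((0,1)))`. As `kNorm` does not induce a metric, this means: `f t ∈ K^n` for all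
`t ∈ [0,T)`, `f` is continuous in time in the `C^n` norm, and `kNorm n (f t)` is bounded on every
`[0,T']` with `T' < T`. -/
structure IsKPath (n : ℕ) (T : ℝ) (f : ℝ → ℝ → ℝ) : Prop where
  mem : ∀ t ∈ Ico (0 : ℝ) T, MemK n (f t)
  cont : ∀ t ∈ Ico (0 : ℝ) T,
    Tendsto (fun s => cNorm n (f s - f t)) (𝓝[Ico (0 : ℝ) T] t) (𝓝 0)
  bdd : ∀ T' < T, ∃ M : ℝ≥0∞, M < ∞ ∧ ∀ t ∈ Icc (0 : ℝ) T', kNorm n (f t) ≤ M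

/-- The sign-changing Biot-Savart law, giving the velocity at `x` from the vorticity `ω`. -/
noncomputable def velocity (β₁ β₂ : ℝ) (ω : ℝ → ℝ) (x : ℝ) : ℝ :=
  x * (∫ y in (min (β₂ * x) 1)..(min (β₁ * x) 1), ω y / y)
    - x * (∫ y in (min (β₁ * x) 1)..1, ω y / y)

/-- `(ω, ρ)`, with `ω t x` and `ρ t x` the values at time `t` and position `x`, is a solution of
`∂ₜω + u ∂ₓω = ρ / x`, `∂ₜρ + u ∂ₓρ = 0`, `ω(·,0) = ω₀`, `ρ(·,0) = ρ₀` on the time interval `[0,T)`,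
in the class `C([0,T), K^n) × C([0,T), K^n)`. The time derivative at `t = 0` is one-sided. -/
structure IsSolution (β₁ β₂ : ℝ) (n : ℕ) (T : ℝ) (ω₀ ρ₀ : ℝ → ℝ) (ω ρ : ℝ → ℝ → ℝ) : Prop where
  omega_path : IsKPath n T ω
  rho_path : IsKPath n T ρ
  omega_init : ω 0 = ω₀
  rho_init : ρ 0 = ρ₀
  omega_eq : ∀ t ∈ Ico (0 : ℝ) T, ∀ x ∈ Ioo (0 : ℝ) 1,
    HasDerivWithinAt (fun s => ω s x)
      (ρ t x / x - velocity β₁ β₂ (ω t) x * deriv (ω t) x) (Ico (0 : ℝ) T) t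
  rho_eq : ∀ t ∈ Ico (0 : ℝ) T, ∀ x ∈ Ioo (0 : ℝ) 1,
    HasDerivWithinAt (fun s => ρ s x)
      (-(velocity β₁ β₂ (ω t) x * deriv (ρ t) x)) (Ico (0 : ℝ) T) t

/-- The `L^∞((0,1))` norm. -/
noncomputable def supNorm (f : ℝ → ℝ) : ℝ≥0∞ :=
  eLpNorm f ∞ (volume.restrict (Ioo (0 : ℝ) 1))

/-! Put `s = log x`, `b₁ = log β₁`, `b₂ = log β₂`, and let `F(s)` be the integral of the vorticity
over `(s, 0)`. Then `u / x = F(s + b₂) - 2 F(s + b₁)`, whose `s`-derivative is `2 ω(s + b₁) - ω(s +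
b₂)`. Take zero initial vorticity and a density `R` in the logarithmic variable. With `S(t, a)` the
logarithmic position of the particle starting at `a`, density is transported and the vorticity
carried by that particle is `R(a)` times its history, the integral over `[0, t]` of `exp(-S(τ, a))`.

Sign control. Where `R` is nondecreasing, vorticities of two particles at distance `b₁ - b₂` differ
by a factor close to `exp(b₁ - b₂) = β₁ / β₂ < 2`, provided their distance was not much larger in
the past. Hence `2 ω(s + b₁) - ω(s + b₂)` is bounded below by a positive multiple of `ω(s + b₁)`,
and `u / x` increases in `s` away from the right end of the support. Near that end the mass of
vorticity is small for a short time. Together these say that gaps shrink at rate at most `1` and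
that `u / x ≤ 1`, which in turn keeps past distances under control. The bootstrap closes on an
interval `[0, T₀]` depending only on `β₁` and `β₂` (`IsLagrangian.isControlled`).

Collapse. For a particle `y` at the left end of the plateau `R = 1`, with history `h`, the strict
monotonicity of `u / x` gives `y' ≤ 1 - κ h` and `h' = exp(-y)`. This forces a Riccati inequality
for `h`, impossible up to `T₀` if `-y(0)` is large (`false_of_collapse`,
`exists_forall_not_isLagrangian`).

Maximal solution. In Lagrangian variables the system is a locally Lipschitz ODE in a Banach space.
Since no solution reaches `T₀`, there is a maximal one, unbounded as `t → T ≤ T₀`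
(`exists_unbounded_solution`). It is smooth, because the integrated equation gains a derivative at
each pass (`IsFlow.jointC_fst`), and it gives an Eulerian solution (`IsFlow.isSolution`). Uniqueness
follows by comparison along its trajectories (`IsSolution.eq_of_hasTrajectories`). If any of the
three time integrals were finite, the Lagrangian state would stay bounded
(`IsFlow.lintegral_supNorm_eulerVort` and its two analogues). -/

open scoped BoundedContinuousFunction

/-! ### Maximal solutions of locally Lipschitz autonomous equations. -/

/-- An autonomous ODE whose vector field is Lipschitz on balls, in a Banach space with Lipschitz
retractions onto balls: the solution starting at `0` either exists up to time `T₀`, or there is a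
maximal solution, which is unbounded. -/
theorem exists_unbounded_solution {E : Type*} [NormedAddCommGroup E] [NormedSpace ℝ E]
    [CompleteSpace E] {f : E → E} {c : ℕ → E → E}
    (hf : ∀ N : ℕ, ∃ K, LipschitzOnWith K f (Metric.closedBall 0 N))
    (hc : ∀ N, LipschitzWith 1 (c N)) (hcn : ∀ N x, ‖c N x‖ ≤ N)
    (hci : ∀ (N : ℕ) x, ‖x‖ ≤ N → c N x = x) {T₀ : ℝ} (hT₀ : 0 < T₀)
    (hno : ¬ ∃ α : ℝ → E, α 0 = 0 ∧
      ∀ t ∈ Icc 0 T₀, HasDerivWithinAt α (f (α t)) (Icc 0 T₀) t) :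
    ∃ T, 0 < T ∧ T ≤ T₀ ∧ ∃ α : ℝ → E, α 0 = 0 ∧
      (∀ t ∈ Ico 0 T, HasDerivWithinAt α (f (α t)) (Ico 0 T) t) ∧
      ∀ N : ℕ, ∃ t ∈ Ico 0 T, N < ‖α t‖ := by
  have hlip : ∀ N : ℕ, ∃ K, LipschitzWith K (fun x => f (c N x)) := by
    intro N
    obtain ⟨K, hK⟩ := hf N
    refine ⟨K * 1, ?_⟩
    rw [← lipschitzOnWith_univ]
    exact hK.comp (hc N).lipschitzOnWith (fun x _ => by simpa using hcn N x)
  choose K hK using hlip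
  -- The truncated field is globally Lipschitz and bounded, so Picard–Lindelöf applies in a ball of
  -- radius bound times length of time. The extra unit of time leaves room to continue past `T₀`.
  have hglob : ∀ N : ℕ, ∃ α : ℝ → E, α 0 = 0 ∧
      ∀ t ∈ Icc 0 (T₀ + 1), HasDerivWithinAt α (f (c N (α t))) (Icc 0 (T₀ + 1)) t := by
    intro N
    have hb : ∀ x, ‖f (c N x)‖ ≤ ‖f 0‖ + K N * N := by
      intro x
      have h1 := (hK N).dist_le_mul (c N x) 0
      rw [hci N _ (hcn N x), hci N 0 (by simp), dist_eq_norm, dist_zero_right] at h1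
      have h2 := norm_sub_norm_le (f (c N x)) (f 0)
      have h3 : (K N : ℝ) * ‖c N x‖ ≤ K N * N :=
        mul_le_mul_of_nonneg_left (hcn N x) (K N).2
      linarith
    let L : NNReal := ⟨‖f 0‖ + K N * N, by positivity⟩
    let r : NNReal := L * ⟨T₀ + 1, by linarith⟩
    have hPL : IsPicardLindelof (fun _ => fun x => f (c N x))
        (⟨0, by constructor <;> linarith⟩ : Icc (0 : ℝ) (T₀ + 1)) (0 : E) r 0 L (K N) := by
      refine ⟨fun t _ => (hK N).lipschitzOnWith, fun x _ => continuousOn_const, fun t _ x _ => hb x,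
        ?_⟩
      simp only [sub_zero, NNReal.coe_zero, sub_self]
      rw [max_eq_left (by linarith)]
      rfl
    exact hPL.exists_eq_forall_mem_Icc_hasDerivWithinAt₀
  choose α hα0 hα using hglob
  have hcont : ∀ N, ContinuousOn (α N) (Icc 0 (T₀ + 1)) := fun N t ht =>
    (hα N t ht).continuousWithinAt
  -- uniqueness for the truncated equations
  have huniq : ∀ (N : ℕ) (β : ℝ → E) (t : ℝ), t ≤ T₀ + 1 → β 0 = 0 → ContinuousOn β (Icc 0 t) →
      (∀ σ ∈ Ico 0 t, HasDerivWithinAt β (f (c N (β σ))) (Ici σ) σ) →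
      EqOn β (α N) (Icc 0 t) := by
    intro N β t ht h0 hβc hβ
    refine ODE_solution_unique (fun _ => hK N) hβc hβ
      ((hcont N).mono (Icc_subset_Icc_right ht)) (fun σ hσ => ?_) (by rw [h0, hα0])
    exact (hα N σ ⟨hσ.1, by linarith [hσ.2]⟩).mono_of_mem_nhdsWithin
      (Icc_mem_nhdsGE_of_mem ⟨hσ.1, by linarith [hσ.2]⟩)
  -- As long as the `N`-th solution stays in the ball of radius `N`, the truncation is invisible and
  -- it solves the original equation; such solutions agree with each other.
  let good : ℕ → ℝ → Prop := fun N t => ∀ σ ∈ Icc 0 t, ‖α N σ‖ ≤ N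
  have hgood : ∀ {N M : ℕ} {t : ℝ}, t ≤ T₀ + 1 → N ≤ M → good N t → EqOn (α N) (α M) (Icc 0 t) := by
    intro N M t ht hNM hg
    refine huniq M (α N) t ht (hα0 N) ((hcont N).mono (Icc_subset_Icc_right ht)) fun σ hσ => ?_
    have h1 := hg σ ⟨hσ.1, hσ.2.le⟩
    have h2 := (hα N σ ⟨hσ.1, by linarith [hσ.2]⟩).mono_of_mem_nhdsWithin
      (Icc_mem_nhdsGE_of_mem (show σ ∈ Ico 0 (T₀ + 1) from ⟨hσ.1, by linarith [hσ.2]⟩))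
    rw [hci N _ h1] at h2
    rwa [hci M _ (h1.trans (by exact_mod_cast hNM))]
  have hgood' : ∀ {N M : ℕ} {t s : ℝ}, t ≤ T₀ + 1 → s ≤ T₀ + 1 → 0 ≤ t → t ≤ s →
      good N t → good M s → α N t = α M t := by
    intro N M t s ht hs h0 hts h1 h2
    rcases le_total N M with h | h
    · exact hgood ht h h1 ⟨h0, le_rfl⟩
    · exact (hgood hs h h2 ⟨h0, hts⟩).symm
  let A : Set ℝ := {t | 0 ≤ t ∧ t ≤ T₀ + 1 ∧ ∃ N, good N t}
  have hA0 : ∀ t ∈ A, t < T₀ := by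
    rintro t ⟨-, -, N, hN⟩
    by_contra! hle
    refine hno ⟨α N, hα0 N, fun σ hσ => ?_⟩
    have h2 := (hα N σ ⟨hσ.1, by linarith [hσ.2]⟩).mono (Icc_subset_Icc_right (by linarith : T₀ ≤ T₀ + 1))
    rwa [hci N _ (hN σ ⟨hσ.1, hσ.2.trans hle⟩)] at h2
  have hAb : BddAbove A := ⟨T₀, fun t ht => (hA0 t ht).le⟩
  -- openness
  have hopen : ∀ (N : ℕ) (t : ℝ), 0 ≤ t → t ≤ T₀ → (∀ σ ∈ Icc 0 t, ‖α (N + 1) σ‖ ≤ N) →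
      ∃ s > t, s ∈ A := by
    intro N t h0 ht hb
    have h1 : ContinuousWithinAt (fun σ => ‖α (N + 1) σ‖) (Icc 0 (T₀ + 1)) t :=
      ((hcont (N + 1)) t ⟨h0, by linarith⟩).norm
    have h2 : ∀ᶠ σ in 𝓝[Icc 0 (T₀ + 1)] t, ‖α (N + 1) σ‖ < N + 1 :=
      h1.eventually_lt continuousWithinAt_const
        (by have := hb t ⟨h0, le_rfl⟩; linarith)
    obtain ⟨ε, hε, hε'⟩ := Metric.mem_nhdsWithin_iff.1 h2
    refine ⟨t + min (ε / 2) (1 / 2), by have : 0 < min (ε / 2) (1 / 2) := by positivity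
                                        linarith, ?_, ?_, N + 1, ?_⟩
    · have : 0 < min (ε / 2) (1 / 2) := by positivity
      linarith
    · linarith [min_le_right (ε / 2) (1 / 2 : ℝ)]
    · intro σ hσ
      rcases le_total σ t with h | h
      · have := hb σ ⟨hσ.1, h⟩
        push_cast; linarith
      · have h3 : σ ∈ Metric.ball t ε ∩ Icc 0 (T₀ + 1) := by
          refine ⟨?_, hσ.1, ?_⟩
          · rw [Metric.mem_ball, Real.dist_eq, abs_of_nonneg (by linarith)]
            linarith [min_le_left (ε / 2) (1 / 2 : ℝ), hσ.2]
          · linarith [min_le_right (ε / 2) (1 / 2 : ℝ), hσ.2]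
        have := hε' h3
        simp only [mem_ofPred_eq] at this
        push_cast; linarith
  obtain ⟨t₁, ht₁, ht₁A⟩ := hopen 0 0 le_rfl hT₀.le (fun σ hσ => by
    have : σ = 0 := le_antisymm hσ.2 hσ.1
    simp [this, hα0])
  set T := sSup A with hT
  have hTpos : 0 < T := lt_of_lt_of_le ht₁ (le_csSup hAb ht₁A)
  have hTle : T ≤ T₀ := csSup_le ⟨_, ht₁A⟩ fun t ht => (hA0 t ht).le
  have hex : ∀ t, t < T → ∃ s ∈ A, t < s := fun t ht => exists_lt_of_lt_csSup ⟨_, ht₁A⟩ ht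
  have hex' : ∀ t, ∃ N, t ∈ Ico 0 T → good N t := by
    intro t
    by_cases ht : t ∈ Ico 0 T
    · obtain ⟨s, ⟨_, _, N, hN⟩, hs⟩ := hex t ht.2
      exact ⟨N, fun _ σ hσ => hN σ ⟨hσ.1, hσ.2.trans hs.le⟩⟩
    · exact ⟨0, fun h => absurd h ht⟩
  choose n hn using hex'
  have hloc : ∀ {s : ℝ} {M : ℕ}, 0 ≤ s → s ≤ T₀ + 1 → good M s → ∀ t ∈ Ico 0 T, t ≤ s →
      α (n t) t = α M t := fun h0 hs hg t ht hts =>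
    hgood' (by linarith [ht.2]) hs ht.1 hts (hn t ht) hg
  have hder : ∀ t ∈ Ico 0 T,
      HasDerivWithinAt (fun t => α (n t) t) (f (α (n t) t)) (Ico 0 T) t := by
    intro t ht
    obtain ⟨s, ⟨hs0, hs1, N, hN⟩, hs⟩ := hex t ht.2
    have h1 : HasDerivWithinAt (α N) (f (α (n t) t)) (Ico 0 T) t := by
      rw [hloc hs0 hs1 hN t ht hs.le]
      have := hα N t ⟨ht.1, by linarith⟩
      rw [hci N _ (hN t ⟨ht.1, hs.le⟩)] at this
      exact this.mono fun x hx => ⟨hx.1, by linarith [hx.2]⟩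
    refine h1.congr_of_eventuallyEq ?_ (hloc hs0 hs1 hN t ht hs.le)
    filter_upwards [self_mem_nhdsWithin, mem_nhdsWithin_of_mem_nhds (Iio_mem_nhds hs)] with σ h2 h3
    exact hloc hs0 hs1 hN σ h2 (le_of_lt h3)
  refine ⟨T, hTpos, hTle, fun t => α (n t) t, hα0 _, hder, ?_⟩
  intro N
  -- A bound `N` on `[0, T)` would identify the glued solution with the one truncated at `N + 1`,
  -- carry the bound to the endpoint and continue the solution past the supremum `T`.
  by_contra! hbd
  have heq : ∀ t ∈ Ico 0 T, α (n t) t = α (N + 1) t := by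
    intro t ht
    refine huniq (N + 1) (fun t => α (n t) t) t (by linarith [ht.2]) (hα0 _)
      (fun σ hσ => ((hder σ ⟨hσ.1, hσ.2.trans_lt ht.2⟩).continuousWithinAt).mono
        fun x hx => ⟨hx.1, hx.2.trans_lt ht.2⟩) (fun σ hσ => ?_) ⟨ht.1, le_rfl⟩
    have hσ' : σ ∈ Ico 0 T := ⟨hσ.1, hσ.2.trans ht.2⟩
    rw [hci]
    · exact (hder σ hσ').mono_of_mem_nhdsWithin (Ico_mem_nhdsGE_of_mem hσ')
    · exact (hbd σ hσ').trans (by push_cast; linarith)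
  have hb : ∀ σ ∈ Icc 0 T, ‖α (N + 1) σ‖ ≤ N := by
    have hcl : closure (Ico 0 T) = Icc 0 T := closure_Ico hTpos.ne
    intro σ hσ
    have hc1 : ContinuousWithinAt (fun σ => ‖α (N + 1) σ‖) (Ico 0 T) σ :=
      (((hcont (N + 1)) σ ⟨hσ.1, by linarith [hσ.2]⟩).norm).mono
        fun x hx => ⟨hx.1, by linarith [hx.2]⟩
    exact hc1.closure_le (hcl ▸ hσ) continuousWithinAt_const fun x hx => by
      rw [← heq x hx]; exact hbd x hx
  obtain ⟨s, hs, hsA⟩ := hopen N T hTpos.le hTle hb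
  exact absurd (le_csSup hAb hsA) (not_le.2 hs)

/-! ### Particle positions in logarithmic coordinates -/

/-- The position of the particle with label `a`, when `exp ∘ j` is the Jacobian and the particle `0`
sits at the origin. -/
noncomputable def position (j : ℝ → ℝ) (a : ℝ) : ℝ := ∫ x in (0 : ℝ)..a, Real.exp (j x)

/-- The label of the particle at position `s`. -/
noncomputable def label (j : ℝ → ℝ) (s : ℝ) : ℝ := Function.invFun (position j) s

/-- The label of the particle at signed distance `b` from the particle `a`, clamped to `[A, 0]`. -/
noncomputable def shiftLabel (A b : ℝ) (j : ℝ → ℝ) (a : ℝ) : ℝ :=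
  max A (min 0 (label j (position j a + b)))

/-- The logarithmic rate of change of the Jacobian. -/
noncomputable def rate (A b₁ b₂ : ℝ) (j V : ℝ → ℝ) (a : ℝ) : ℝ :=
  2 * (∫ x in (0 : ℝ)..shiftLabel A b₁ j a, V x) - ∫ x in (0 : ℝ)..shiftLabel A b₂ j a, V x

/-- The rate of change of the label derivative of the vorticity. -/
noncomputable def source (R : ℝ → ℝ) (j : ℝ → ℝ) (a : ℝ) : ℝ :=
  Real.exp (-position j a) * (deriv R a - R a * Real.exp (j a))

/-- Admissible density profiles in logarithmic coordinates: increasing from `0` to `1` on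
`[A, A + 1]`, constant until `-3`, and vanishing from `-2` on. -/
structure IsProfile (A : ℝ) (R : ℝ → ℝ) : Prop where
  le : A ≤ -10
  smooth : ∀ n : ℕ, ContDiff ℝ n R
  nonneg : ∀ a, 0 ≤ R a
  le_one : ∀ a, R a ≤ 1
  zero_of_le : ∀ a ≤ A, R a = 0
  zero_of_ge : ∀ a ≥ -2, R a = 0
  mono : ∀ a a', a ≤ a' → a' ≤ -3 → R a ≤ R a'
  one : ∀ a ∈ Icc (A + 1) (-3), R a = 1

/-! ### The change of variables between labels and positions. -/

section position

variable {j : ℝ → ℝ} {N : ℝ}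

theorem position_sub (hj : Continuous j) (a b : ℝ) :
    position j b - position j a = ∫ x in a..b, Real.exp (j x) := by
  have hc : Continuous fun x => Real.exp (j x) := Real.continuous_exp.comp hj
  exact intervalIntegral.integral_interval_sub_left (hc.intervalIntegrable _ _)
    (hc.intervalIntegrable _ _)

theorem position_zero : position j 0 = 0 := by simp [position]

theorem hasDerivAt_position (hj : Continuous j) (a : ℝ) :
    HasDerivAt (position j) (Real.exp (j a)) a := by
  have hc : Continuous fun x => Real.exp (j x) := Real.continuous_exp.comp hj
  exact hc.integral_hasStrictDerivAt 0 a |>.hasDerivAt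

theorem continuous_position (hj : Continuous j) : Continuous (position j) :=
  continuous_iff_continuousAt.2 fun a => (hasDerivAt_position hj a).continuousAt

theorem position_sub_le (hj : Continuous j) (hN : ∀ x, |j x| ≤ N) {a b : ℝ} (hab : a ≤ b) :
    position j b - position j a ≤ Real.exp N * (b - a) := by
  rw [position_sub hj]
  have hc : Continuous fun x => Real.exp (j x) := Real.continuous_exp.comp hj
  have := intervalIntegral.integral_mono_on hab (hc.intervalIntegrable _ _)
    (intervalIntegrable_const (μ := volume) (c := Real.exp N))
    (fun x _ => Real.exp_le_exp.2 (le_of_abs_le (hN x)))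
  simpa [mul_comm] using this

theorem le_position_sub (hj : Continuous j) (hN : ∀ x, |j x| ≤ N) {a b : ℝ} (hab : a ≤ b) :
    Real.exp (-N) * (b - a) ≤ position j b - position j a := by
  rw [position_sub hj]
  have hc : Continuous fun x => Real.exp (j x) := Real.continuous_exp.comp hj
  have := intervalIntegral.integral_mono_on hab (intervalIntegrable_const (μ := volume) (c := Real.exp (-N)))
    (hc.intervalIntegrable _ _) (fun x _ => Real.exp_le_exp.2 (neg_le_of_abs_le (hN x)))
  simpa [mul_comm] using this

theorem sub_le_exp_mul_position_sub (hj : Continuous j) (hN : ∀ x, |j x| ≤ N) {a b : ℝ}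
    (hab : a ≤ b) : b - a ≤ Real.exp N * (position j b - position j a) := by
  have h := le_position_sub hj hN hab
  calc b - a = Real.exp N * (Real.exp (-N) * (b - a)) := by
        rw [← mul_assoc, ← Real.exp_add]; simp
    _ ≤ _ := mul_le_mul_of_nonneg_left h (Real.exp_pos _).le

theorem position_strictMono (hj : Continuous j) : StrictMono (position j) := by
  intro a b hab
  have hc : Continuous fun x => Real.exp (j x) := Real.continuous_exp.comp hj
  have := intervalIntegral.intervalIntegral_pos_of_pos (f := fun x => Real.exp (j x))
    (hc.intervalIntegrable a b) (fun x => Real.exp_pos _) hab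
  rw [← position_sub hj] at this
  linarith

theorem position_surjective (hj : Continuous j) (hN : ∀ x, |j x| ≤ N) :
    Function.Surjective (position j) := by
  refine (continuous_position hj).surjective ?_ ?_
  · refine tendsto_atTop_mono' _ ?_ (tendsto_id.const_mul_atTop (Real.exp_pos (-N)))
    filter_upwards [eventually_ge_atTop 0] with a ha
    simpa [position_zero] using le_position_sub hj hN ha
  · refine tendsto_atBot_mono' _ ?_ (tendsto_id.const_mul_atBot (Real.exp_pos (-N)))
    filter_upwards [eventually_le_atBot 0] with a ha
    have := le_position_sub hj hN ha
    simp only [position_zero] at this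
    simp only [id]
    linarith

theorem position_label (hj : Continuous j) (hN : ∀ x, |j x| ≤ N) (s : ℝ) :
    position j (label j s) = s :=
  Function.invFun_eq (position_surjective hj hN s)

theorem label_position (hj : Continuous j) (a : ℝ) : label j (position j a) = a :=
  Function.leftInverse_invFun (position_strictMono hj).injective a

theorem abs_label_sub_le (hj : Continuous j) (hN : ∀ x, |j x| ≤ N) (s s' : ℝ) :
    |label j s - label j s'| ≤ Real.exp N * |s - s'| := by
  wlog h : label j s' ≤ label j s generalizing s s'
  · rw [abs_sub_comm, abs_sub_comm s]
    exact this s' s (le_of_not_ge h)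
  have := sub_le_exp_mul_position_sub hj hN h
  rw [position_label hj hN, position_label hj hN] at this
  rw [abs_of_nonneg (by linarith)]
  exact this.trans (mul_le_mul_of_nonneg_left (le_abs_self _) (Real.exp_pos _).le)

theorem continuous_label (hj : Continuous j) (hN : ∀ x, |j x| ≤ N) : Continuous (label j) := by
  have : LipschitzWith ⟨Real.exp N, (Real.exp_pos N).le⟩ (label j) :=
    LipschitzWith.of_dist_le_mul fun s s' => by
      rw [Real.dist_eq, Real.dist_eq]; exact abs_label_sub_le hj hN s s'
  exact this.continuous

theorem label_le_iff (hj : Continuous j) (hN : ∀ x, |j x| ≤ N) (s a : ℝ) :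
    label j s ≤ a ↔ s ≤ position j a := by
  rw [← (position_strictMono hj).le_iff_le, position_label hj hN]

theorem le_label_iff (hj : Continuous j) (hN : ∀ x, |j x| ≤ N) (s a : ℝ) :
    a ≤ label j s ↔ position j a ≤ s := by
  rw [← (position_strictMono hj).le_iff_le, position_label hj hN]

theorem abs_position_le (hj : Continuous j) (hN : ∀ x, |j x| ≤ N) (a : ℝ) :
    |position j a| ≤ Real.exp N * |a| := by
  rcases le_total 0 a with h | h
  · have h1 := position_sub_le hj hN h
    have h2 := (position_strictMono hj).monotone h
    rw [position_zero] at h1 h2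
    rw [abs_of_nonneg h2, abs_of_nonneg h]; linarith
  · have h1 := position_sub_le hj hN h
    have h2 := (position_strictMono hj).monotone h
    rw [position_zero] at h1 h2
    rw [abs_of_nonpos h2, abs_of_nonpos h]; linarith

end position

theorem abs_exp_sub_exp_le {x y M : ℝ} (hx : x ≤ M) (hy : y ≤ M) :
    |Real.exp x - Real.exp y| ≤ Real.exp M * |x - y| := by
  wlog h : y ≤ x generalizing x y
  · rw [abs_sub_comm, abs_sub_comm x]
    exact this hy hx (le_of_not_ge h)
  rw [abs_of_nonneg (by linarith [Real.exp_le_exp.2 h]), abs_of_nonneg (by linarith)]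
  have h1 : 1 - (x - y) ≤ Real.exp (-(x - y)) := by linarith [Real.add_one_le_exp (-(x - y))]
  have h2 : Real.exp y = Real.exp x * Real.exp (-(x - y)) := by rw [← Real.exp_add]; ring_nf
  have h3 := Real.exp_pos x
  have h4 : Real.exp x * (x - y) ≤ Real.exp M * (x - y) :=
    mul_le_mul_of_nonneg_right (Real.exp_le_exp.2 hx) (by linarith)
  nlinarith

/-! ### Lipschitz dependence of the Jacobian rate on the state. -/

section Lipschitz

variable {j₁ j₂ : ℝ → ℝ} {N D : ℝ}

theorem abs_exp_comp_sub_le (hN₁ : ∀ x, |j₁ x| ≤ N) (hN₂ : ∀ x, |j₂ x| ≤ N)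
    (hD : ∀ x, |j₁ x - j₂ x| ≤ D) (x : ℝ) :
    |Real.exp (j₁ x) - Real.exp (j₂ x)| ≤ Real.exp N * D :=
  (abs_exp_sub_exp_le (le_of_abs_le (hN₁ x)) (le_of_abs_le (hN₂ x))).trans
    (mul_le_mul_of_nonneg_left (hD x) (Real.exp_pos _).le)

theorem abs_position_sub_sub_le (hj₁ : Continuous j₁) (hj₂ : Continuous j₂)
    (hN₁ : ∀ x, |j₁ x| ≤ N) (hN₂ : ∀ x, |j₂ x| ≤ N) (hD : ∀ x, |j₁ x - j₂ x| ≤ D) (a b : ℝ) :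
    |(position j₁ b - position j₁ a) - (position j₂ b - position j₂ a)|
      ≤ Real.exp N * D * |b - a| := by
  have hc₁ : Continuous fun x => Real.exp (j₁ x) := Real.continuous_exp.comp hj₁
  have hc₂ : Continuous fun x => Real.exp (j₂ x) := Real.continuous_exp.comp hj₂
  rw [position_sub hj₁, position_sub hj₂, ← intervalIntegral.integral_sub
    (hc₁.intervalIntegrable _ _) (hc₂.intervalIntegrable _ _)]
  exact intervalIntegral.norm_integral_le_of_norm_le_const
    (f := fun x => Real.exp (j₁ x) - Real.exp (j₂ x)) fun x _ =>
    abs_exp_comp_sub_le hN₁ hN₂ hD x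

theorem abs_position_sub_position_le (hj₁ : Continuous j₁) (hj₂ : Continuous j₂)
    (hN₁ : ∀ x, |j₁ x| ≤ N) (hN₂ : ∀ x, |j₂ x| ≤ N) (hD : ∀ x, |j₁ x - j₂ x| ≤ D) (a : ℝ) :
    |position j₁ a - position j₂ a| ≤ Real.exp N * D * |a| := by
  simpa [position_zero] using abs_position_sub_sub_le hj₁ hj₂ hN₁ hN₂ hD 0 a

theorem shiftLabel_mem {A : ℝ} (hA : A ≤ 0) (b : ℝ) (j : ℝ → ℝ) (a : ℝ) :
    shiftLabel A b j a ∈ Icc A 0 :=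
  ⟨le_max_left _ _, max_le hA (min_le_left _ _)⟩

/-- If the clamped labels satisfy `α < β`, the clamps can only help: `position j₁ a + b ≤ position
j₁ α` and `position j₂ β ≤ position j₂ a + b`. Subtracting bounds the `j₂`-distance from `α` to `β`
by the change in the distance from `a` to `α`. The three factors `exp N` come from `|α - a| ≤ exp N
* |b|`, from the change of the Jacobian, and from converting position to label. -/
theorem shiftLabel_sub_le {A : ℝ} (hA : A ≤ 0) (hj₁ : Continuous j₁) (hj₂ : Continuous j₂)
    (hN₁ : ∀ x, |j₁ x| ≤ N) (hN₂ : ∀ x, |j₂ x| ≤ N) (hD : ∀ x, |j₁ x - j₂ x| ≤ D) (b a : ℝ) :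
    shiftLabel A b j₂ a - shiftLabel A b j₁ a ≤ Real.exp (3 * N) * D * |b| := by
  have hD0 : 0 ≤ D := (abs_nonneg _).trans (hD 0)
  rcases le_or_gt (shiftLabel A b j₂ a) (shiftLabel A b j₁ a) with hle | hlt
  · exact (sub_nonpos.2 hle).trans (by positivity)
  have hm₁ := shiftLabel_mem hA b j₁ a
  have hm₂ := shiftLabel_mem hA b j₂ a
  set α := shiftLabel A b j₁ a with hα
  set β := shiftLabel A b j₂ a with hβ
  have h1 : label j₁ (position j₁ a + b) ≤ α := by
    by_contra! h
    have h2 : min 0 (label j₁ (position j₁ a + b)) ≤ α := le_max_right _ _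
    rcases min_le_iff.1 h2 with h3 | h3
    · linarith [hm₂.2]
    · linarith
  have h2 : β ≤ label j₂ (position j₂ a + b) := by
    by_contra! h
    rcases max_choice A (min 0 (label j₂ (position j₂ a + b))) with h3 | h3
    · have : β = A := h3
      linarith [hm₁.1]
    · have : β = min 0 (label j₂ (position j₂ a + b)) := h3
      have := min_le_right 0 (label j₂ (position j₂ a + b))
      linarith
  rw [label_le_iff hj₁ hN₁] at h1
  rw [le_label_iff hj₂ hN₂] at h2
  have h3 : |α - a| ≤ Real.exp N * |b| := by
    rcases le_total a α with h | h
    · rw [abs_of_nonneg (by linarith)]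
      have h4 := sub_le_exp_mul_position_sub hj₂ hN₂ (h.trans hlt.le)
      have h5 : Real.exp N * (position j₂ β - position j₂ a) ≤ Real.exp N * |b| :=
        mul_le_mul_of_nonneg_left (by linarith [le_abs_self b]) (Real.exp_pos _).le
      linarith
    · rw [abs_of_nonpos (by linarith)]
      have h4 := sub_le_exp_mul_position_sub hj₁ hN₁ h
      have h5 : Real.exp N * (position j₁ a - position j₁ α) ≤ Real.exp N * |b| :=
        mul_le_mul_of_nonneg_left (by linarith [neg_le_abs b]) (Real.exp_pos _).le
      linarith
  have h4 := abs_position_sub_sub_le hj₁ hj₂ hN₁ hN₂ hD a α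
  have h5 : position j₂ β - position j₂ α ≤ Real.exp N * D * (Real.exp N * |b|) := by
    have := mul_le_mul_of_nonneg_left h3 (by positivity : 0 ≤ Real.exp N * D)
    linarith [le_abs_self ((position j₁ α - position j₁ a) - (position j₂ α - position j₂ a))]
  calc β - α ≤ Real.exp N * (position j₂ β - position j₂ α) :=
        sub_le_exp_mul_position_sub hj₂ hN₂ hlt.le
    _ ≤ Real.exp N * (Real.exp N * D * (Real.exp N * |b|)) :=
        mul_le_mul_of_nonneg_left h5 (Real.exp_pos _).le
    _ = Real.exp (3 * N) * D * |b| := by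
        rw [show 3 * N = N + N + N by ring, Real.exp_add, Real.exp_add]; ring

theorem abs_shiftLabel_sub_le {A : ℝ} (hA : A ≤ 0) (hj₁ : Continuous j₁) (hj₂ : Continuous j₂)
    (hN₁ : ∀ x, |j₁ x| ≤ N) (hN₂ : ∀ x, |j₂ x| ≤ N) (hD : ∀ x, |j₁ x - j₂ x| ≤ D) (b a : ℝ) :
    |shiftLabel A b j₁ a - shiftLabel A b j₂ a| ≤ Real.exp (3 * N) * D * |b| := by
  refine abs_sub_le_iff.2 ⟨?_, shiftLabel_sub_le hA hj₁ hj₂ hN₁ hN₂ hD b a⟩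
  exact shiftLabel_sub_le hA hj₂ hj₁ hN₂ hN₁ (fun x => by rw [abs_sub_comm]; exact hD x) b a

theorem abs_integral_shiftLabel_le {A : ℝ} (hA : A ≤ 0) {V : ℝ → ℝ} (hV : ∀ x, |V x| ≤ N)
    (b : ℝ) (j : ℝ → ℝ) (a : ℝ) :
    |∫ x in (0 : ℝ)..shiftLabel A b j a, V x| ≤ N * -A := by
  have hN0 : 0 ≤ N := (abs_nonneg _).trans (hV 0)
  have hm := shiftLabel_mem hA b j a
  have h := intervalIntegral.norm_integral_le_of_norm_le_const (a := 0)
    (b := shiftLabel A b j a) (f := V) (C := N) fun x _ => hV x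
  rw [Real.norm_eq_abs, sub_zero, abs_of_nonpos hm.2] at h
  exact h.trans (mul_le_mul_of_nonneg_left (by linarith [hm.1]) hN0)

/-- The change of the integrand costs `-A * D`, since labels stay in `[A, 0]`; the moving endpoint
costs `N` times the displacement of the shifted label. -/
theorem abs_integral_shiftLabel_sub_le {A : ℝ} (hA : A ≤ 0) (hj₁ : Continuous j₁)
    (hj₂ : Continuous j₂) {V₁ V₂ : ℝ → ℝ} (hVc₁ : Continuous V₁) (hVc₂ : Continuous V₂)
    (hN₁ : ∀ x, |j₁ x| ≤ N) (hN₂ : ∀ x, |j₂ x| ≤ N) (hD : ∀ x, |j₁ x - j₂ x| ≤ D)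
    (hV₂ : ∀ x, |V₂ x| ≤ N) (hVD : ∀ x, |V₁ x - V₂ x| ≤ D) (b a : ℝ) :
    |(∫ x in (0 : ℝ)..shiftLabel A b j₁ a, V₁ x) - ∫ x in (0 : ℝ)..shiftLabel A b j₂ a, V₂ x|
      ≤ (-A + N * Real.exp (3 * N) * |b|) * D := by
  have hN0 : 0 ≤ N := (abs_nonneg _).trans (hV₂ 0)
  have h1 : (∫ x in (0 : ℝ)..shiftLabel A b j₁ a, V₁ x)
      - ∫ x in (0 : ℝ)..shiftLabel A b j₂ a, V₂ x
      = (∫ x in (0 : ℝ)..shiftLabel A b j₁ a, (V₁ x - V₂ x))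
        + ∫ x in shiftLabel A b j₂ a..shiftLabel A b j₁ a, V₂ x := by
    have h := intervalIntegral.integral_interval_sub_left (μ := volume)
      (hVc₂.intervalIntegrable 0 (shiftLabel A b j₁ a))
      (hVc₂.intervalIntegrable 0 (shiftLabel A b j₂ a))
    rw [intervalIntegral.integral_sub (hVc₁.intervalIntegrable _ _) (hVc₂.intervalIntegrable _ _),
      ← h]
    ring
  have h2 := abs_integral_shiftLabel_le hA hVD b j₁ a
  have h3 := intervalIntegral.norm_integral_le_of_norm_le_const (a := shiftLabel A b j₂ a)
    (b := shiftLabel A b j₁ a) (f := V₂) (C := N) fun x _ => hV₂ x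
  have h4 := mul_le_mul_of_nonneg_left (abs_shiftLabel_sub_le hA hj₁ hj₂ hN₁ hN₂ hD b a) hN0
  rw [h1]
  rw [Real.norm_eq_abs] at h3
  refine (abs_add_le _ _).trans ?_
  linarith

theorem abs_rate_le {A : ℝ} (hA : A ≤ 0) {V : ℝ → ℝ} (hV : ∀ x, |V x| ≤ N) (b₁ b₂ : ℝ)
    (j : ℝ → ℝ) (a : ℝ) : |rate A b₁ b₂ j V a| ≤ 3 * (N * -A) := by
  have h1 := abs_le.1 (abs_integral_shiftLabel_le hA hV b₁ j a)
  have h2 := abs_le.1 (abs_integral_shiftLabel_le hA hV b₂ j a)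
  rw [rate, abs_le]
  constructor <;> linarith [h1.1, h1.2, h2.1, h2.2]

theorem abs_rate_sub_le {A : ℝ} (hA : A ≤ 0) (hj₁ : Continuous j₁)
    (hj₂ : Continuous j₂) {V₁ V₂ : ℝ → ℝ} (hVc₁ : Continuous V₁) (hVc₂ : Continuous V₂)
    (hN₁ : ∀ x, |j₁ x| ≤ N) (hN₂ : ∀ x, |j₂ x| ≤ N) (hD : ∀ x, |j₁ x - j₂ x| ≤ D)
    (hV₂ : ∀ x, |V₂ x| ≤ N) (hVD : ∀ x, |V₁ x - V₂ x| ≤ D) (b₁ b₂ a : ℝ) :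
    |rate A b₁ b₂ j₁ V₁ a - rate A b₁ b₂ j₂ V₂ a|
      ≤ (2 * (-A + N * Real.exp (3 * N) * |b₁|) + (-A + N * Real.exp (3 * N) * |b₂|)) * D := by
  have h1 := abs_le.1 (abs_integral_shiftLabel_sub_le hA hj₁ hj₂ hVc₁ hVc₂ hN₁ hN₂ hD hV₂ hVD b₁ a)
  have h2 := abs_le.1 (abs_integral_shiftLabel_sub_le hA hj₁ hj₂ hVc₁ hVc₂ hN₁ hN₂ hD hV₂ hVD b₂ a)
  rw [rate, rate, abs_le]
  constructor <;> linarith [h1.1, h1.2, h2.1, h2.2]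

theorem continuous_rate {A b₁ b₂ : ℝ} {j V : ℝ → ℝ} (hj : Continuous j) (hN : ∀ x, |j x| ≤ N)
    (hV : Continuous V) : Continuous (rate A b₁ b₂ j V) := by
  have hp := continuous_position hj
  have hl := continuous_label hj hN
  have hi : Continuous fun a => ∫ x in (0 : ℝ)..a, V x :=
    intervalIntegral.continuous_primitive (fun a b => hV.intervalIntegrable a b) 0
  have hs : ∀ b, Continuous (shiftLabel A b j) := fun b => by
    unfold shiftLabel; fun_prop
  exact ((hi.comp (hs b₁)).const_smul (2 : ℝ)).sub (hi.comp (hs b₂))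

end Lipschitz

/-! ### Bounds for the vorticity source. -/

section source

variable {A : ℝ} {R : ℝ → ℝ} {N : ℝ}

theorem IsProfile.continuous (hR : IsProfile A R) : Continuous R := (hR.smooth 0).continuous

theorem IsProfile.hasDerivAt (hR : IsProfile A R) (a : ℝ) : HasDerivAt R (deriv R a) a :=
  ((hR.smooth 1).differentiable (by norm_num)).differentiableAt.hasDerivAt

theorem IsProfile.continuous_deriv (hR : IsProfile A R) : Continuous (deriv R) :=
  (hR.smooth 1).continuous_deriv (by norm_num)

theorem IsProfile.zero_of_notMem (hR : IsProfile A R) {a : ℝ} (ha : a ∉ Icc A 0) : R a = 0 := by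
  rcases not_and_or.1 ha with h | h
  · exact hR.zero_of_le a (le_of_not_ge h)
  · exact hR.zero_of_ge a (by linarith)

theorem IsProfile.deriv_zero_of_notMem (hR : IsProfile A R) {a : ℝ} (ha : a ∉ Icc A 0) :
    deriv R a = 0 := by
  have : R =ᶠ[𝓝 a] fun _ => 0 := by
    filter_upwards [isClosed_Icc.isOpen_compl.mem_nhds ha] with x hx
    exact hR.zero_of_notMem hx
  rw [this.deriv_eq, deriv_const]

theorem IsProfile.exists_bound (hR : IsProfile A R) : ∃ C, 1 ≤ C ∧ ∀ a, |deriv R a| ≤ C := by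
  obtain ⟨C, hC⟩ := (isCompact_Icc (a := A) (b := 0)).exists_bound_of_continuousOn
    hR.continuous_deriv.continuousOn
  refine ⟨max C 1, le_max_right _ _, fun a => ?_⟩
  by_cases ha : a ∈ Icc A 0
  · exact (hC a ha).trans (le_max_left _ _)
  · rw [hR.deriv_zero_of_notMem ha, abs_zero]
    exact zero_le_one.trans (le_max_right _ _)

theorem IsProfile.abs_le_one (hR : IsProfile A R) (a : ℝ) : |R a| ≤ 1 := by
  rw [abs_of_nonneg (hR.nonneg a)]; exact hR.le_one a

theorem exp_neg_position_le {j : ℝ → ℝ} (hj : Continuous j) (hN : ∀ x, |j x| ≤ N) {a : ℝ}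
    (ha : a ∈ Icc A 0) : -position j a ≤ Real.exp N * -A := by
  have h1 := abs_position_le hj hN a
  have h2 : Real.exp N * |a| ≤ Real.exp N * -A := by
    rw [abs_of_nonpos ha.2]
    exact mul_le_mul_of_nonneg_left (by linarith [ha.1]) (Real.exp_pos _).le
  linarith [neg_le_abs (position j a)]

/-- The factor `exp(-position)` has no uniform bound over all labels, but the profile and its
derivative vanish outside `[A, 0]`, so only labels in that interval matter. -/
theorem abs_source_le (hR : IsProfile A R) {C : ℝ} (hC1 : 1 ≤ C) (hC : ∀ a, |deriv R a| ≤ C)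
    {j : ℝ → ℝ} (hj : Continuous j) (hN : ∀ x, |j x| ≤ N) (a : ℝ) :
    |source R j a| ≤ Real.exp (Real.exp N * -A) * (C + Real.exp N) := by
  have hpos : 0 ≤ Real.exp (Real.exp N * -A) * (C + Real.exp N) := by positivity
  by_cases ha : a ∈ Icc A 0
  · rw [source, abs_mul, Real.abs_exp]
    refine mul_le_mul (Real.exp_le_exp.2 (exp_neg_position_le hj hN ha)) ?_ (abs_nonneg _)
      (Real.exp_pos _).le
    refine (abs_sub _ _).trans (add_le_add (hC a) ?_)
    rw [abs_mul, Real.abs_exp]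
    calc |R a| * Real.exp (j a) ≤ 1 * Real.exp N :=
          mul_le_mul (hR.abs_le_one a) (Real.exp_le_exp.2 (le_of_abs_le (hN a)))
            (Real.exp_pos _).le zero_le_one
      _ = _ := one_mul _
  · rw [source, hR.deriv_zero_of_notMem ha, hR.zero_of_notMem ha]
    simpa using hpos

theorem abs_source_sub_le (hR : IsProfile A R) {C : ℝ} (hC1 : 1 ≤ C) (hC : ∀ a, |deriv R a| ≤ C)
    {j₁ j₂ : ℝ → ℝ} (hj₁ : Continuous j₁) (hj₂ : Continuous j₂) {D : ℝ}
    (hN₁ : ∀ x, |j₁ x| ≤ N) (hN₂ : ∀ x, |j₂ x| ≤ N) (hD : ∀ x, |j₁ x - j₂ x| ≤ D) (a : ℝ) :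
    |source R j₁ a - source R j₂ a| ≤
      (Real.exp (Real.exp N * -A) * (Real.exp N * -A) * (C + Real.exp N)
        + Real.exp (Real.exp N * -A) * Real.exp N) * D := by
  have hD0 : 0 ≤ D := (abs_nonneg _).trans (hD 0)
  have hA : A ≤ 0 := by linarith [hR.le]
  have hA' : 0 ≤ -A := by linarith
  by_cases ha : a ∈ Icc A 0
  · have h1 : source R j₁ a - source R j₂ a
        = (Real.exp (-position j₁ a) - Real.exp (-position j₂ a))
            * (deriv R a - R a * Real.exp (j₁ a))
          - Real.exp (-position j₂ a) * (R a * (Real.exp (j₁ a) - Real.exp (j₂ a))) := by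
      unfold source; ring
    have h2 : |deriv R a - R a * Real.exp (j₁ a)| ≤ C + Real.exp N := by
      refine (abs_sub _ _).trans (add_le_add (hC a) ?_)
      rw [abs_mul, Real.abs_exp]
      calc |R a| * Real.exp (j₁ a) ≤ 1 * Real.exp N :=
            mul_le_mul (hR.abs_le_one a) (Real.exp_le_exp.2 (le_of_abs_le (hN₁ a)))
              (Real.exp_pos _).le zero_le_one
        _ = _ := one_mul _
    have h3 : |Real.exp (-position j₁ a) - Real.exp (-position j₂ a)|
        ≤ Real.exp (Real.exp N * -A) * (Real.exp N * D * -A) := by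
      refine (abs_exp_sub_exp_le (exp_neg_position_le hj₁ hN₁ ha)
        (exp_neg_position_le hj₂ hN₂ ha)).trans ?_
      refine mul_le_mul_of_nonneg_left ?_ (Real.exp_pos _).le
      have h4 := abs_position_sub_position_le hj₁ hj₂ hN₁ hN₂ hD a
      have h5 : Real.exp N * D * |a| ≤ Real.exp N * D * -A := by
        rw [abs_of_nonpos ha.2]
        exact mul_le_mul_of_nonneg_left (by linarith [ha.1]) (by positivity)
      rw [neg_sub_neg, abs_sub_comm]
      exact h4.trans h5
    have h6 : |R a * (Real.exp (j₁ a) - Real.exp (j₂ a))| ≤ Real.exp N * D := by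
      rw [abs_mul]
      calc _ ≤ 1 * (Real.exp N * D) := mul_le_mul (hR.abs_le_one a)
            (abs_exp_comp_sub_le hN₁ hN₂ hD a) (abs_nonneg _) zero_le_one
        _ = _ := one_mul _
    have h7 := Real.exp_le_exp.2 (exp_neg_position_le hj₂ hN₂ ha)
    rw [h1]
    refine (abs_sub _ _).trans ?_
    rw [abs_mul, abs_mul, Real.abs_exp]
    have h8 := mul_le_mul h3 h2 (abs_nonneg _) (by positivity)
    have h9 := mul_le_mul h7 h6 (abs_nonneg _) (by positivity)
    calc _ ≤ _ := add_le_add h8 h9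
      _ = _ := by ring
  · rw [source, source, hR.deriv_zero_of_notMem ha, hR.zero_of_notMem ha]
    have : 0 ≤ (Real.exp (Real.exp N * -A) * (Real.exp N * -A) * (C + Real.exp N)
        + Real.exp (Real.exp N * -A) * Real.exp N) * D := by positivity
    simpa using this

theorem continuous_source (hR : IsProfile A R) {j : ℝ → ℝ} (hj : Continuous j) :
    Continuous (source R j) := by
  have h1 := continuous_position hj
  have h2 := hR.continuous
  have h3 := hR.continuous_deriv
  unfold source; fun_prop

end source

/-! ### The Lagrangian equation as an ODE in a Banach space -/

/-- States: the logarithm of the Jacobian and the label derivative of the vorticity. -/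
abbrev FlowState := (ℝ →ᵇ ℝ) × (ℝ →ᵇ ℝ)

theorem abs_fst_le (x : FlowState) (a : ℝ) : |x.1 a| ≤ ‖x‖ :=
  (x.1.norm_coe_le_norm a).trans (norm_fst_le x)

theorem abs_snd_le (x : FlowState) (a : ℝ) : |x.2 a| ≤ ‖x‖ :=
  (x.2.norm_coe_le_norm a).trans (norm_snd_le x)

theorem norm_flowState_le {x : FlowState} {C : ℝ} (hC : 0 ≤ C) (h₁ : ∀ a, |x.1 a| ≤ C)
    (h₂ : ∀ a, |x.2 a| ≤ C) : ‖x‖ ≤ C :=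
  norm_prod_le_iff.2 ⟨(BoundedContinuousFunction.norm_le hC).2 h₁,
    (BoundedContinuousFunction.norm_le hC).2 h₂⟩

/-- The vector field governing the Lagrangian dynamics. -/
noncomputable def flowField {A : ℝ} {R : ℝ → ℝ} (hR : IsProfile A R) (b₁ b₂ : ℝ) (x : FlowState) :
    FlowState :=
  (BoundedContinuousFunction.ofNormedAddCommGroup (rate A b₁ b₂ x.1 x.2)
      (continuous_rate x.1.continuous (abs_fst_le x) x.2.continuous) _
      (abs_rate_le (by linarith [hR.le]) (abs_snd_le x) b₁ b₂ x.1),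
    BoundedContinuousFunction.ofNormedAddCommGroup (source R x.1)
      (continuous_source hR x.1.continuous) _
      (abs_source_le hR hR.exists_bound.choose_spec.1 hR.exists_bound.choose_spec.2
        x.1.continuous (abs_fst_le x)))

/-- Evaluating the vorticity at a shifted particle is Lipschitz in the Jacobian only if the
vorticity is Lipschitz in the label. Carrying its label derivative as a bounded state variable
ensures this in the sup norm. -/
theorem exists_lipschitzOnWith_flowField {A : ℝ} {R : ℝ → ℝ} (hR : IsProfile A R) (b₁ b₂ : ℝ)
    (N : ℕ) : ∃ K, LipschitzOnWith K (flowField hR b₁ b₂) (Metric.closedBall 0 N) := by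
  obtain ⟨C, hC1, hC⟩ := hR.exists_bound
  have hA : A ≤ 0 := by linarith [hR.le]
  have hA' : 0 ≤ -A := by linarith
  let K₁ : ℝ := 2 * (-A + N * Real.exp (3 * N) * |b₁|) + (-A + N * Real.exp (3 * N) * |b₂|)
  let K₂ : ℝ := Real.exp (Real.exp N * -A) * (Real.exp N * -A) * (C + Real.exp N)
        + Real.exp (Real.exp N * -A) * Real.exp N
  have hK₁ : 0 ≤ K₁ := by positivity
  have hK₂ : 0 ≤ K₂ := by positivity
  refine ⟨⟨K₁ + K₂, by positivity⟩, LipschitzOnWith.of_dist_le_mul fun x hx y hy => ?_⟩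
  rw [mem_closedBall_zero_iff] at hx hy
  have hx1 : ∀ a, |x.1 a| ≤ N := fun a => (abs_fst_le x a).trans hx
  have hy1 : ∀ a, |y.1 a| ≤ N := fun a => (abs_fst_le y a).trans hy
  have hy2 : ∀ a, |y.2 a| ≤ N := fun a => (abs_snd_le y a).trans hy
  have hd1 : ∀ a, |x.1 a - y.1 a| ≤ ‖x - y‖ := fun a => abs_fst_le (x - y) a
  have hd2 : ∀ a, |x.2 a - y.2 a| ≤ ‖x - y‖ := fun a => abs_snd_le (x - y) a
  rw [dist_eq_norm, dist_eq_norm]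
  refine norm_flowState_le (mul_nonneg (NNReal.coe_nonneg _) (norm_nonneg _))
    (fun a => ?_) (fun a => ?_)
  · have h := abs_rate_sub_le hA x.1.continuous y.1.continuous x.2.continuous y.2.continuous
      hx1 hy1 hd1 hy2 hd2 b₁ b₂ a
    exact h.trans (mul_le_mul_of_nonneg_right (le_add_of_nonneg_right hK₂) (norm_nonneg _))
  · have h := abs_source_sub_le hR hC1 hC x.1.continuous y.1.continuous hx1 hy1 hd1 a
    exact h.trans (mul_le_mul_of_nonneg_right (le_add_of_nonneg_left hK₁) (norm_nonneg _))

/-- Truncation of a bounded continuous function at level `N`. -/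
noncomputable def clampBCF (N : ℕ) (f : ℝ →ᵇ ℝ) : ℝ →ᵇ ℝ :=
  BoundedContinuousFunction.ofNormedAddCommGroup (fun a => max (-(N : ℝ)) (min N (f a)))
    (by fun_prop) N fun a => by
      have : (0 : ℝ) ≤ N := N.cast_nonneg
      rw [Real.norm_eq_abs, abs_le]
      exact ⟨le_max_left _ _, max_le (by linarith) (min_le_left _ _)⟩

theorem norm_clampBCF_le (N : ℕ) (f : ℝ →ᵇ ℝ) : ‖clampBCF N f‖ ≤ N :=
  BoundedContinuousFunction.norm_ofNormedAddCommGroup_le _ N.cast_nonneg _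

/-- Truncation of a state at level `N`. -/
noncomputable def clampState (N : ℕ) (x : FlowState) : FlowState := (clampBCF N x.1, clampBCF N x.2)

theorem norm_clampState_le (N : ℕ) (x : FlowState) : ‖clampState N x‖ ≤ N :=
  norm_prod_le_iff.2 ⟨norm_clampBCF_le N x.1, norm_clampBCF_le N x.2⟩

theorem clampState_eq {N : ℕ} {x : FlowState} (hx : ‖x‖ ≤ N) : clampState N x = x := by
  have h : ∀ y : ℝ, |y| ≤ N → max (-(N : ℝ)) (min N y) = y := fun y hy => by
    rw [min_eq_right (le_of_abs_le hy), max_eq_right (neg_le_of_abs_le hy)]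
  refine Prod.ext ?_ ?_ <;> ext a
  · exact h _ ((abs_fst_le x a).trans hx)
  · exact h _ ((abs_snd_le x a).trans hx)

theorem lipschitzWith_clampState (N : ℕ) : LipschitzWith 1 (clampState N) := by
  refine LipschitzWith.of_dist_le_mul fun x y => ?_
  have h : ∀ y z : ℝ, |max (-(N : ℝ)) (min N y) - max (-(N : ℝ)) (min N z)| ≤ |y - z| :=
    fun y z => (abs_max_sub_max_le_max _ _ _ _).trans (by
      rw [sub_self, abs_zero]
      refine max_le (abs_nonneg _) ((abs_min_sub_min_le_max _ _ _ _).trans ?_)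
      rw [sub_self, abs_zero]
      exact max_le (abs_nonneg _) le_rfl)
  rw [dist_eq_norm, dist_eq_norm, NNReal.coe_one, one_mul]
  refine norm_flowState_le (norm_nonneg _) (fun a => ?_) (fun a => ?_)
  · exact (h _ _).trans (abs_fst_le (x - y) a)
  · exact (h _ _).trans (abs_snd_le (x - y) a)

/-- A solution of the Lagrangian equation on the time set `I`. -/
def IsFlow {A : ℝ} {R : ℝ → ℝ} (hR : IsProfile A R) (b₁ b₂ : ℝ) (I : Set ℝ) (α : ℝ → FlowState) :
    Prop :=
  α 0 = 0 ∧ ∀ t ∈ I, HasDerivWithinAt α (flowField hR b₁ b₂ (α t)) I t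

theorem exists_unbounded_flow {A : ℝ} {R : ℝ → ℝ} (hR : IsProfile A R) (b₁ b₂ : ℝ) {T₀ : ℝ}
    (hT₀ : 0 < T₀) (hno : ¬ ∃ α, IsFlow hR b₁ b₂ (Icc 0 T₀) α) :
    ∃ T, 0 < T ∧ T ≤ T₀ ∧ ∃ α, IsFlow hR b₁ b₂ (Ico 0 T) α ∧
      ∀ N : ℕ, ∃ t ∈ Ico 0 T, N < ‖α t‖ := by
  obtain ⟨T, h0, h1, α, h2, h3, h4⟩ := exists_unbounded_solution
    (exists_lipschitzOnWith_flowField hR b₁ b₂) lipschitzWith_clampState norm_clampState_le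
    (fun N x hx => clampState_eq hx) hT₀ hno
  exact ⟨T, h0, h1, α, ⟨h2, h3⟩, h4⟩

/-! ### Eulerian quantities attached to a state -/

/-- Evaluation is a continuous ring homomorphism and hence commutes with the exponential series.
This makes positions differentiable in the state, through the Banach algebra exponential. -/
theorem exp_bcf_apply (f : ℝ →ᵇ ℝ) (a : ℝ) : (NormedSpace.exp f) a = Real.exp (f a) := by
  let φ : (ℝ →ᵇ ℝ) →+* ℝ :=
    { toFun := fun g => g a, map_one' := rfl, map_mul' := fun _ _ => rfl, map_zero' := rfl, map_add' := fun _ _ => rfl }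
  let : NormedAlgebra ℚ (ℝ →ᵇ ℝ) := NormedAlgebra.restrictScalars ℚ ℝ _
  rw [Real.exp_eq_exp_ℝ]
  exact NormedSpace.map_exp φ (BoundedContinuousFunction.evalCLM ℝ a).continuous f

/-- Integration over an interval, as a continuous linear functional on bounded functions. -/
noncomputable def integralCLM (a : ℝ) : (ℝ →ᵇ ℝ) →L[ℝ] ℝ :=
  LinearMap.mkContinuous
    { toFun := fun f => ∫ x in (0 : ℝ)..a, f x
      map_add' := fun f g => intervalIntegral.integral_add (f.continuous.intervalIntegrable _ _)
        (g.continuous.intervalIntegrable _ _)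
      map_smul' := fun c f => intervalIntegral.integral_const_mul c f } |a| fun f => by
    have := intervalIntegral.norm_integral_le_of_norm_le_const (a := 0) (b := a) (f := f)
      (C := ‖f‖) fun x _ => f.norm_coe_le_norm x
    rw [sub_zero] at this
    rwa [mul_comm]

theorem hasDerivWithinAt_position {j : ℝ → ℝ →ᵇ ℝ} {j' : ℝ →ᵇ ℝ} {I : Set ℝ} {t : ℝ}
    (h : HasDerivWithinAt j j' I t) (a : ℝ) :
    HasDerivWithinAt (fun τ => position (j τ) a) (∫ x in (0 : ℝ)..a, Real.exp (j t x) * j' x) I t := by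
  have h1 := (hasFDerivAt_exp (𝕂 := ℝ) (x := j t)).comp_hasDerivWithinAt t h
  have h2 := (integralCLM a).hasFDerivAt.comp_hasDerivWithinAt t h1
  have h3 : (fun τ => position (j τ) a) = integralCLM a ∘ NormedSpace.exp ∘ j := by
    ext τ
    refine intervalIntegral.integral_congr fun x _ => (exp_bcf_apply _ _).symm
  rw [h3]
  refine h2.congr_deriv (intervalIntegral.integral_congr fun x _ => ?_)
  simp [exp_bcf_apply]

/-- The vorticity of a state as a function of the logarithmic position. -/
noncomputable def vorticity (A : ℝ) (x : FlowState) (s : ℝ) : ℝ :=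
  ∫ y in (0 : ℝ)..max A (min 0 (label x.1 s)), x.2 y

/-- The velocity in logarithmic coordinates. -/
noncomputable def logVel (b₁ b₂ : ℝ) (w : ℝ → ℝ) (s : ℝ) : ℝ :=
  (∫ y in (s + b₂)..0, w y) - 2 * ∫ y in (s + b₁)..0, w y

theorem hasDerivAt_integral_left {w : ℝ → ℝ} (hw : Continuous w) (s b : ℝ) :
    HasDerivAt (fun s => ∫ y in (s + b)..0, w y) (-w (s + b)) s := by
  have h := intervalIntegral.integral_hasDerivAt_left (hw.intervalIntegrable (s + b) 0)
    (hw.stronglyMeasurableAtFilter _ _) hw.continuousAt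
  exact h.comp_add_const s b

theorem hasDerivAt_logVel {w : ℝ → ℝ} (hw : Continuous w) (b₁ b₂ s : ℝ) :
    HasDerivAt (logVel b₁ b₂ w) (2 * w (s + b₁) - w (s + b₂)) s := by
  have h := (hasDerivAt_integral_left hw s b₂).sub ((hasDerivAt_integral_left hw s b₁).const_mul 2)
  exact h.congr_deriv (by ring)

/-! ### Particle velocity and vorticity along a flow. -/

section State

variable {A : ℝ} {R : ℝ → ℝ}

theorem continuous_state_primitive (x : FlowState) : Continuous fun a => ∫ y in (0 : ℝ)..a, x.2 y :=
  intervalIntegral.continuous_primitive (fun a b => x.2.continuous.intervalIntegrable a b) 0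

theorem continuous_vorticity (x : FlowState) : Continuous (vorticity A x) := by
  have h := continuous_label x.1.continuous (abs_fst_le x)
  exact (continuous_state_primitive x).comp (by fun_prop)

theorem vorticity_of_nonneg (hA : A ≤ 0) (x : FlowState) {s : ℝ} (hs : 0 ≤ s) :
    vorticity A x s = 0 := by
  have h : 0 ≤ label x.1 s := by
    rw [le_label_iff x.1.continuous (abs_fst_le x), position_zero]; exact hs
  rw [vorticity, min_eq_left h, max_eq_right hA, intervalIntegral.integral_same]

theorem vorticity_position (x : FlowState) (a : ℝ) :
    vorticity A x (position x.1 a) = ∫ y in (0 : ℝ)..max A (min 0 a), x.2 y := by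
  rw [vorticity, label_position x.1.continuous]

/-- The rate is the `s`-derivative of the logarithmic velocity at the particle, so the integrand is
the label derivative of velocity along particles. Fixing particle `0` at the origin produces the
subtracted constant, removed later by `IsControlled.logVel_zero`. -/
theorem integral_exp_mul_rate (b₁ b₂ : ℝ) (x : FlowState) (a : ℝ) :
    (∫ y in (0 : ℝ)..a, Real.exp (x.1 y) * rate A b₁ b₂ x.1 x.2 y)
      = logVel b₁ b₂ (vorticity A x) (position x.1 a) - logVel b₁ b₂ (vorticity A x) 0 := by
  have h : ∀ y, HasDerivAt (fun y => logVel b₁ b₂ (vorticity A x) (position x.1 y))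
      (Real.exp (x.1 y) * rate A b₁ b₂ x.1 x.2 y) y := fun y => by
    refine ((hasDerivAt_logVel (continuous_vorticity x) b₁ b₂ _).comp y
      (hasDerivAt_position x.1.continuous y)).congr_deriv ?_
    rw [mul_comm]; rfl
  have hc := continuous_rate (A := A) (b₁ := b₁) (b₂ := b₂) x.1.continuous (abs_fst_le x)
    x.2.continuous
  rw [intervalIntegral.integral_eq_sub_of_hasDerivAt (fun y _ => h y)
    (Continuous.intervalIntegrable (by fun_prop) _ _), position_zero]

/-- The source is the label derivative of `ρ / x` along particles; the boundary term at label `0`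
vanishes with the profile. -/
theorem integral_source (hR : IsProfile A R) {j : ℝ → ℝ} (hj : Continuous j) (c : ℝ) :
    ∫ y in (0 : ℝ)..c, source R j y = R c * Real.exp (-position j c) := by
  have h : ∀ y, HasDerivAt (fun y => R y * Real.exp (-position j y)) (source R j y) y := fun y => by
    refine ((hR.hasDerivAt y).mul (hasDerivAt_position hj y).neg.exp).congr_deriv ?_
    simp only [source, Pi.neg_apply]; ring
  rw [intervalIntegral.integral_eq_sub_of_hasDerivAt (fun y _ => h y)
    ((continuous_source hR hj).intervalIntegrable _ _), hR.zero_of_ge 0 (by norm_num)]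
  ring

theorem hasDerivWithinAt_fst {α : ℝ → FlowState} {α' : FlowState} {I : Set ℝ} {t : ℝ}
    (h : HasDerivWithinAt α α' I t) : HasDerivWithinAt (fun τ => (α τ).1) α'.1 I t :=
  (ContinuousLinearMap.fst ℝ (ℝ →ᵇ ℝ) (ℝ →ᵇ ℝ)).hasFDerivAt.comp_hasDerivWithinAt t h

theorem hasDerivWithinAt_snd {α : ℝ → FlowState} {α' : FlowState} {I : Set ℝ} {t : ℝ}
    (h : HasDerivWithinAt α α' I t) : HasDerivWithinAt (fun τ => (α τ).2) α'.2 I t :=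
  (ContinuousLinearMap.snd ℝ (ℝ →ᵇ ℝ) (ℝ →ᵇ ℝ)).hasFDerivAt.comp_hasDerivWithinAt t h

variable {hR : IsProfile A R} {b₁ b₂ : ℝ} {α : ℝ → FlowState} {I : Set ℝ}

theorem IsFlow.continuousOn (h : IsFlow hR b₁ b₂ I α) : ContinuousOn α I :=
  fun t ht => (h.2 t ht).continuousWithinAt

theorem IsFlow.mono {J : Set ℝ} (h : IsFlow hR b₁ b₂ I α) (hJ : J ⊆ I) : IsFlow hR b₁ b₂ J α :=
  ⟨h.1, fun t ht => (h.2 t (hJ ht)).mono hJ⟩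

theorem IsFlow.hasDerivWithinAt_position (h : IsFlow hR b₁ b₂ I α) {t : ℝ} (ht : t ∈ I) (a : ℝ) :
    HasDerivWithinAt (fun τ => position (α τ).1 a)
      (logVel b₁ b₂ (vorticity A (α t)) (position (α t).1 a)
        - logVel b₁ b₂ (vorticity A (α t)) 0) I t := by
  rw [← integral_exp_mul_rate]
  exact _root_.hasDerivWithinAt_position (hasDerivWithinAt_fst (h.2 t ht)) a

theorem continuous_position_const (a : ℝ) : Continuous fun j : ℝ →ᵇ ℝ => position j a :=
  continuous_iff_continuousAt.2 fun j => by
    have h : ContinuousAt (fun j : ℝ →ᵇ ℝ => integralCLM a (NormedSpace.exp j)) j :=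
      (integralCLM a).continuous.continuousAt.comp
        (hasFDerivAt_exp (𝕂 := ℝ) (x := j)).continuousAt
    convert h using 2
    exact intervalIntegral.integral_congr fun x _ => (exp_bcf_apply _ _).symm

theorem IsFlow.continuousOn_position (h : IsFlow hR b₁ b₂ I α) (a : ℝ) :
    ContinuousOn (fun t => position (α t).1 a) I :=
  (continuous_position_const a).comp_continuousOn (continuous_fst.comp_continuousOn h.continuousOn)

/-- Integrating the equation for the second component in the label and then in time recovers the
transport of vorticity with forcing `ρ / x`, starting from zero. -/
theorem IsFlow.vorticity_position {t₁ : ℝ} (h : IsFlow hR b₁ b₂ (Icc 0 t₁) α) {t : ℝ}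
    (ht : t ∈ Icc 0 t₁) (a : ℝ) :
    vorticity A (α t) (position (α t).1 a)
      = R a * ∫ τ in (0 : ℝ)..t, Real.exp (-position (α τ).1 a) := by
  have hA : A ≤ 0 := by linarith [hR.le]
  rw [_root_.vorticity_position]
  set c := max A (min 0 a) with hc
  have hderiv : ∀ τ ∈ Icc 0 t₁, HasDerivWithinAt (fun σ => ∫ y in (0 : ℝ)..c, (α σ).2 y)
      (R c * Real.exp (-position (α τ).1 c)) (Icc 0 t₁) τ := fun τ hτ => by
    rw [← integral_source hR (α τ).1.continuous]
    exact (integralCLM c).hasFDerivAt.comp_hasDerivWithinAt τ (hasDerivWithinAt_snd (h.2 τ hτ))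
  have hcont : ContinuousOn (fun τ => R c * Real.exp (-position (α τ).1 c)) (Icc 0 t) :=
    ((h.continuousOn_position c).mono (Icc_subset_Icc_right ht.2)).neg.rexp.const_smul (R c)
  have hftc := intervalIntegral.integral_eq_sub_of_hasDerivAt_of_le ht.1
    (fun τ hτ => ((hderiv τ ⟨hτ.1, hτ.2.trans ht.2⟩).continuousWithinAt).mono
      (Icc_subset_Icc_right ht.2))
    (fun τ hτ => (hderiv τ ⟨hτ.1.le, hτ.2.le.trans ht.2⟩).hasDerivAt
      (Icc_mem_nhds hτ.1 (hτ.2.trans_le ht.2))) (hcont.intervalIntegrable_of_Icc ht.1)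
  rw [h.1] at hftc
  simp only [Prod.snd_zero, BoundedContinuousFunction.coe_zero, Pi.zero_apply,
    intervalIntegral.integral_zero, sub_zero] at hftc
  rw [← hftc, intervalIntegral.integral_const_mul]
  -- Outside `[A, 0]` the clamp changes the label, but the profile vanishes at both the original and
  -- the clamped label.
  by_cases ha : a ∈ Icc A 0
  · rw [hc, min_eq_right ha.2, max_eq_right ha.1]
  · rw [hR.zero_of_notMem ha]
    have : R c = 0 := by
      rcases not_and_or.1 ha with h1 | h1
      · refine hR.zero_of_le c ?_
        rw [hc, min_eq_right (by linarith), max_eq_left (by linarith)]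
      · refine hR.zero_of_ge c ?_
        rw [hc, min_eq_left (by linarith), max_eq_right hA]; norm_num
    rw [this]; simp

end State

/-- The properties of the particle trajectories `S` and of the vorticity `w` in logarithmic
coordinates, on the time interval `[0, t₁]`. -/
structure IsLagrangian (b₁ b₂ t₁ : ℝ) (R : ℝ → ℝ) (S w : ℝ → ℝ → ℝ) : Prop where
  strictMono : ∀ t ∈ Icc 0 t₁, StrictMono (S t)
  surjective : ∀ t ∈ Icc 0 t₁, Function.Surjective (S t)
  init : ∀ a, S 0 a = a
  zero : ∀ t ∈ Icc 0 t₁, S t 0 = 0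
  deriv : ∀ t ∈ Icc 0 t₁, ∀ a, HasDerivWithinAt (fun τ => S τ a)
    (logVel b₁ b₂ (w t) (S t a) - logVel b₁ b₂ (w t) 0) (Icc 0 t₁) t
  vort : ∀ t ∈ Icc 0 t₁, ∀ a, w t (S t a) = R a * ∫ τ in (0 : ℝ)..t, Real.exp (-S τ a)
  cont : ∀ t ∈ Icc 0 t₁, Continuous (w t)
  bound : ∃ C, ∀ t ∈ Icc 0 t₁, ∀ s, |logVel b₁ b₂ (w t) s| ≤ C

theorem abs_integral_le_of_support {w : ℝ → ℝ} (hw : Continuous w) {M K : ℝ} (hK : 0 ≤ K)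
    (hM : ∀ s, |w s| ≤ M) (hl : ∀ s ≤ -K, w s = 0) (hr : ∀ s ≥ 0, w s = 0) (s : ℝ) :
    |∫ y in s..0, w y| ≤ M * K := by
  have hM0 : 0 ≤ M := (abs_nonneg _).trans (hM 0)
  have hbound : ∀ u v : ℝ, |u - v| ≤ K → |∫ y in v..u, w y| ≤ M * K := fun u v huv =>
    (intervalIntegral.norm_integral_le_of_norm_le_const (f := w) fun x _ => hM x).trans
      (mul_le_mul_of_nonneg_left huv hM0)
  rcases le_total s 0 with h0 | h0
  · rcases le_total s (-K) with h1 | h1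
    · rw [← intervalIntegral.integral_add_adjacent_intervals (hw.intervalIntegrable s (-K))
        (hw.intervalIntegrable (-K) 0), intervalIntegral.integral_congr (g := fun _ => 0),
        intervalIntegral.integral_zero, zero_add]
      · exact hbound _ _ (by rw [sub_neg_eq_add, zero_add, abs_of_nonneg hK])
      · intro y hy
        rw [uIcc_of_le h1] at hy
        exact hl y hy.2
    · exact hbound _ _ (by rw [zero_sub, abs_neg, abs_of_nonpos h0]; linarith)
  · rw [intervalIntegral.integral_congr (g := fun _ => 0), intervalIntegral.integral_zero, abs_zero]
    · positivity
    · intro y hy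
      rw [uIcc_of_ge h0] at hy
      exact hr y hy.1

theorem IsFlow.isLagrangian {A : ℝ} {R : ℝ → ℝ} {hR : IsProfile A R} {b₁ b₂ t₁ : ℝ}
    {α : ℝ → FlowState} (h : IsFlow hR b₁ b₂ (Icc 0 t₁) α) :
    IsLagrangian b₁ b₂ t₁ R (fun t => position (α t).1) (fun t => vorticity A (α t)) where
  strictMono t _ := position_strictMono (α t).1.continuous
  surjective t _ := position_surjective (α t).1.continuous (abs_fst_le (α t))
  init a := by simp [h.1, position]
  zero t _ := position_zero
  deriv t ht a := h.hasDerivWithinAt_position ht a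
  vort t ht a := h.vorticity_position ht a
  cont t _ := continuous_vorticity (α t)
  bound := by
    have hA : A ≤ 0 := by linarith [hR.le]
    obtain ⟨N, hN⟩ := isCompact_Icc.exists_bound_of_continuousOn h.continuousOn
    have hF : ∀ t ∈ Icc 0 t₁, ∀ s, |∫ y in s..0, vorticity A (α t) y|
        ≤ (N * -A) * (Real.exp N * -A) := by
      intro t ht s
      have hj : ∀ x, |(α t).1 x| ≤ N := fun x => (abs_fst_le _ x).trans (hN t ht)
      have hV : ∀ x, |(α t).2 x| ≤ N := fun x => (abs_snd_le _ x).trans (hN t ht)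
      refine abs_integral_le_of_support (continuous_vorticity _)
        (mul_nonneg (Real.exp_pos _).le (by linarith)) (fun s => ?_) (fun s hs => ?_)
        (fun s hs => vorticity_of_nonneg hA _ hs) s
      · have := abs_integral_shiftLabel_le hA hV 0 (α t).1 (label (α t).1 s)
        rwa [shiftLabel, add_zero, position_label (α t).1.continuous hj] at this
      · have h1 : label (α t).1 s ≤ A := by
          rw [label_le_iff (α t).1.continuous hj]
          have := exp_neg_position_le (α t).1.continuous hj (a := A) ⟨le_rfl, hA⟩
          linarith
        rw [← position_label (α t).1.continuous hj s, h.vorticity_position ht,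
          hR.zero_of_le _ h1, zero_mul]
    refine ⟨3 * ((N * -A) * (Real.exp N * -A)), fun t ht s => ?_⟩
    have h1 := abs_le.1 (hF t ht (s + b₂))
    have h2 := abs_le.1 (hF t ht (s + b₁))
    rw [logVel, abs_le]
    constructor <;> linarith [h1.1, h1.2, h2.1, h2.2]

/-! ### Finite time blow-up of Lagrangian flows -/

/-! ### One-sided mean value inequalities in time. -/

section MeanValue

variable {f f' : ℝ → ℝ} {t₁ : ℝ}

theorem sub_le_of_hasDerivWithinAt (hf : ∀ t ∈ Icc 0 t₁, HasDerivWithinAt f (f' t) (Icc 0 t₁) t)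
    {τ σ B : ℝ} (hτ : 0 ≤ τ) (hτσ : τ ≤ σ) (hσ : σ ≤ t₁) (hB : ∀ x ∈ Icc τ σ, f' x ≤ B) :
    f σ - f τ ≤ B * (σ - τ) := by
  have hsub : Icc τ σ ⊆ Icc 0 t₁ := Icc_subset_Icc hτ hσ
  have hd : ∀ x ∈ Ioo τ σ, HasDerivAt f (f' x) x := fun x hx =>
    (hf x (hsub (Ioo_subset_Icc_self hx))).hasDerivAt
      (Icc_mem_nhds (hτ.trans_lt hx.1) (hx.2.trans_le hσ))
  refine (convex_Icc τ σ).image_sub_le_mul_sub_of_deriv_le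
    (fun x hx => ((hf x (hsub hx)).continuousWithinAt).mono hsub) ?_ ?_ τ (left_mem_Icc.2 hτσ) σ
    (right_mem_Icc.2 hτσ) hτσ
  · rw [interior_Icc]
    exact fun x hx => (hd x hx).differentiableAt.differentiableWithinAt
  · rw [interior_Icc]
    intro x hx
    rw [(hd x hx).deriv]
    exact hB x (Ioo_subset_Icc_self hx)

/-- The tool for continuing the bootstrap: the good rate `B` holds up to time `t`, and the crude
rate `C` is paid only for a further time at most `ε`. -/
theorem sub_le_of_two_bounds (hf : ∀ t ∈ Icc 0 t₁, HasDerivWithinAt f (f' t) (Icc 0 t₁) t)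
    {t ε τ σ B C : ℝ} (hτ : 0 ≤ τ) (hτσ : τ ≤ σ) (hσ : σ ≤ t₁) (hσt : σ ≤ t + ε) (hε : 0 ≤ ε)
    (hB0 : 0 ≤ B) (hC0 : 0 ≤ C) (hB : ∀ x ∈ Icc 0 t₁, x ≤ t → f' x ≤ B)
    (hC : ∀ x ∈ Icc 0 t₁, f' x ≤ C) : f σ - f τ ≤ B * (σ - τ) + C * ε := by
  have hCε : 0 ≤ C * ε := mul_nonneg hC0 hε
  have hBσ : 0 ≤ B * (σ - τ) := mul_nonneg hB0 (by linarith)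
  rcases le_total σ t with h1 | h1
  · have := sub_le_of_hasDerivWithinAt hf hτ hτσ hσ fun x hx =>
      hB x ⟨hτ.trans hx.1, hx.2.trans hσ⟩ (hx.2.trans h1)
    linarith
  rcases le_total t τ with h2 | h2
  · have := sub_le_of_hasDerivWithinAt hf hτ hτσ hσ fun x hx =>
      hC x ⟨hτ.trans hx.1, hx.2.trans hσ⟩
    have h3 : C * (σ - τ) ≤ C * ε := mul_le_mul_of_nonneg_left (by linarith) hC0
    linarith
  · have h3 := sub_le_of_hasDerivWithinAt hf hτ h2 (h1.trans hσ) fun x hx =>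
      hB x ⟨hτ.trans hx.1, hx.2.trans (h1.trans hσ)⟩ hx.2
    have h4 := sub_le_of_hasDerivWithinAt hf (hτ.trans h2) h1 hσ fun x hx =>
      hC x ⟨(hτ.trans h2).trans hx.1, hx.2.trans hσ⟩
    have h5 : C * (σ - t) ≤ C * ε := mul_le_mul_of_nonneg_left (by linarith) hC0
    have h6 : B * (t - τ) ≤ B * (σ - τ) := mul_le_mul_of_nonneg_left (by linarith) hB0
    linarith

end MeanValue

/-- The scalar differential inequality behind the blow-up. -/
theorem false_of_collapse {y y' h : ℝ → ℝ} {κ T : ℝ} (hκ : 0 < κ) (hT : 0 < T)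
    (hy : ∀ t ∈ Icc 0 T, HasDerivWithinAt y (y' t) (Icc 0 T) t)
    (hh : ∀ t ∈ Icc 0 T, HasDerivWithinAt h (Real.exp (-y t)) (Icc 0 T) t) (hh0 : h 0 = 0)
    (hle : ∀ t ∈ Icc 0 T, y' t ≤ 1 - κ * h t)
    (hy0 : 1 / κ + 16 / (κ * T ^ 2) ≤ Real.exp (-y 0)) : False := by
  -- This constant gives `h(T/2) ≥ B * T / 2 = 8 / (κ * T)`. From there `h' ≥ κ / 4 * h ^ 2` lowers
  -- `1 / h` by `κ * T / 8` over the remaining half of the interval, which is all that is left of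
  -- it.
  set B := 16 / (κ * T ^ 2) with hB
  have hB0 : 0 < B := by positivity
  -- a Lyapunov function
  have hφ : ∀ t ∈ Icc 0 T, Real.exp (-y 0) ≤ Real.exp (-y t) - κ / 2 * h t ^ 2 + h t := by
    intro t ht
    have hd : ∀ t ∈ Icc 0 T, HasDerivWithinAt
        (fun t => -(Real.exp (-y t) - κ / 2 * h t ^ 2 + h t))
        (-(Real.exp (-y t) * (-y' t) - κ / 2 * (2 * h t * Real.exp (-y t)) + Real.exp (-y t)))
        (Icc 0 T) t := fun t ht => by
      have h1 := (((hh t ht).pow 2).const_mul (κ / 2))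
      refine (((hy t ht).neg.exp.sub h1).add (hh t ht)).neg.congr_deriv ?_
      simp
    have := sub_le_of_hasDerivWithinAt hd le_rfl ht.1 ht.2 (B := 0) fun x hx => by
      have hx' : x ∈ Icc 0 T := ⟨hx.1, hx.2.trans ht.2⟩
      have h1 := hle x hx'
      have h2 := Real.exp_pos (-y x)
      nlinarith
    simp only [hh0] at this
    linarith
  -- Half of the quadratic term absorbs the linear one by completing the square, at the price of the
  -- `1 / κ` assumed initially.
  have hh' : ∀ t ∈ Icc 0 T, κ / 4 * h t ^ 2 + B ≤ Real.exp (-y t) := by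
    intro t ht
    have h1 := hφ t ht
    have h2 : κ / 4 * h t ^ 2 - h t + 1 / κ = κ / 4 * (h t - 2 / κ) ^ 2 := by
      field_simp; ring
    have h3 : 0 ≤ κ / 4 * (h t - 2 / κ) ^ 2 := by positivity
    linarith
  have hlow : ∀ t ∈ Icc 0 T, B * t ≤ h t := by
    intro t ht
    have hd : ∀ t ∈ Icc 0 T, HasDerivWithinAt (fun t => -h t) (-Real.exp (-y t)) (Icc 0 T) t :=
      fun t ht => (hh t ht).neg
    have := sub_le_of_hasDerivWithinAt hd le_rfl ht.1 ht.2 (B := -B) fun x hx => by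
      have := hh' x ⟨hx.1, hx.2.trans ht.2⟩
      have h3 : 0 ≤ κ / 4 * h x ^ 2 := by positivity
      linarith
    simp only [hh0] at this
    linarith
  have hpos : ∀ t ∈ Icc (T / 2) T, 0 < h t := fun t ht => by
    have := hlow t ⟨by linarith [ht.1], ht.2⟩
    have h2 : 0 < B * t := mul_pos hB0 (by linarith [ht.1])
    linarith
  have hinv : (h T)⁻¹ - (h (T / 2))⁻¹ ≤ -(κ / 4) * (T - T / 2) := by
    have hmem : ∀ t ∈ Icc (T / 2) T, t ∈ Icc 0 T := fun t ht => ⟨by linarith [ht.1], ht.2⟩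
    have hd : ∀ x ∈ Ioo (T / 2) T,
        HasDerivAt (fun t => (h t)⁻¹) (-Real.exp (-y x) / h x ^ 2) x := fun x hx => by
      have := (hh x (hmem x (Ioo_subset_Icc_self hx))).hasDerivAt
        (Icc_mem_nhds (by linarith [hx.1]) hx.2)
      exact this.inv (hpos x (Ioo_subset_Icc_self hx)).ne'
    refine (convex_Icc (T / 2) T).image_sub_le_mul_sub_of_deriv_le (f := fun t => (h t)⁻¹)
      (fun x hx => ?_) ?_ ?_ (T / 2) ⟨le_rfl, by linarith⟩ T ⟨by linarith, le_rfl⟩ (by linarith)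
    · exact (((hh x (hmem x hx)).continuousWithinAt).mono hmem).inv₀ (hpos x hx).ne'
    · rw [interior_Icc]
      exact fun x hx => (hd x hx).differentiableAt.differentiableWithinAt
    · rw [interior_Icc]
      intro x hx
      have h1 := hpos x (Ioo_subset_Icc_self hx)
      have h2 := hh' x (hmem x (Ioo_subset_Icc_self hx))
      rw [(hd x hx).deriv, div_le_iff₀ (by positivity)]
      linarith
  have h1 : 0 < (h T)⁻¹ := inv_pos.2 (hpos T ⟨by linarith, le_rfl⟩)
  have h2 : (h (T / 2))⁻¹ ≤ (B * (T / 2))⁻¹ :=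
    inv_anti₀ (by positivity) (hlow (T / 2) ⟨by linarith, by linarith⟩)
  have h3 : (B * (T / 2))⁻¹ = κ * T / 8 := by
    rw [hB]; field_simp; norm_num
  rw [h3] at h2
  linarith

/-! ### The bootstrap for the velocity and the collapse of particles. -/

section Bootstrap

variable {A b₁ b₂ t₁ : ℝ} {R : ℝ → ℝ} {S w : ℝ → ℝ → ℝ}

/-- The integral of the vorticity to the right of a point. -/
noncomputable def mass (w : ℝ → ℝ) (s : ℝ) : ℝ := ∫ y in s..0, w y

theorem logVel_eq_mass (b₁ b₂ : ℝ) (w : ℝ → ℝ) (s : ℝ) :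
    logVel b₁ b₂ w s = mass w (s + b₂) - 2 * mass w (s + b₁) := rfl

theorem mass_antitone {w : ℝ → ℝ} (hw : Continuous w) (h0 : ∀ s, 0 ≤ w s) : Antitone (mass w) := by
  intro s s' hs
  have h := intervalIntegral.integral_add_adjacent_intervals (μ := volume)
    (hw.intervalIntegrable s s') (hw.intervalIntegrable s' 0)
  have h1 := intervalIntegral.integral_nonneg (μ := volume) hs fun x _ => h0 x
  unfold mass
  linarith

theorem mass_eq_zero {w : ℝ → ℝ} {M s : ℝ} (hM : M ≤ 0) (hw : ∀ s ≥ M, w s = 0) (hs : M ≤ s) :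
    mass w s = 0 := by
  unfold mass
  rw [intervalIntegral.integral_congr (g := fun _ => 0), intervalIntegral.integral_zero]
  intro y hy
  exact hw y ((le_min hs hM).trans hy.1)

theorem mass_nonneg {w : ℝ → ℝ} (hw : Continuous w) (h0 : ∀ s, 0 ≤ w s) {M : ℝ} (hM : M ≤ 0)
    (hwM : ∀ s ≥ M, w s = 0) (s : ℝ) : 0 ≤ mass w s := by
  rcases le_total M s with h | h
  · exact (mass_eq_zero hM hwM h).ge
  · exact (mass_eq_zero hM hwM le_rfl).ge.trans (mass_antitone hw h0 h)

namespace IsLagrangian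

theorem hist_nonneg {σ : ℝ} (hσ : 0 ≤ σ) (a : ℝ) :
    0 ≤ ∫ τ in (0 : ℝ)..σ, Real.exp (-S τ a) :=
  intervalIntegral.integral_nonneg hσ fun _ _ => (Real.exp_pos _).le

theorem continuousOn (h : IsLagrangian b₁ b₂ t₁ R S w) (a : ℝ) :
    ContinuousOn (fun t => S t a) (Icc 0 t₁) := fun t ht => (h.deriv t ht a).continuousWithinAt

theorem intervalIntegrable (h : IsLagrangian b₁ b₂ t₁ R S w) (a : ℝ) {σ : ℝ} (hσ : σ ∈ Icc 0 t₁) :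
    IntervalIntegrable (fun τ => Real.exp (-S τ a)) volume 0 σ :=
  (((h.continuousOn a).mono (Icc_subset_Icc_right hσ.2)).neg.rexp).intervalIntegrable_of_Icc hσ.1

theorem vort_nonneg (h : IsLagrangian b₁ b₂ t₁ R S w) (hR : IsProfile A R) {σ : ℝ}
    (hσ : σ ∈ Icc 0 t₁) (s : ℝ) : 0 ≤ w σ s := by
  obtain ⟨a, rfl⟩ := h.surjective σ hσ s
  rw [h.vort σ hσ]
  exact mul_nonneg (hR.nonneg a) (hist_nonneg hσ.1 a)

theorem vort_eq_zero (h : IsLagrangian b₁ b₂ t₁ R S w) (hR : IsProfile A R) {σ : ℝ}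
    (hσ : σ ∈ Icc 0 t₁) {s : ℝ} (hs : S σ (-2) ≤ s) : w σ s = 0 := by
  obtain ⟨a, rfl⟩ := h.surjective σ hσ s
  rw [h.vort σ hσ, hR.zero_of_ge a ((h.strictMono σ hσ).le_iff_le.1 hs), zero_mul]

theorem edge_le (h : IsLagrangian b₁ b₂ t₁ R S w) {σ : ℝ} (hσ : σ ∈ Icc 0 t₁) :
    S σ (-2) ≤ 0 := by
  rw [← h.zero σ hσ]
  exact (h.strictMono σ hσ).monotone (by norm_num)

theorem mass_nonneg (h : IsLagrangian b₁ b₂ t₁ R S w) (hR : IsProfile A R) {σ : ℝ}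
    (hσ : σ ∈ Icc 0 t₁) (s : ℝ) : 0 ≤ mass (w σ) s :=
  _root_.mass_nonneg (h.cont σ hσ) (h.vort_nonneg hR hσ) (h.edge_le hσ)
    (fun _ hs => h.vort_eq_zero hR hσ hs) s

end IsLagrangian

/-- The bootstrap assumption at time `σ`. -/
structure IsControlled (b₁ b₂ θ : ℝ) (S w : ℝ → ℝ → ℝ) (σ : ℝ) : Prop where
  ratio : ∀ s ≤ S σ (-3) - b₁, w σ (s + b₂) ≤ θ * w σ (s + b₁)
  mass_le : mass (w σ) (S σ (-3) - (b₁ - b₂)) ≤ 1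
  edge : S σ (-2) ≤ -1

/-- The constraints on the logarithms of `β₁` and `β₂`. -/
structure IsShiftPair (b₁ b₂ : ℝ) : Prop where
  nonneg : 0 ≤ b₁
  nonpos : b₂ ≤ 0
  lt_log : b₁ - b₂ < Real.log 2

theorem IsShiftPair.lt_one (hb : IsShiftPair b₁ b₂) : b₁ - b₂ < 1 := by
  linarith [hb.lt_log, Real.log_two_lt_d9]

namespace IsControlled

variable {θ σ : ℝ}

/-- Both shifts exceed `-1`, and the vorticity is supported to the left of `-1`. -/
theorem logVel_zero (hc : IsControlled b₁ b₂ θ S w σ) (hb : IsShiftPair b₁ b₂)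
    (hR : IsProfile A R) (h : IsLagrangian b₁ b₂ t₁ R S w) (hσ : σ ∈ Icc 0 t₁) :
    logVel b₁ b₂ (w σ) 0 = 0 := by
  have h0 : ∀ s ≥ -1, mass (w σ) s = 0 := fun s hs =>
    mass_eq_zero (h.edge_le hσ) (fun _ => h.vort_eq_zero hR hσ) (hc.edge.trans hs)
  have h1 := hb.nonneg
  have h2 := hb.lt_one
  rw [logVel_eq_mass, h0 _ (by linarith), h0 _ (by linarith)]
  ring

theorem le_deriv (hc : IsControlled b₁ b₂ θ S w σ) {s : ℝ} (hs : s ≤ S σ (-3) - b₁) :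
    (2 - θ) * w σ (s + b₁) ≤ 2 * w σ (s + b₁) - w σ (s + b₂) := by
  linarith [hc.ratio s hs]

theorem logVel_mono (hc : IsControlled b₁ b₂ θ S w σ) (hθ : θ ≤ 2)
    (hR : IsProfile A R) (h : IsLagrangian b₁ b₂ t₁ R S w) (hσ : σ ∈ Icc 0 t₁) :
    MonotoneOn (logVel b₁ b₂ (w σ)) (Iic (S σ (-3) - b₁)) := by
  have hd := hasDerivAt_logVel (h.cont σ hσ) b₁ b₂
  refine monotoneOn_of_deriv_nonneg (convex_Iic _) (fun s _ => (hd s).continuousAt.continuousWithinAt)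
    (fun s _ => (hd s).differentiableAt.differentiableWithinAt) fun s hs => ?_
  rw [(hd s).deriv]
  refine le_trans ?_ (hc.le_deriv (mem_Iic.1 (interior_subset hs)))
  exact mul_nonneg (by linarith) (h.vort_nonneg hR hσ _)

/-- To the right of `S σ (-3) - b₁` the positive term is at most the mass controlled by `mass_le`;
to the left the velocity is monotone, hence below its value at that point. -/
theorem logVel_le_one (hc : IsControlled b₁ b₂ θ S w σ) (hθ : θ ≤ 2)
    (hR : IsProfile A R) (h : IsLagrangian b₁ b₂ t₁ R S w) (hσ : σ ∈ Icc 0 t₁) (s : ℝ) :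
    logVel b₁ b₂ (w σ) s ≤ 1 := by
  have hF := mass_antitone (h.cont σ hσ) (h.vort_nonneg hR hσ)
  have hF0 := h.mass_nonneg hR hσ
  have hright : ∀ s, S σ (-3) - b₁ ≤ s → logVel b₁ b₂ (w σ) s ≤ 1 := fun s hs => by
    have h1 : mass (w σ) (s + b₂) ≤ mass (w σ) (S σ (-3) - (b₁ - b₂)) := hF (by linarith)
    have h2 := hF0 (s + b₁)
    have h3 := hc.mass_le
    rw [logVel_eq_mass]
    linarith
  rcases le_total s (S σ (-3) - b₁) with hs | hs
  · exact (hc.logVel_mono hθ hR h hσ hs (mem_Iic.2 le_rfl) hs).trans (hright _ le_rfl)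
  · exact hright s hs

/-- This bounds the rate at which gaps between particles close. The velocity can decrease only to
the right of `S σ (-3) - b₁`, and there only through the term bounded by `mass_le`. -/
theorem neg_one_le_logVel_sub (hc : IsControlled b₁ b₂ θ S w σ) (hθ : θ ≤ 2)
    (hR : IsProfile A R) (h : IsLagrangian b₁ b₂ t₁ R S w) (hσ : σ ∈ Icc 0 t₁) {s s' : ℝ}
    (hs : s ≤ s') :
    -1 ≤ logVel b₁ b₂ (w σ) s' - logVel b₁ b₂ (w σ) s := by
  have hF := mass_antitone (h.cont σ hσ) (h.vort_nonneg hR hσ)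
  have hF0 := h.mass_nonneg hR hσ
  have hright : ∀ s s', S σ (-3) - b₁ ≤ s → s ≤ s' →
      -1 ≤ logVel b₁ b₂ (w σ) s' - logVel b₁ b₂ (w σ) s := fun s s' hs hs' => by
    have h1 : mass (w σ) (s + b₂) ≤ mass (w σ) (S σ (-3) - (b₁ - b₂)) := hF (by linarith)
    have h2 : mass (w σ) (s' + b₁) ≤ mass (w σ) (s + b₁) := hF (by linarith)
    have h3 := hF0 (s' + b₂)
    have h4 := hc.mass_le
    rw [logVel_eq_mass, logVel_eq_mass]
    linarith
  have hm := hc.logVel_mono hθ hR h hσ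
  rcases le_total (S σ (-3) - b₁) s with h1 | h1
  · exact hright s s' h1 hs
  rcases le_total s' (S σ (-3) - b₁) with h2 | h2
  · linarith [hm h1 h2 hs]
  · linarith [hm h1 (mem_Iic.2 le_rfl) h1, hright _ s' le_rfl h2]

theorem neg_two_le_logVel (hc : IsControlled b₁ b₂ θ S w σ) (hb : IsShiftPair b₁ b₂)
    (hR : IsProfile A R) (h : IsLagrangian b₁ b₂ t₁ R S w) (hσ : σ ∈ Icc 0 t₁) :
    -2 ≤ logVel b₁ b₂ (w σ) (S σ (-3)) := by
  have hF := mass_antitone (h.cont σ hσ) (h.vort_nonneg hR hσ)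
  have h1 : mass (w σ) (S σ (-3) + b₁) ≤ mass (w σ) (S σ (-3) - (b₁ - b₂)) :=
    hF (by linarith [hb.nonneg, hb.nonpos])
  have h2 := h.mass_nonneg hR hσ (S σ (-3) + b₂)
  have h3 := hc.mass_le
  rw [logVel_eq_mass]
  linarith

end IsControlled

/-- Histories of two particles are compared through their largest past separation; this turns
control of distances into control of vorticity ratios. -/
theorem hist_le_mul {a a' θ σ : ℝ} (hσ : 0 ≤ σ)
    (hi : IntervalIntegrable (fun τ => Real.exp (-S τ a)) volume 0 σ)
    (hi' : IntervalIntegrable (fun τ => Real.exp (-S τ a')) volume 0 σ)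
    (hsep : ∀ τ ∈ Icc 0 σ, S τ a' - S τ a ≤ θ) :
    ∫ τ in (0 : ℝ)..σ, Real.exp (-S τ a)
      ≤ Real.exp θ * ∫ τ in (0 : ℝ)..σ, Real.exp (-S τ a') := by
  rw [← intervalIntegral.integral_const_mul]
  refine intervalIntegral.integral_mono_on hσ hi (hi'.const_mul _) fun τ hτ => ?_
  rw [← Real.exp_add]
  exact Real.exp_le_exp.2 (by linarith [hsep τ hτ])

/-- The bootstrap argument: for small times depending only on `b₁` and `b₂`, the flow stays
controlled. -/
theorem IsLagrangian.isControlled (h : IsLagrangian b₁ b₂ t₁ R S w) (hb : IsShiftPair b₁ b₂)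
    (hR : IsProfile A R) {T₀ : ℝ} (hT₀ : 0 < T₀) (ht₁ : t₁ ≤ T₀) (hT₁ : T₀ * (5 * Real.exp 5) ≤ 1)
    (hθ : b₁ - b₂ + 2 * T₀ ≤ Real.log 2) {σ : ℝ} (hσ : σ ∈ Icc 0 t₁) :
    IsControlled b₁ b₂ (Real.exp (b₁ - b₂ + 2 * T₀)) S w σ := by
  set θ := Real.exp (b₁ - b₂ + 2 * T₀) with hθdef
  have hθ2 : θ ≤ 2 := by
    exact (Real.exp_le_exp.2 hθ).trans_eq (Real.exp_log two_pos)
  have hT5 : T₀ * 5 ≤ 1 := by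
    have h1 : (1 : ℝ) ≤ Real.exp 5 := Real.one_le_exp (by norm_num)
    nlinarith
  obtain ⟨C₀, hC₀⟩ := h.bound
  set C := 2 * |C₀| with hC
  have hC0 : 0 ≤ C := by positivity
  have hv : ∀ t ∈ Icc 0 t₁, ∀ s s', |logVel b₁ b₂ (w t) s - logVel b₁ b₂ (w t) s'| ≤ C :=
    fun t ht s s' => by
      have h1 := abs_le.1 ((hC₀ t ht s).trans (le_abs_self C₀))
      have h2 := abs_le.1 ((hC₀ t ht s').trans (le_abs_self C₀))
      rw [hC, abs_le]; constructor <;> linarith [h1.1, h1.2, h2.1, h2.2]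
  -- The crude velocity bound `C` depends on the flow. With this step its contribution is at most
  -- `T₀` each time, so every estimate loses `2 * T₀` instead of `T₀`, and the loss does not
  -- accumulate.
  set ε := T₀ / (C + 1) with hε
  have hε0 : 0 < ε := by positivity
  have hCε : C * ε ≤ T₀ := by
    rw [hε, mul_div_assoc', div_le_iff₀ (by positivity)]; nlinarith
  have step : ∀ t, (∀ σ ∈ Icc 0 t₁, σ ≤ t → IsControlled b₁ b₂ θ S w σ) →
      ∀ σ ∈ Icc 0 t₁, σ ≤ t + ε → IsControlled b₁ b₂ θ S w σ := by
    intro t hgood σ hσ hσt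
    have I1 : ∀ a, ∀ τ ∈ Icc 0 σ, S σ a - S τ a ≤ 2 * T₀ := fun a τ hτ => by
      have := sub_le_of_two_bounds (h.deriv · · a) hτ.1 hτ.2 hσ.2 hσt hε0.le zero_le_one hC0
        (fun x hx hxt => by
          rw [(hgood x hx hxt).logVel_zero hb hR h hx, sub_zero]
          exact (hgood x hx hxt).logVel_le_one hθ2 hR h hx _)
        (fun x hx => le_of_abs_le (hv x hx _ _))
      linarith [hσ.2, hτ.1]
    -- Past gaps exceed the present gap by at most `2 * T₀`. For the particles now at `s + b₂` and
    -- `s + b₁` this yields the ratio `exp(b₁ - b₂ + 2 * T₀)`.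
    have I2 : ∀ a a', a ≤ a' → ∀ τ ∈ Icc 0 σ,
        (S τ a' - S τ a) - (S σ a' - S σ a) ≤ 2 * T₀ := fun a a' haa τ hτ => by
      have := sub_le_of_two_bounds (fun t ht => ((h.deriv t ht a).sub (h.deriv t ht a')))
        hτ.1 hτ.2 hσ.2 hσt hε0.le zero_le_one hC0
        (fun x hx hxt => by
          have := (hgood x hx hxt).neg_one_le_logVel_sub hθ2 hR h hx
            ((h.strictMono x hx).monotone haa)
          linarith)
        (fun x hx => by
          have := le_of_abs_le (hv x hx (S x a) (S x a'))
          linarith)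
      simp only [Pi.sub_apply] at this
      linarith [hσ.2, hτ.1]
    have I3 : -3 - 3 * T₀ ≤ S σ (-3) := by
      have := sub_le_of_two_bounds (fun t ht => (h.deriv t ht (-3)).neg)
        le_rfl hσ.1 hσ.2 hσt hε0.le zero_le_two hC0
        (fun x hx hxt => by
          rw [(hgood x hx hxt).logVel_zero hb hR h hx]
          linarith [(hgood x hx hxt).neg_two_le_logVel hb hR h hx])
        (fun x hx => by
          rw [neg_sub]
          exact le_of_abs_le (hv x hx _ _))
      simp only [Pi.neg_apply, h.init] at this
      linarith [hσ.2]
    refine ⟨fun s hs => ?_, ?_, ?_⟩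
    · obtain ⟨a, ha⟩ := h.surjective σ hσ (s + b₂)
      obtain ⟨a', ha'⟩ := h.surjective σ hσ (s + b₁)
      have haa : a ≤ a' := by
        rw [← (h.strictMono σ hσ).le_iff_le, ha, ha']; linarith [hb.nonneg, hb.nonpos]
      have ha3 : a' ≤ -3 := by
        rw [← (h.strictMono σ hσ).le_iff_le, ha']; linarith
      rw [← ha, ← ha', h.vort σ hσ, h.vort σ hσ]
      have h1 := hist_le_mul hσ.1 (h.intervalIntegrable a hσ) (h.intervalIntegrable a' hσ)
        (θ := b₁ - b₂ + 2 * T₀) fun τ hτ => by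
          have := I2 a a' haa τ hτ
          rw [ha, ha'] at this
          linarith
      calc _ ≤ R a' * (θ * ∫ τ in (0 : ℝ)..σ, Real.exp (-S τ a')) :=
            mul_le_mul (hR.mono a a' haa ha3) h1 (hist_nonneg hσ.1 a) (hR.nonneg a')
        _ = _ := by ring
    · have hle0 : S σ (-3) ≤ 0 := by
        rw [← h.zero σ hσ]; exact (h.strictMono σ hσ).monotone (by norm_num)
      -- Particles in this range are above `-4 - 3 * T₀` now and were at most `2 * T₀` lower before,
      -- hence always above `-5` because `5 * T₀ ≤ 1`. The range also has length at most `5`, so its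
      -- mass is at most `5 * T₀ * exp 5 ≤ 1`.
      have hbd : ∀ y ∈ Icc (S σ (-3) - (b₁ - b₂)) 0, w σ y ≤ T₀ * Real.exp 5 := fun y hy => by
        obtain ⟨a, rfl⟩ := h.surjective σ hσ y
        rw [h.vort σ hσ]
        have h1 : ∫ τ in (0 : ℝ)..σ, Real.exp (-S τ a) ≤ ∫ τ in (0 : ℝ)..σ, Real.exp 5 :=
          intervalIntegral.integral_mono_on hσ.1 (h.intervalIntegrable a hσ)
            intervalIntegrable_const fun τ hτ => Real.exp_le_exp.2 (by
              linarith [I1 a τ hτ, hy.1, hb.lt_one])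
        rw [intervalIntegral.integral_const, smul_eq_mul, sub_zero] at h1
        have h2 : σ * Real.exp 5 ≤ T₀ * Real.exp 5 :=
          mul_le_mul_of_nonneg_right (hσ.2.trans ht₁) (Real.exp_pos 5).le
        calc _ ≤ 1 * (T₀ * Real.exp 5) := mul_le_mul (hR.le_one a) (h1.trans h2)
              (hist_nonneg hσ.1 a) zero_le_one
          _ = _ := one_mul _
      have hle : S σ (-3) - (b₁ - b₂) ≤ 0 := by linarith [hb.nonneg, hb.nonpos]
      have h1 := intervalIntegral.integral_mono_on (μ := volume) hle ((h.cont σ hσ).intervalIntegrable _ _)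
        (intervalIntegrable_const (μ := volume)) hbd
      rw [intervalIntegral.integral_const, smul_eq_mul] at h1
      have h2 : (0 - (S σ (-3) - (b₁ - b₂))) * (T₀ * Real.exp 5) ≤ 5 * (T₀ * Real.exp 5) :=
        mul_le_mul_of_nonneg_right (by linarith [hb.lt_one]) (by positivity)
      unfold mass
      linarith
    · have := I1 (-2) 0 ⟨le_rfl, hσ.1⟩
      rw [h.init] at this
      linarith
  -- Starting from `-ε` makes the base case vacuous; control at time `0` is itself an instance of
  -- `step`.
  have hn : ∀ n : ℕ, ∀ σ ∈ Icc 0 t₁, σ ≤ -ε + n * ε → IsControlled b₁ b₂ θ S w σ := by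
    intro n
    induction n with
    | zero =>
      intro σ hσ hle
      simp only [Nat.cast_zero, zero_mul, add_zero] at hle
      linarith [hσ.1]
    | succ n ih =>
      intro σ hσ hle
      refine step _ ih σ hσ ?_
      push_cast at hle
      linarith
  obtain ⟨n, hn'⟩ := exists_nat_ge ((σ + ε) / ε)
  refine hn n σ hσ ?_
  rw [div_le_iff₀ hε0] at hn'
  linarith

/-- Flows with a profile of long support collapse in a short time. -/
theorem exists_forall_not_isLagrangian (hb : IsShiftPair b₁ b₂) :
    ∃ T₀ > 0, ∃ A₀ ≤ -10,
      (∀ R, IsProfile A₀ R → ∀ S w, ¬ IsLagrangian b₁ b₂ T₀ R S w) ∧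
      ∀ A R, IsProfile A R → ∀ t₁ ≤ T₀, ∀ S w, IsLagrangian b₁ b₂ t₁ R S w →
        ∀ t ∈ Icc 0 t₁, S t (-2) ≤ -1 ∧ logVel b₁ b₂ (w t) 0 = 0 := by
  set η := Real.log 2 - (b₁ - b₂) with hη
  have hη0 : 0 < η := by linarith [hb.lt_log]
  -- The first bound keeps `b₁ - b₂ + 2 * T₀` strictly below `log 2`, so the vorticity ratio stays
  -- strictly below `2`; the second is what the mass estimate needs.
  set T₀ := min (η / 4) (1 / (5 * Real.exp 5)) with hT₀
  have hT₀0 : 0 < T₀ := by positivity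
  have hT₁ : T₀ * (5 * Real.exp 5) ≤ 1 := by
    rw [← le_div_iff₀ (by positivity)]; exact min_le_right _ _
  have hTη : T₀ ≤ η / 4 := min_le_left _ _
  have hθ : b₁ - b₂ + 2 * T₀ ≤ Real.log 2 := by linarith
  have hT5 : T₀ * 5 ≤ 1 := by
    have h1 : (1 : ℝ) ≤ Real.exp 5 := Real.one_le_exp (by norm_num)
    nlinarith
  set θ := Real.exp (b₁ - b₂ + 2 * T₀) with hθdef
  have hθ2 : θ < 2 := by
    exact (Real.exp_lt_exp.2 (by linarith)).trans_eq (Real.exp_log two_pos)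
  set κ := (2 - θ) * Real.exp (-3) with hκ
  have hκ0 : 0 < κ := mul_pos (by linarith) (Real.exp_pos _)
  set X := 1 / κ + 16 / (κ * T₀ ^ 2) with hX
  have hX0 : 0 < X := by positivity
  -- With this left end the plateau starts at `-9 - X`, so `exp(-y 0) ≥ X`, the threshold of
  -- `false_of_collapse`, follows from `exp x ≥ x + 1`.
  refine ⟨T₀, hT₀0, -10 - X, by linarith, fun R hR S w h => ?_, fun A R hR t₁ ht₁ S w h t ht => ?_⟩
  swap
  · have hc := h.isControlled hb hR hT₀0 ht₁ hT₁ hθ ht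
    exact ⟨hc.edge, hc.logVel_zero hb hR h ht⟩
  have hc : ∀ t ∈ Icc 0 T₀, IsControlled b₁ b₂ θ S w t := fun t ht =>
    h.isControlled hb hR hT₀0 le_rfl hT₁ hθ ht
  set p : ℝ := -10 - X + 1 with hp
  have hh : ∀ t ∈ Icc 0 T₀, HasDerivWithinAt (fun t => ∫ τ in (0 : ℝ)..t, Real.exp (-S τ p))
      (Real.exp (-S t p)) (Icc 0 T₀) t := fun t ht => by
    have hco : ContinuousOn (fun τ => Real.exp (-S τ p)) (Icc 0 T₀) := (h.continuousOn p).neg.rexp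
    have : Fact (t ∈ Icc 0 T₀) := ⟨ht⟩
    exact intervalIntegral.integral_hasDerivWithinAt_right (h.intervalIntegrable p ht)
      (hco.stronglyMeasurableAtFilter_nhdsWithin measurableSet_Icc t) (hco t ht)
  refine false_of_collapse (h := fun t => ∫ τ in (0 : ℝ)..t, Real.exp (-S τ p)) hκ0 hT₀0
    (h.deriv · · p) hh intervalIntegral.integral_same (fun t ht => ?_) ?_
  · have hct := hc t ht
    rw [hct.logVel_zero hb hR h ht, sub_zero]
    have hsep : ∀ a a', a ≤ a' → ∀ τ ∈ Icc 0 t, (S τ a' - S τ a) - (S t a' - S t a) ≤ T₀ :=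
      fun a a' haa τ hτ => by
        have := sub_le_of_hasDerivWithinAt
          (fun t ht => ((h.deriv t ht a).sub (h.deriv t ht a'))) hτ.1 hτ.2 ht.2 (B := 1)
          (fun x hx => by
            have hx' : x ∈ Icc 0 T₀ := ⟨hτ.1.trans hx.1, hx.2.trans ht.2⟩
            have := (hc x hx').neg_one_le_logVel_sub hθ2.le hR h hx'
              ((h.strictMono x hx').monotone haa)
            linarith)
        simp only [Pi.sub_apply] at this
        linarith [hτ.1, ht.2]
    have hfar : S t p + 5 ≤ S t (-3) := by
      have := hsep p (-3) (by linarith) 0 ⟨le_rfl, ht.1⟩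
      rw [h.init, h.init] at this
      linarith
    -- The particle now at `s + b₁` is within `2` of the particle `p` and was within `2 + T₀ ≤ 3` of
    -- it before. By `hfar` it lies on the plateau, so its vorticity is at least `exp(-3)` times the
    -- history of `p`.
    have hw : ∀ s ∈ Icc (S t p) (S t p + 1),
        Real.exp (-3) * (∫ τ in (0 : ℝ)..t, Real.exp (-S τ p)) ≤ w t (s + b₁) := fun s hs => by
      obtain ⟨a, ha⟩ := h.surjective t ht (s + b₁)
      have hpa : p ≤ a := by
        rw [← (h.strictMono t ht).le_iff_le, ha]; linarith [hs.1, hb.nonneg]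
      have haq : a ≤ -3 := by
        rw [← (h.strictMono t ht).le_iff_le, ha]
        linarith [hs.2, hb.nonpos, hb.lt_one]
      rw [← ha, h.vort t ht, hR.one a ⟨hpa, haq⟩, one_mul]
      have h1 := hist_le_mul ht.1 (h.intervalIntegrable p ht) (h.intervalIntegrable a ht) (θ := 3)
        fun τ hτ => by
          have := hsep p a hpa τ hτ
          rw [ha] at this
          linarith [hs.2, hb.nonpos, hb.lt_one]
      calc _ ≤ Real.exp (-3) * (Real.exp 3 * ∫ τ in (0 : ℝ)..t, Real.exp (-S τ a)) :=
            mul_le_mul_of_nonneg_left h1 (Real.exp_pos _).le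
        _ = _ := by rw [← mul_assoc, ← Real.exp_add]; simp
    have hd := hasDerivAt_logVel (h.cont t ht) b₁ b₂
    -- On this unit interval the velocity grows with slope at least `κ` times the history, while at
    -- its right end it is at most `1`; hence `y' ≤ 1 - κ * h`.
    have hmv := (convex_Icc (S t p) (S t p + 1)).mul_sub_le_image_sub_of_le_deriv
      (f := logVel b₁ b₂ (w t)) (fun s _ => (hd s).continuousAt.continuousWithinAt)
      (fun s _ => (hd s).differentiableAt.differentiableWithinAt)
      (C := κ * ∫ τ in (0 : ℝ)..t, Real.exp (-S τ p)) (fun s hs => by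
        rw [interior_Icc] at hs
        rw [(hd s).deriv]
        refine le_trans ?_ (hct.le_deriv (by linarith [hs.2, hb.nonpos, hb.lt_one]))
        rw [hκ, mul_assoc]
        exact mul_le_mul_of_nonneg_left (hw s (Ioo_subset_Icc_self hs)) (by linarith))
      (S t p) ⟨le_rfl, by linarith⟩ (S t p + 1) ⟨by linarith, le_rfl⟩ (by linarith)
    have := hct.logVel_le_one hθ2.le hR h ht (S t p + 1)
    linarith
  · rw [h.init]
    have := Real.add_one_le_exp (-p)
    linarith

end Bootstrap

/-! ### Families of functions with jointly continuous space derivatives -/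

/-- `f t x` has `k` derivatives in `x`, jointly continuous in `(t, x)`. -/
def JointC : ℕ → (ℝ → ℝ → ℝ) → Prop
  | 0, f => Continuous (Function.uncurry f)
  | k + 1, f => Continuous (Function.uncurry f) ∧
      ∃ f' : ℝ → ℝ → ℝ, (∀ t x, HasDerivAt (f t) (f' t x) x) ∧ JointC k f'

namespace JointC

variable {k : ℕ} {f g : ℝ → ℝ → ℝ}

theorem continuous (hf : JointC k f) : Continuous (Function.uncurry f) := by
  cases k with
  | zero => exact hf
  | succ k => exact hf.1

theorem continuous₂ {X : Type*} [TopologicalSpace X] (hf : JointC k f) {u v : X → ℝ}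
    (hu : Continuous u) (hv : Continuous v) : Continuous fun x => f (u x) (v x) :=
  hf.continuous.comp (hu.prodMk hv)

theorem of_succ (hf : JointC (k + 1) f) : JointC k f := by
  induction k generalizing f with
  | zero => exact hf.1
  | succ k ih =>
    obtain ⟨h1, f', h2, h3⟩ := hf
    exact ⟨h1, f', h2, ih h3⟩

theorem of_le {m : ℕ} (hf : JointC k f) (h : m ≤ k) : JointC m f := by
  induction k, h using Nat.le_induction with
  | base => exact hf
  | succ k _ ih => exact ih hf.of_succ

theorem add (hf : JointC k f) (hg : JointC k g) : JointC k fun t x => f t x + g t x := by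
  induction k generalizing f g with
  | zero => exact Continuous.add (hf : Continuous _) hg
  | succ k ih =>
    obtain ⟨h1, f', h2, h3⟩ := hf
    obtain ⟨h1', g', h2', h3'⟩ := hg
    exact ⟨h1.add h1', _, fun t x => (h2 t x).add (h2' t x), ih h3 h3'⟩

theorem mul (hf : JointC k f) (hg : JointC k g) : JointC k fun t x => f t x * g t x := by
  induction k generalizing f g with
  | zero => exact Continuous.mul (hf : Continuous _) hg
  | succ k ih =>
    have hf0 := hf.of_succ
    have hg0 := hg.of_succ
    obtain ⟨h1, f', h2, h3⟩ := hf
    obtain ⟨h1', g', h2', h3'⟩ := hg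
    exact ⟨h1.mul h1', _, fun t x => (h2 t x).mul (h2' t x), (ih h3 hg0).add (ih hf0 h3')⟩

theorem of_contDiff {φ : ℝ → ℝ} (hφ : ContDiff ℝ k φ) : JointC k fun _ => φ := by
  induction k generalizing φ with
  | zero => exact hφ.continuous.comp continuous_snd
  | succ k ih =>
    have h : ContDiff ℝ ((k : WithTop ℕ∞) + 1) φ := by exact_mod_cast hφ
    rw [contDiff_succ_iff_deriv] at h
    exact ⟨h.1.continuous.comp continuous_snd, fun _ => deriv φ,
      fun _ x => (h.1 x).hasDerivAt, ih h.2.2⟩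

theorem const (c : ℝ) : JointC k fun _ _ => c := of_contDiff contDiff_const

theorem neg (hf : JointC k f) : JointC k fun t x => -f t x := by
  simpa using (const (-1)).mul hf

theorem sub (hf : JointC k f) (hg : JointC k g) : JointC k fun t x => f t x - g t x := by
  simpa [sub_eq_add_neg] using hf.add hg.neg

theorem comp (hf : JointC k f) (hg : JointC k g) : JointC k fun t x => f t (g t x) := by
  induction k generalizing f g with
  | zero => exact hf.continuous₂ continuous_fst hg.continuous
  | succ k ih =>
    have hg0 := hg.of_succ
    obtain ⟨h1, f', h2, h3⟩ := hf
    obtain ⟨h1', g', h2', h3'⟩ := hg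
    exact ⟨h1.comp (continuous_fst.prodMk h1'), fun t x => f' t (g t x) * g' t x,
      fun t x => (h2 t (g t x)).comp x (h2' t x), (ih h3 hg0).mul h3'⟩

theorem exp (hf : JointC k f) : JointC k fun t x => Real.exp (f t x) :=
  (of_contDiff Real.contDiff_exp).comp hf

theorem comp_add (hf : JointC k f) (b : ℝ) : JointC k fun t x => f t (x + b) :=
  hf.comp (of_contDiff (contDiff_id.add contDiff_const))

theorem integral (hf : JointC k f) {θ : ℝ → ℝ} (hθ : Continuous θ) :
    JointC k fun t x => ∫ τ in (0 : ℝ)..θ t, f τ x := by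
  have hcont : ∀ f : ℝ → ℝ → ℝ, Continuous (Function.uncurry f) →
      Continuous (Function.uncurry fun t x => ∫ τ in (0 : ℝ)..θ t, f τ x) := fun f hf =>
    intervalIntegral.continuous_parametric_intervalIntegral_of_continuous
      (f := fun (p : ℝ × ℝ) τ => f τ p.2)
      (hf.comp (continuous_snd.prodMk (continuous_snd.comp continuous_fst)))
      (hθ.comp continuous_fst)
  induction k generalizing f with
  | zero => exact hcont f hf
  | succ k ih =>
    obtain ⟨h1, f', h2, h3⟩ := hf
    refine ⟨hcont f h1, _, fun t x => ?_, ih h3⟩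
    have hc' := h3.continuous
    have hslice : ∀ x, Continuous fun τ => f τ x := fun x =>
      h1.comp (continuous_id.prodMk continuous_const)
    have hslice' : ∀ x, Continuous fun τ => f' τ x := fun x =>
      hc'.comp (continuous_id.prodMk continuous_const)
    obtain ⟨C, hC⟩ := ((isCompact_uIcc (a := (0 : ℝ)) (b := θ t)).prod
      (isCompact_closedBall x 1)).exists_bound_of_continuousOn hc'.continuousOn
    refine (intervalIntegral.hasDerivAt_integral_of_dominated_loc_of_deriv_le
      (F := fun x τ => f τ x) (F' := fun x τ => f' τ x) (bound := fun _ => C)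
      (Metric.closedBall_mem_nhds x one_pos) ?_ ((hslice x).intervalIntegrable _ _) ?_ ?_ ?_ ?_).2
    · exact Eventually.of_forall fun x => (hslice x).aestronglyMeasurable
    · exact (hslice' x).aestronglyMeasurable
    · exact Eventually.of_forall fun τ hτ y hy => hC (τ, y) ⟨uIoc_subset_uIcc hτ, hy⟩
    · exact intervalIntegrable_const
    · exact Eventually.of_forall fun τ _ y _ => h2 τ y

theorem contDiff (hf : JointC k f) (t : ℝ) : ContDiff ℝ k (f t) := by
  induction k generalizing f with
  | zero =>
    exact contDiff_zero.2 (hf.continuous.comp (continuous_const.prodMk continuous_id))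
  | succ k ih =>
    obtain ⟨h1, f', h2, h3⟩ := hf
    have h4 : deriv (f t) = f' t := funext fun x => (h2 t x).deriv
    have : ContDiff ℝ ((k : WithTop ℕ∞) + 1) (f t) := by
      rw [contDiff_succ_iff_deriv, h4]
      exact ⟨fun x => (h2 t x).differentiableAt, by simp, ih h3⟩
    exact_mod_cast this

theorem continuous_iteratedDeriv (hf : JointC k f) {i : ℕ} (hi : i ≤ k) :
    Continuous (Function.uncurry fun t => iteratedDeriv i (f t)) := by
  induction i generalizing f k with
  | zero => simpa using hf.continuous
  | succ i ih =>
    cases k with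
    | zero => omega
    | succ k =>
      obtain ⟨h1, f', h2, h3⟩ := hf
      have h4 : ∀ t, deriv (f t) = f' t := fun t => funext fun x => (h2 t x).deriv
      simp only [iteratedDeriv_succ', h4]
      exact ih h3 (by omega)

/-- Passing from logarithmic to original coordinates. -/
theorem comp_log (hf : JointC k f) {K : ℝ} (hK : ∀ t, ∀ s ≤ K, f t s = 0) :
    JointC k fun t x => if 0 < x then f t (Real.log x) else 0 := by
  have hzero : ∀ f : ℝ → ℝ → ℝ, (∀ t, ∀ s ≤ K, f t s = 0) → ∀ t, ∀ x < Real.exp K,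
      (if 0 < x then f t (Real.log x) else 0) = 0 := fun f hK t x hx => by
    split_ifs with h
    · exact hK t _ ((Real.log_le_iff_le_exp h).2 hx.le)
    · rfl
  have hcont : ∀ f : ℝ → ℝ → ℝ, (∀ t, ∀ s ≤ K, f t s = 0) → Continuous (Function.uncurry f) →
      Continuous (Function.uncurry fun t x => if 0 < x then f t (Real.log x) else 0) := by
    intro f hK hf
    rw [continuous_iff_continuousAt]
    rintro ⟨t, x⟩
    rcases lt_or_ge 0 x with hx | hx
    · have h1 : ContinuousAt (fun p : ℝ × ℝ => f p.1 (Real.log p.2)) (t, x) :=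
        ContinuousAt.comp (g := Function.uncurry f) (f := fun p : ℝ × ℝ => (p.1, Real.log p.2))
          hf.continuousAt (continuousAt_fst.prodMk (continuousAt_snd.log hx.ne'))
      refine h1.congr ?_
      filter_upwards [continuousAt_snd.eventually (Ioi_mem_nhds hx)] with p hp
      simp only [Function.uncurry]
      rw [if_pos (mem_Ioi.1 hp)]
    · have h1 : ContinuousAt (fun _ : ℝ × ℝ => (0 : ℝ)) (t, x) := continuousAt_const
      refine h1.congr ?_
      filter_upwards [continuousAt_snd.eventually
        (Iio_mem_nhds (hx.trans_lt (Real.exp_pos K)))] with p hp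
      exact (hzero f hK p.1 p.2 hp).symm
  induction k generalizing f with
  | zero => exact hcont f hK hf
  | succ k ih =>
    obtain ⟨h1, f', h2, h3⟩ := hf
    have hf'0 : ∀ t, ∀ s < K, f' t s = 0 := fun t s hs => by
      refine (h2 t s).unique ((hasDerivAt_const s (0 : ℝ)).congr_of_eventuallyEq ?_)
      filter_upwards [Iio_mem_nhds hs] with y hy
      exact hK t y (le_of_lt hy)
    have hf'K : ∀ t, ∀ s ≤ K, f' t s * Real.exp (-s) = 0 := fun t s hs => by
      have hc : Continuous (f' t) := h3.continuous.comp (continuous_const.prodMk continuous_id)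
      have hcl : IsClosed {s | f' t s = 0} := isClosed_singleton.preimage hc
      have h4 : closure (Iio K) ⊆ {s | f' t s = 0} :=
        hcl.closure_subset_iff.2 fun s hs => hf'0 t s hs
      rw [closure_Iio] at h4
      rw [show f' t s = 0 from h4 hs, zero_mul]
    -- The derivative of `f t (log x)` is `f' t s * exp(-s)` at `s = log x`, which again vanishes
    -- for `s ≤ K`; the induction therefore stays within the same class.
    refine ⟨hcont f hK h1, _, fun t x => ?_, ih (h3.mul (of_contDiff (k := k)
      (φ := fun s => Real.exp (-s)) (by fun_prop))) hf'K⟩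
    rcases lt_or_ge 0 x with hx | hx
    · rw [if_pos hx]
      have h4 := (h2 t (Real.log x)).comp x (Real.hasDerivAt_log hx.ne')
      rw [Real.exp_neg, Real.exp_log hx]
      refine h4.congr_of_eventuallyEq ?_
      filter_upwards [Ioi_mem_nhds hx] with y hy
      simp only [Function.comp]
      rw [if_pos (mem_Ioi.1 hy)]
    · rw [if_neg (not_lt.2 hx)]
      refine (hasDerivAt_const x (0 : ℝ)).congr_of_eventuallyEq ?_
      filter_upwards [Iio_mem_nhds (hx.trans_lt (Real.exp_pos K))] with y hy
      exact hzero f hK t y hy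

end JointC

/-! ### Smoothness of Lagrangian flows -/

section Smoothness

variable {A : ℝ} {R : ℝ → ℝ} {hR : IsProfile A R} {b₁ b₂ t₁ : ℝ} {α : ℝ → FlowState}

theorem JointC.position {j : ℝ → ℝ → ℝ} {k : ℕ} (hj : JointC k j) :
    JointC (k + 1) fun t => _root_.position (j t) := by
  have hs : ∀ t, Continuous (j t) := fun t =>
    hj.continuous.comp (continuous_const.prodMk continuous_id)
  refine ⟨?_, _, fun t a => hasDerivAt_position (hs t) a, hj.exp⟩
  exact intervalIntegral.continuous_parametric_intervalIntegral_of_continuous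
    (f := fun (p : ℝ × ℝ) x => Real.exp (j p.1 x))
    (Real.continuous_exp.comp (hj.continuous₂ (continuous_fst.comp continuous_fst) continuous_snd))
    continuous_snd

theorem hasDerivAt_label {j : ℝ → ℝ} {N : ℝ} (hj : Continuous j) (hN : ∀ x, |j x| ≤ N) (s : ℝ) :
    HasDerivAt (label j) (Real.exp (-j (label j s))) s := by
  rw [Real.exp_neg]
  exact (hasDerivAt_position hj _).of_local_left_inverse (continuous_label hj hN).continuousAt
    (Real.exp_pos _).ne' (Eventually.of_forall (position_label hj hN))

/-- Joint continuity comes from the Lipschitz bound in `s`, uniform in time. The derivative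
`exp(-j)` at the label inherits the regularity of the label, so each round gains one derivative
until those of `j` are used up. -/
theorem JointC.label {j : ℝ → ℝ → ℝ} {k : ℕ} {N : ℝ} (hj : JointC k j)
    (hN : ∀ t x, |j t x| ≤ N) : JointC (k + 1) fun t => _root_.label (j t) := by
  have hs : ∀ t, Continuous (j t) := fun t =>
    hj.continuous.comp (continuous_const.prodMk continuous_id)
  have hc : Continuous (Function.uncurry fun t => _root_.label (j t)) := by
    rw [continuous_iff_continuousAt]
    rintro ⟨t, s⟩
    have hp := hj.position.continuous₂ (X := ℝ × ℝ) continuous_fst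
      (continuous_const (y := _root_.label (j t) s))
    have h1 : Tendsto (fun p : ℝ × ℝ => Real.exp N *
        |p.2 - _root_.position (j p.1) (_root_.label (j t) s)|) (𝓝 (t, s)) (𝓝 0) := by
      have h2 : Continuous fun p : ℝ × ℝ => Real.exp N *
          |p.2 - _root_.position (j p.1) (_root_.label (j t) s)| :=
        continuous_const.mul (continuous_snd.sub hp).abs
      have := h2.tendsto (t, s)
      simpa [position_label (hs t) (hN t)] using this
    refine tendsto_iff_dist_tendsto_zero.2 (squeeze_zero (fun _ => dist_nonneg) (fun p => ?_) h1)
    have := abs_label_sub_le (hs p.1) (hN p.1) p.2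
      (_root_.position (j p.1) (_root_.label (j t) s))
    rw [label_position (hs p.1)] at this
    exact this
  have hm : ∀ m ≤ k + 1, JointC m fun t => _root_.label (j t) := by
    intro m
    induction m with
    | zero => exact fun _ => hc
    | succ m ih =>
      intro hm
      exact ⟨hc, _, fun t s => hasDerivAt_label (hs t) (hN t) s,
        ((hj.of_le (by omega : m ≤ k)).comp (ih (by omega))).neg.exp⟩
  exact hm _ le_rfl

/-- Clamping of time to `[0, t₁]`. -/
noncomputable def clampTime (t₁ t : ℝ) : ℝ := max 0 (min t₁ t)

theorem continuous_clampTime (t₁ : ℝ) : Continuous (clampTime t₁) := by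
  unfold clampTime; fun_prop

theorem clampTime_mem (ht₁ : 0 ≤ t₁) (t : ℝ) : clampTime t₁ t ∈ Icc 0 t₁ :=
  ⟨le_max_left _ _, max_le ht₁ (min_le_left _ _)⟩

theorem clampTime_of_mem {t : ℝ} (ht : t ∈ Icc 0 t₁) : clampTime t₁ t = t := by
  rw [clampTime, min_eq_right ht.2, max_eq_right ht.1]

theorem IsFlow.continuous_clamp (h : IsFlow hR b₁ b₂ (Icc 0 t₁) α) (ht₁ : 0 ≤ t₁) :
    Continuous fun t => α (clampTime t₁ t) :=
  h.continuousOn.comp_continuous (continuous_clampTime t₁) (clampTime_mem ht₁)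

theorem IsFlow.exists_bound (h : IsFlow hR b₁ b₂ (Icc 0 t₁) α) (ht₁ : 0 ≤ t₁) :
    ∃ N, ∀ t, ‖α (clampTime t₁ t)‖ ≤ N := by
  obtain ⟨N, hN⟩ := isCompact_Icc.exists_bound_of_continuousOn h.continuousOn
  exact ⟨N, fun t => hN _ (clampTime_mem ht₁ t)⟩

theorem integral_clampTime (f : ℝ → ℝ) {t : ℝ} (ht : t ∈ Icc 0 t₁) :
    ∫ τ in (0 : ℝ)..t, f τ = ∫ τ in (0 : ℝ)..t, f (clampTime t₁ τ) := by
  refine intervalIntegral.integral_congr fun τ hτ => ?_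
  rw [uIcc_of_le ht.1] at hτ
  rw [clampTime_of_mem ⟨hτ.1, hτ.2.trans ht.2⟩]

theorem IsFlow.jointC_zero (h : IsFlow hR b₁ b₂ (Icc 0 t₁) α) (ht₁ : 0 ≤ t₁) :
    JointC 0 fun t a => (α (clampTime t₁ t)).1 a :=
  Continuous.eval (continuous_fst.comp ((h.continuous_clamp ht₁).comp continuous_fst))
    continuous_snd

/-- The explicit formula expresses the vorticity through the profile, positions and labels, and the
last two are one derivative smoother than the Jacobian. -/
theorem IsFlow.jointC_vorticity_of (h : IsFlow hR b₁ b₂ (Icc 0 t₁) α) (ht₁ : 0 ≤ t₁) {k : ℕ}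
    (hj : JointC k fun t a => (α (clampTime t₁ t)).1 a) :
    JointC (k + 1) fun t s => vorticity A (α (clampTime t₁ t)) s := by
  obtain ⟨N, hN⟩ := h.exists_bound ht₁
  have hL : JointC (k + 1) fun t => label (α (clampTime t₁ t)).1 :=
    hj.label fun t x => (abs_fst_le _ x).trans (hN t)
  have hH : JointC (k + 1) fun t a =>
      ∫ τ in (0 : ℝ)..clampTime t₁ t, Real.exp (-position (α (clampTime t₁ τ)).1 a) :=
    hj.position.neg.exp.integral (continuous_clampTime t₁)
  have hRL := (JointC.of_contDiff (hR.smooth (k + 1))).comp hL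
  have := hRL.mul (hH.comp hL)
  convert this using 3 with t s
  set τ := clampTime t₁ t with hτ
  have hτm : τ ∈ Icc 0 t₁ := clampTime_mem ht₁ t
  conv_lhs => rw [← position_label (α τ).1.continuous (abs_fst_le (α τ)) s]
  rw [h.vorticity_position hτm, integral_clampTime _ hτm]

theorem IsFlow.fst_eq_integral (h : IsFlow hR b₁ b₂ (Icc 0 t₁) α) (ht₁ : 0 ≤ t₁) {t : ℝ}
    (ht : t ∈ Icc 0 t₁) (a : ℝ) :
    (α t).1 a = ∫ τ in (0 : ℝ)..t, rate A b₁ b₂ (α τ).1 (α τ).2 a := by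
  have hderiv : ∀ τ ∈ Icc 0 t₁, HasDerivWithinAt (fun σ => (α σ).1 a)
      (rate A b₁ b₂ (α τ).1 (α τ).2 a) (Icc 0 t₁) τ := fun τ hτ =>
    (BoundedContinuousFunction.evalCLM ℝ a : (ℝ →ᵇ ℝ) →L[ℝ] ℝ).hasFDerivAt.comp_hasDerivWithinAt τ
      (hasDerivWithinAt_fst (h.2 τ hτ))
  have hc : Continuous fun τ => rate A b₁ b₂ (α (clampTime t₁ τ)).1 (α (clampTime t₁ τ)).2 a := by
    have hj := h.jointC_zero ht₁
    have hw := h.jointC_vorticity_of ht₁ hj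
    have hp := hj.position.continuous₂ (X := ℝ) continuous_id (continuous_const (y := a))
    exact ((hw.continuous₂ continuous_id (hp.add continuous_const)).const_smul (2 : ℝ)).sub
      (hw.continuous₂ continuous_id (hp.add continuous_const))
  have hftc := intervalIntegral.integral_eq_sub_of_hasDerivAt_of_le ht.1
    (f := fun σ => (α σ).1 a)
    (f' := fun τ => rate A b₁ b₂ (α (clampTime t₁ τ)).1 (α (clampTime t₁ τ)).2 a)
    (fun τ hτ => ((hderiv τ ⟨hτ.1, hτ.2.trans ht.2⟩).continuousWithinAt).mono
      (Icc_subset_Icc_right ht.2))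
    (fun τ hτ => by
      rw [clampTime_of_mem ⟨hτ.1.le, hτ.2.le.trans ht.2⟩]
      exact (hderiv τ ⟨hτ.1.le, hτ.2.le.trans ht.2⟩).hasDerivAt
        (Icc_mem_nhds hτ.1 (hτ.2.trans_le ht.2)))
    (hc.intervalIntegrable _ _)
  rw [integral_clampTime _ ht, hftc, h.1]
  simp

/-- The rate is a combination of vorticities at shifted positions, hence one derivative smoother
than the Jacobian; integrating it in time returns that derivative to the Jacobian. -/
theorem IsFlow.jointC_fst (h : IsFlow hR b₁ b₂ (Icc 0 t₁) α) (ht₁ : 0 ≤ t₁) (k : ℕ) :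
    JointC k fun t a => (α (clampTime t₁ t)).1 a := by
  induction k with
  | zero => exact h.jointC_zero ht₁
  | succ k ih =>
    have hw := h.jointC_vorticity_of ht₁ ih
    have hp := ih.position
    have hr : JointC (k + 1) fun t a =>
        rate A b₁ b₂ (α (clampTime t₁ t)).1 (α (clampTime t₁ t)).2 a :=
      ((JointC.const 2).mul ((hw.comp_add b₁).comp hp)).sub ((hw.comp_add b₂).comp hp)
    have hi := hr.integral (continuous_clampTime t₁)
    convert hi using 3 with t a
    rw [h.fst_eq_integral ht₁ (clampTime_mem ht₁ t), integral_clampTime _ (clampTime_mem ht₁ t)]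

theorem IsFlow.jointC_vorticity (h : IsFlow hR b₁ b₂ (Icc 0 t₁) α) (ht₁ : 0 ≤ t₁) (k : ℕ) :
    JointC k fun t s => vorticity A (α (clampTime t₁ t)) s :=
  (h.jointC_vorticity_of ht₁ (h.jointC_fst ht₁ k)).of_succ

theorem IsFlow.jointC_label (h : IsFlow hR b₁ b₂ (Icc 0 t₁) α) (ht₁ : 0 ≤ t₁) (k : ℕ) :
    JointC k fun t s => label (α (clampTime t₁ t)).1 s := by
  obtain ⟨N, hN⟩ := h.exists_bound ht₁
  exact ((h.jointC_fst ht₁ k).label fun t x => (abs_fst_le _ x).trans (hN t)).of_succ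

end Smoothness

/-! ### Paths in `K^n` -/

theorem iteratedDeriv_eq_zero_of_notMem {f : ℝ → ℝ} {m M : ℝ} (hf : ∀ x ∉ Icc m M, f x = 0)
    (k : ℕ) {x : ℝ} (hx : x ∉ Icc m M) : iteratedDeriv k f x = 0 := by
  have h : f =ᶠ[𝓝 x] fun _ => 0 := by
    filter_upwards [isClosed_Icc.isOpen_compl.mem_nhds hx] with y hy
    exact hf y hy
  rw [h.iteratedDeriv_eq]
  simp [iteratedDeriv_fun_const_zero]

theorem tsupport_subset_Icc {f : ℝ → ℝ} {m M : ℝ} (hf : ∀ x ∉ Icc m M, f x = 0) :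
    tsupport f ⊆ Icc m M :=
  closure_minimal (fun x hx => by by_contra h; exact hx (hf x h)) isClosed_Icc

/-- Smooth families with supports in a fixed compact subset of `(0, 1)` on each compact time
interval are paths in `K^n`. -/
theorem isKPath_of_jointC {n : ℕ} {T : ℝ} {f : ℝ → ℝ → ℝ}
    (h : ∀ t₁, 0 ≤ t₁ → t₁ < T → ∃ F, JointC n F ∧ (∀ t ∈ Icc 0 t₁, F t = f t) ∧
      ∃ m M, 0 < m ∧ M < 1 ∧ ∀ t ∈ Icc 0 t₁, ∀ x ∉ Icc m M, f t x = 0) : IsKPath n T f where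
  mem t ht := by
    obtain ⟨F, hF, hFf, m, M, hm, hM, hs⟩ := h t ht.1 ht.2
    have ht' : t ∈ Icc 0 t := ⟨ht.1, le_rfl⟩
    refine ⟨hFf t ht' ▸ hF.contDiff t, HasCompactSupport.intro isCompact_Icc (hs t ht'),
      (tsupport_subset_Icc (hs t ht')).trans fun x hx => ⟨hm.trans_le hx.1, hx.2.trans_lt hM⟩⟩
  cont t ht := by
    obtain ⟨F, hF, hFf, m, M, hm, hM, hs⟩ := h ((t + T) / 2) (by linarith [ht.1, ht.2])
      (by linarith [ht.2])
    have ht' : t ∈ Icc 0 ((t + T) / 2) := ⟨ht.1, by linarith [ht.2]⟩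
    have key : ∀ k ∈ Finset.range (n + 1),
        Tendsto (fun s => ⨆ x : ℝ, ‖iteratedDeriv k (f s - f t) x‖ₑ) (𝓝[Ico (0 : ℝ) T] t) (𝓝 0) := by
      intro k hk
      have hkn : k ≤ n := Nat.lt_succ_iff.1 (Finset.mem_range.1 hk)
      have hg := hF.continuous_iteratedDeriv hkn
      rw [ENNReal.tendsto_nhds_zero]
      intro ε hε
      have hev : ∀ᶠ s in 𝓝 t, ∀ x ∈ Icc m M,
          ‖iteratedDeriv k (F s) x - iteratedDeriv k (F t) x‖ₑ < ε := by
        refine isCompact_Icc.eventually_forall_of_forall_eventually fun x _ => ?_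
        have hc : Continuous fun z : ℝ × ℝ =>
            ‖iteratedDeriv k (F z.1) z.2 - iteratedDeriv k (F t) z.2‖ₑ :=
          (hg.sub (hg.comp (continuous_const.prodMk continuous_snd))).enorm
        refine hc.continuousAt.eventually_lt continuousAt_const ?_
        simpa using hε
      filter_upwards [nhdsWithin_le_nhds hev, self_mem_nhdsWithin,
        nhdsWithin_le_nhds (Iio_mem_nhds (show t < (t + T) / 2 by linarith [ht.2]))] with s h1 h2 h3
      have hs' : s ∈ Icc 0 ((t + T) / 2) := ⟨h2.1, le_of_lt h3⟩
      refine iSup_le fun x => ?_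
      rw [← hFf s hs', ← hFf t ht']
      by_cases hx : x ∈ Icc m M
      · rw [iteratedDeriv_sub ((hF.contDiff s).of_le (by exact_mod_cast hkn)).contDiffAt
          ((hF.contDiff t).of_le (by exact_mod_cast hkn)).contDiffAt]
        exact (h1 x hx).le
      · rw [iteratedDeriv_eq_zero_of_notMem (m := m) (M := M) (fun y hy => ?_) k hx]
        · simp
        · rw [Pi.sub_apply, hFf s hs', hFf t ht', hs s hs' y hy, hs t ht' y hy, sub_zero]
    have := tendsto_finsetSum _ key
    simpa [cNorm] using this
  bdd T' hT' := by
    rcases lt_or_ge T' 0 with h0 | h0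
    · exact ⟨0, ENNReal.zero_lt_top, fun t ht => by linarith [ht.1, ht.2]⟩
    obtain ⟨F, hF, hFf, m, M, hm, hM, hs⟩ := h T' h0 hT'
    have key : ∀ k : ℕ, ∃ C : ℝ≥0∞, C < ∞ ∧ (k ≤ n → ∀ t ∈ Icc 0 T', ∀ x,
        ‖iteratedDeriv k (f t) x‖ₑ ≤ C) := by
      intro k
      by_cases hkn : k ≤ n
      · obtain ⟨C, hC⟩ := (isCompact_Icc (a := (0 : ℝ)) (b := T')).prod
          (isCompact_Icc (a := m) (b := M)) |>.exists_bound_of_continuousOn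
          (hF.continuous_iteratedDeriv hkn).continuousOn
        refine ⟨ENNReal.ofReal C, ENNReal.ofReal_lt_top, fun _ t ht x => ?_⟩
        by_cases hx : x ∈ Icc m M
        · have := hC (t, x) ⟨ht, hx⟩
          simp only [Function.uncurry] at this
          rw [hFf t ht] at this
          rw [← ofReal_norm]
          exact ENNReal.ofReal_le_ofReal this
        · rw [iteratedDeriv_eq_zero_of_notMem (hs t ht) k hx]
          simp
      · exact ⟨0, ENNReal.zero_lt_top, fun h => absurd h hkn⟩
    choose C hC hCb using key
    refine ⟨(∑ k ∈ Finset.range (n + 1), C k) + (ENNReal.ofReal m)⁻¹,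
      ENNReal.add_lt_top.2 ⟨ENNReal.sum_lt_top.2 fun k _ => hC k,
        ENNReal.inv_lt_top.2 (ENNReal.ofReal_pos.2 hm)⟩, fun t ht => add_le_add ?_ ?_⟩
    · exact Finset.sum_le_sum fun k hk => iSup_le fun x =>
        hCb k (Nat.lt_succ_iff.1 (Finset.mem_range.1 hk)) t ht x
    · exact ENNReal.inv_le_inv' (le_iInf₂ fun x hx =>
        ENNReal.ofReal_le_ofReal (tsupport_subset_Icc (hs t ht) hx).1)

/-- Quantitative bounds for a path in `K^1` on a compact time interval. -/
theorem IsKPath.exists_bounds {T : ℝ} {f : ℝ → ℝ → ℝ} (hf : IsKPath 1 T f) {t₁ : ℝ} (ht₁ : t₁ < T) :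
    ∃ M m : ℝ, 0 < m ∧ ∀ t ∈ Icc 0 t₁, (∀ x, |f t x| ≤ M) ∧ (∀ x, |deriv (f t) x| ≤ M) ∧
      ∀ x < m, f t x = 0 := by
  obtain ⟨M, hM, hb⟩ := hf.bdd t₁ ht₁
  have hle : ∀ t ∈ Icc 0 t₁, ∀ k ≤ 1, ∀ x, |iteratedDeriv k (f t) x| ≤ M.toReal := by
    intro t ht k hk x
    have h1 : ‖iteratedDeriv k (f t) x‖ₑ ≤ M := by
      refine le_trans ?_ ((le_add_right le_rfl).trans (hb t ht))
      refine le_trans (le_iSup (fun x => ‖iteratedDeriv k (f t) x‖ₑ) x) ?_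
      exact Finset.single_le_sum (f := fun k => ⨆ x, ‖iteratedDeriv k (f t) x‖ₑ)
        (fun _ _ => zero_le) (Finset.mem_range.2 (by omega))
    have := ENNReal.toReal_mono hM.ne h1
    simpa using this
  -- The summand `1` keeps the inverse finite, hence its real value positive, even when `M = 0`.
  have hpos : 0 < ((M + 1)⁻¹).toReal := by
    refine ENNReal.toReal_pos (ENNReal.inv_ne_zero.2 (by simp [hM.ne])) (by simp)
  refine ⟨M.toReal, ((M + 1)⁻¹).toReal, hpos, fun t ht => ⟨fun x => ?_, fun x => ?_, fun x hx => ?_⟩⟩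
  · simpa using hle t ht 0 zero_le_one x
  · simpa using hle t ht 1 le_rfl x
  · by_contra hne
    have hmem : x ∈ tsupport (f t) := subset_tsupport _ hne
    have h1 : (⨅ x ∈ tsupport (f t), ENNReal.ofReal x)⁻¹ ≤ M + 1 :=
      ((le_add_left le_rfl).trans (hb t ht)).trans (le_add_right le_rfl)
    have h2 : (M + 1)⁻¹ ≤ ENNReal.ofReal x := by
      rw [ENNReal.inv_le_iff_inv_le]
      exact (ENNReal.inv_le_inv' (iInf₂_le x hmem)).trans h1
    have h3 : 0 < ENNReal.ofReal x :=
      lt_of_lt_of_le (ENNReal.inv_pos.2 (by simp [hM.ne])) h2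
    have h4 := ENNReal.toReal_mono ENNReal.ofReal_ne_top h2
    rw [ENNReal.toReal_ofReal (ENNReal.ofReal_pos.1 h3).le] at h4
    linarith

theorem enorm_iteratedDeriv_le_cNorm {n k : ℕ} (hk : k ≤ n) (f : ℝ → ℝ) (x : ℝ) :
    ‖iteratedDeriv k f x‖ₑ ≤ cNorm n f :=
  (le_iSup (fun x => ‖iteratedDeriv k f x‖ₑ) x).trans
    (Finset.single_le_sum (f := fun k => ⨆ x, ‖iteratedDeriv k f x‖ₑ) (fun _ _ => zero_le)
      (Finset.mem_range.2 (by omega)))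

theorem IsKPath.jointC {T : ℝ} {f : ℝ → ℝ → ℝ} (hf : IsKPath 1 T f) {t₁ : ℝ} (h0 : 0 ≤ t₁)
    (ht₁ : t₁ < T) : JointC 1 fun t => f (clampTime t₁ t) := by
  have hmem : ∀ t, clampTime t₁ t ∈ Ico 0 T := fun t =>
    ⟨(clampTime_mem h0 t).1, (clampTime_mem h0 t).2.trans_lt ht₁⟩
  have hCD : ∀ t, ContDiff ℝ 1 (f (clampTime t₁ t)) := fun t => (hf.mem _ (hmem t)).1
  have hjoint : ∀ k ≤ 1,
      Continuous (Function.uncurry fun t => iteratedDeriv k (f (clampTime t₁ t))) := by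
    intro k hk
    rw [continuous_iff_continuousAt]
    rintro ⟨t, x⟩
    have hCDk : ∀ t y, ContDiffAt ℝ k (f (clampTime t₁ t)) y := fun t y =>
      ((hCD t).of_le (by exact_mod_cast hk)).contDiffAt
    have h1 : Tendsto (fun p : ℝ × ℝ => cNorm 1 (f (clampTime t₁ p.1) - f (clampTime t₁ t)))
        (𝓝 (t, x)) (𝓝 0) := by
      refine (hf.cont _ (hmem t)).comp (tendsto_nhdsWithin_iff.2 ⟨?_, ?_⟩)
      · exact ((continuous_clampTime t₁).comp continuous_fst).tendsto (t, x)
      · exact Eventually.of_forall fun p => hmem p.1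
    have h2 : Continuous fun p : ℝ × ℝ => iteratedDeriv k (f (clampTime t₁ t)) p.2 :=
      ((hCD t).continuous_iteratedDeriv k (by exact_mod_cast hk)).comp continuous_snd
    have h3 : Tendsto (fun p : ℝ × ℝ => iteratedDeriv k (f (clampTime t₁ p.1)) p.2
        - iteratedDeriv k (f (clampTime t₁ t)) p.2) (𝓝 (t, x)) (𝓝 0) := by
      rw [tendsto_zero_iff_enorm_tendsto_zero]
      refine tendsto_of_tendsto_of_tendsto_of_le_of_le tendsto_const_nhds h1 (fun _ => zero_le)
        fun p => ?_
      have := enorm_iteratedDeriv_le_cNorm hk (f (clampTime t₁ p.1) - f (clampTime t₁ t)) p.2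
      rwa [iteratedDeriv_sub (hCDk _ _) (hCDk _ _)] at this
    have h4 := h3.add (h2.tendsto (t, x))
    simp only [sub_add_cancel, zero_add] at h4
    exact h4
  refine ⟨by simpa using hjoint 0 zero_le_one, fun t => deriv (f (clampTime t₁ t)), fun t x => ?_, ?_⟩
  · exact ((hCD t).differentiable (by norm_num) x).hasDerivAt
  · show Continuous _
    simpa using hjoint 1 le_rfl

/-! ### Differentiation along moving points -/

/-- `G` need not be differentiable in time, so only the spatial increment is differentiated.
Hadamard's formula writes it as `Φ (t, y) * (y - x₀)` with `Φ` jointly continuous. -/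
theorem hasDerivWithinAt_moving {G : ℝ → ℝ → ℝ} (hG : JointC 1 G) {X : ℝ → ℝ} {X' : ℝ} {I : Set ℝ}
    {t₀ : ℝ} (hX : HasDerivWithinAt X X' I t₀) :
    HasDerivWithinAt (fun t => G t (X t) - G t (X t₀)) (deriv (G t₀) (X t₀) * X') I t₀ := by
  obtain ⟨-, G', hG', hc⟩ := hG
  replace hc : Continuous (Function.uncurry G') := hc
  set x₀ := X t₀ with hx₀
  let Φ : ℝ × ℝ → ℝ := fun p => ∫ r in (0 : ℝ)..1, G' p.1 (x₀ + r * (p.2 - x₀))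
  have hΦ : Continuous Φ := by
    refine intervalIntegral.continuous_parametric_intervalIntegral_of_continuous'
      (f := fun (p : ℝ × ℝ) r => G' p.1 (x₀ + r * (p.2 - x₀))) ?_ 0 1
    exact hc.comp (g := Function.uncurry G')
      (f := fun q : (ℝ × ℝ) × ℝ => (q.1.1, x₀ + q.2 * (q.1.2 - x₀))) (by fun_prop)
  have hmv : ∀ t y, G t y - G t x₀ = Φ (t, y) * (y - x₀) := by
    intro t y
    have hd : ∀ r, HasDerivAt (fun r => G t (x₀ + r * (y - x₀)))
        (G' t (x₀ + r * (y - x₀)) * (y - x₀)) r := fun r => by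
      have h1 : HasDerivAt (fun r => x₀ + r * (y - x₀)) (y - x₀) r := by
        simpa using ((hasDerivAt_id r).mul_const (y - x₀)).const_add x₀
      exact (hG' t _).comp r h1
    have hcr : Continuous fun r => G' t (x₀ + r * (y - x₀)) * (y - x₀) :=
      (hc.comp (g := Function.uncurry G') (f := fun r : ℝ => (t, x₀ + r * (y - x₀)))
        (by fun_prop)).mul continuous_const
    have := intervalIntegral.integral_eq_sub_of_hasDerivAt (a := 0) (b := 1) (fun r _ => hd r)
      (hcr.intervalIntegrable _ _)
    simp only [one_mul, zero_mul, add_zero, add_sub_cancel] at this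
    rw [← this, intervalIntegral.integral_mul_const]
  have hΦ0 : Φ (t₀, x₀) = deriv (G t₀) x₀ := by
    simp only [Φ, sub_self, mul_zero, add_zero, intervalIntegral.integral_const, sub_zero, one_smul,
      (hG' t₀ x₀).deriv]
  rw [hasDerivWithinAt_iff_tendsto_slope] at hX ⊢
  have h1 : Tendsto (fun t => Φ (t, X t)) (𝓝[I \ {t₀}] t₀) (𝓝 (Φ (t₀, x₀))) := by
    have hXc : Tendsto X (𝓝[I \ {t₀}] t₀) (𝓝 x₀) := by
      have := (hasDerivWithinAt_iff_tendsto_slope.2 hX).continuousWithinAt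
      exact this.mono_left (nhdsWithin_mono _ sdiff_subset)
    exact (hΦ.tendsto (t₀, x₀)).comp
      ((tendsto_id.mono_left nhdsWithin_le_nhds).prodMk_nhds hXc)
  rw [← hΦ0]
  refine (h1.mul hX).congr fun t => ?_
  simp only [slope, vsub_eq_sub, smul_eq_mul]
  rw [hmv t (X t), ← hx₀, sub_self, sub_zero]
  ring

/-! ### The velocity in logarithmic coordinates -/

theorem integral_div_eq_mass {w ω : ℝ → ℝ} (hw : Continuous w) (hw0 : ∀ s ≥ 0, w s = 0)
    (hω : ∀ x, 0 < x → ω x = w (Real.log x)) {u : ℝ} (hu : 0 < u) :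
    ∫ y in (min u 1)..1, ω y / y = mass w (Real.log u) := by
  rcases le_total u 1 with h | h
  · rw [min_eq_left h]
    have hpos : ∀ y ∈ uIcc u 1, 0 < y := fun y hy => by
      rw [uIcc_of_le h] at hy; exact hu.trans_le hy.1
    have := intervalIntegral.integral_comp_mul_deriv' (a := u) (b := 1) (f := Real.log)
      (f' := fun x => x⁻¹) (g := w) (fun x hx => Real.hasDerivAt_log (hpos x hx).ne')
      (continuousOn_id.inv₀ fun x hx => (hpos x hx).ne') hw.continuousOn
    rw [Real.log_one] at this
    rw [mass, ← this]
    refine intervalIntegral.integral_congr fun y hy => ?_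
    simp only [Function.comp, hω y (hpos y hy), div_eq_mul_inv]
  · rw [min_eq_right h, intervalIntegral.integral_same,
      mass_eq_zero le_rfl hw0 (Real.log_nonneg h)]

/-- Under `y = exp s` the measure `dy / y` becomes `ds`, the factors `β₁`, `β₂` become shifts, and
the cutoffs at `1` are harmless since `w` vanishes for `s ≥ 0`. The integral over `(β₁ x, 1)` is
subtracted twice, whence the factor `2`. -/
theorem velocity_eq_logVel {β₁ β₂ : ℝ} (hβ₁ : 0 < β₁) (hβ₂ : 0 < β₂) {w ω : ℝ → ℝ}
    (hw : Continuous w) (hw0 : ∀ s ≥ 0, w s = 0) (hω : ∀ x, 0 < x → ω x = w (Real.log x)) {x : ℝ}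
    (hx : 0 < x) :
    velocity β₁ β₂ ω x = x * logVel (Real.log β₁) (Real.log β₂) w (Real.log x) := by
  have hint : ∀ u > 0, IntervalIntegrable (fun y => ω y / y) volume (min u 1) 1 := fun u hu => by
    have hpos : ∀ y ∈ uIcc (min u 1) 1, 0 < y := fun y hy => by
      rw [uIcc_of_le (min_le_right _ _)] at hy
      exact (lt_min hu one_pos).trans_le hy.1
    have h1 : ContinuousOn (fun y => w (Real.log y) / y) (uIcc (min u 1) 1) :=
      (hw.comp_continuousOn (Real.continuousOn_log.mono fun y hy => (hpos y hy).ne')).div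
        continuousOn_id fun y hy => (hpos y hy).ne'
    refine (h1.congr fun y hy => ?_).intervalIntegrable
    rw [hω y (hpos y hy)]
  have h1 : 0 < β₁ * x := by positivity
  have h2 : 0 < β₂ * x := by positivity
  have hadd := intervalIntegral.integral_interval_sub_interval_comm (hint _ h2) (hint _ h1)
    ((hint _ h2).trans (hint _ h1).symm)
  rw [intervalIntegral.integral_same, sub_zero, integral_div_eq_mass hw hw0 hω h1,
    integral_div_eq_mass hw hw0 hω h2] at hadd
  rw [velocity, ← hadd, integral_div_eq_mass hw hw0 hω h1, logVel_eq_mass,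
    Real.log_mul hβ₁.ne' hx.ne', Real.log_mul hβ₂.ne' hx.ne', add_comm (Real.log β₁),
    add_comm (Real.log β₂)]
  ring

/-! ### The Eulerian solution attached to a flow -/

/-- The vorticity as a function on `ℝ`. -/
noncomputable def eulerVort (A : ℝ) (α : ℝ → FlowState) (t x : ℝ) : ℝ :=
  if 0 < x then vorticity A (α t) (Real.log x) else 0

/-- The density as a function on `ℝ`. -/
noncomputable def eulerDens (R : ℝ → ℝ) (α : ℝ → FlowState) (t x : ℝ) : ℝ :=
  if 0 < x then R (label (α t).1 (Real.log x)) else 0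

section Euler

variable {A : ℝ} {R : ℝ → ℝ} {hR : IsProfile A R} {b₁ b₂ : ℝ} {α : ℝ → FlowState}

theorem eulerVort_exp (t s : ℝ) : eulerVort A α t (Real.exp s) = vorticity A (α t) s := by
  rw [eulerVort, if_pos (Real.exp_pos s), Real.log_exp]

theorem eulerDens_exp (t s : ℝ) : eulerDens R α t (Real.exp s) = R (label (α t).1 s) := by
  rw [eulerDens, if_pos (Real.exp_pos s), Real.log_exp]

theorem IsFlow.vorticity_eq {t₁ : ℝ} (h : IsFlow hR b₁ b₂ (Icc 0 t₁) α) {t : ℝ}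
    (ht : t ∈ Icc 0 t₁) (s : ℝ) :
    vorticity A (α t) s = R (label (α t).1 s)
      * ∫ τ in (0 : ℝ)..t, Real.exp (-position (α τ).1 (label (α t).1 s)) := by
  conv_lhs => rw [← position_label (α t).1.continuous (abs_fst_le (α t)) s]
  exact h.vorticity_position ht _

/-- A lower bound for the positions of the particles carrying vorticity or density. -/
theorem IsFlow.exists_support_bound {t₁ : ℝ} (h : IsFlow hR b₁ b₂ (Icc 0 t₁) α) (h0 : 0 ≤ t₁) :
    ∃ K, ∀ t ∈ Icc 0 t₁, ∀ s ≤ K, R (label (α t).1 s) = 0 := by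
  have hA : A ≤ 0 := by linarith [hR.le]
  obtain ⟨N, hN⟩ := h.exists_bound h0
  refine ⟨-(Real.exp N * -A), fun t ht s hs => hR.zero_of_le _ ?_⟩
  have hN' : ∀ x, |(α t).1 x| ≤ N := fun x => by
    have := hN t
    rw [clampTime_of_mem ht] at this
    exact (abs_fst_le _ x).trans this
  rw [label_le_iff (α t).1.continuous hN']
  have := exp_neg_position_le (α t).1.continuous hN' (a := A) ⟨le_rfl, hA⟩
  linarith

theorem profile_label_eq_zero (hR : IsProfile A R) (x : FlowState) {s : ℝ}
    (hs : position x.1 (-2) ≤ s) : R (label x.1 s) = 0 :=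
  hR.zero_of_ge _ ((le_label_iff x.1.continuous (abs_fst_le x) _ _).2 hs)

variable {T : ℝ}

theorem IsFlow.restrict (h : IsFlow hR b₁ b₂ (Ico 0 T) α) {t₁ : ℝ} (ht₁ : t₁ < T) :
    IsFlow hR b₁ b₂ (Icc 0 t₁) α := h.mono fun _ hx => ⟨hx.1, hx.2.trans_lt ht₁⟩

theorem IsFlow.jointC_eulerDens {t₁ : ℝ} (h : IsFlow hR b₁ b₂ (Icc 0 t₁) α) (h0 : 0 ≤ t₁) (n : ℕ) :
    JointC n fun t => eulerDens R α (clampTime t₁ t) := by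
  obtain ⟨K, hK⟩ := h.exists_support_bound h0
  exact ((JointC.of_contDiff (hR.smooth n)).comp (h.jointC_label h0 n)).comp_log
    fun t s hs => hK _ (clampTime_mem h0 t) s hs

theorem IsFlow.jointC_eulerVort {t₁ : ℝ} (h : IsFlow hR b₁ b₂ (Icc 0 t₁) α) (h0 : 0 ≤ t₁) (n : ℕ) :
    JointC n fun t => eulerVort A α (clampTime t₁ t) := by
  obtain ⟨K, hK⟩ := h.exists_support_bound h0
  refine (h.jointC_vorticity h0 n).comp_log (K := K) fun t s hs => ?_
  rw [h.vorticity_eq (clampTime_mem h0 t), hK _ (clampTime_mem h0 t) s hs, zero_mul]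

theorem IsFlow.exists_euler_support {t₁ : ℝ} (h : IsFlow hR b₁ b₂ (Icc 0 t₁) α) (h0 : 0 ≤ t₁)
    (hedge : ∀ t ∈ Icc 0 t₁, position (α t).1 (-2) ≤ -1) :
    ∃ m M, 0 < m ∧ M < 1 ∧ ∀ t ∈ Icc 0 t₁, ∀ x ∉ Icc m M,
      eulerVort A α t x = 0 ∧ eulerDens R α t x = 0 := by
  obtain ⟨K, hK⟩ := h.exists_support_bound h0
  refine ⟨Real.exp K, Real.exp (-1), Real.exp_pos K, by simp, fun t ht x hx => ?_⟩
  unfold eulerVort eulerDens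
  split_ifs with hx0
  · have : R (label (α t).1 (Real.log x)) = 0 := by
      rcases not_and_or.1 hx with h1 | h1
      · exact hK t ht _ ((Real.log_le_iff_le_exp hx0).2 (le_of_not_ge h1))
      · refine profile_label_eq_zero hR _ ((hedge t ht).trans ?_)
        exact (Real.le_log_iff_exp_le hx0).2 (le_of_not_ge h1)
    exact ⟨by rw [h.vorticity_eq ht, this, zero_mul], this⟩
  · exact ⟨rfl, rfl⟩

theorem IsFlow.isKPath_eulerVort (h : IsFlow hR b₁ b₂ (Ico 0 T) α)
    (hedge : ∀ t ∈ Ico 0 T, position (α t).1 (-2) ≤ -1) (n : ℕ) :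
    IsKPath n T (eulerVort A α) :=
  isKPath_of_jointC fun t₁ h0 ht₁ => by
    obtain ⟨m, M, hm, hM, hs⟩ := (h.restrict ht₁).exists_euler_support h0
      fun t ht => hedge t ⟨ht.1, ht.2.trans_lt ht₁⟩
    exact ⟨_, (h.restrict ht₁).jointC_eulerVort h0 n, fun t ht => by rw [clampTime_of_mem ht],
      m, M, hm, hM, fun t ht x hx => (hs t ht x hx).1⟩

theorem IsFlow.isKPath_eulerDens (h : IsFlow hR b₁ b₂ (Ico 0 T) α)
    (hedge : ∀ t ∈ Ico 0 T, position (α t).1 (-2) ≤ -1) (n : ℕ) :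
    IsKPath n T (eulerDens R α) :=
  isKPath_of_jointC fun t₁ h0 ht₁ => by
    obtain ⟨m, M, hm, hM, hs⟩ := (h.restrict ht₁).exists_euler_support h0
      fun t ht => hedge t ⟨ht.1, ht.2.trans_lt ht₁⟩
    exact ⟨_, (h.restrict ht₁).jointC_eulerDens h0 n, fun t ht => by rw [clampTime_of_mem ht],
      m, M, hm, hM, fun t ht x hx => (hs t ht x hx).2⟩

variable {β₁ β₂ : ℝ}

theorem velocity_eulerVort (hR : IsProfile A R) (hβ₁ : 0 < β₁) (hβ₂ : 0 < β₂) (t : ℝ) {x : ℝ}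
    (hx : 0 < x) : velocity β₁ β₂ (eulerVort A α t) x
      = x * logVel (Real.log β₁) (Real.log β₂) (vorticity A (α t)) (Real.log x) :=
  velocity_eq_logVel hβ₁ hβ₂ (continuous_vorticity (α t))
    (fun _ => vorticity_of_nonneg (by linarith [hR.le]) (α t))
    (fun _ hx => if_pos hx) hx

/-- Particles move with the Eulerian velocity. -/
theorem IsFlow.hasDerivWithinAt_exp_position (hβ₁ : 0 < β₁) (hβ₂ : 0 < β₂) {I : Set ℝ}
    (h : IsFlow hR (Real.log β₁) (Real.log β₂) I α)
    (hv : ∀ t ∈ I, logVel (Real.log β₁) (Real.log β₂) (vorticity A (α t)) 0 = 0) {t : ℝ}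
    (ht : t ∈ I) (a : ℝ) :
    HasDerivWithinAt (fun τ => Real.exp (position (α τ).1 a))
      (velocity β₁ β₂ (eulerVort A α t) (Real.exp (position (α t).1 a))) I t := by
  have := (h.hasDerivWithinAt_position ht a).exp
  rw [hv t ht, sub_zero] at this
  rw [velocity_eulerVort hR hβ₁ hβ₂ t (Real.exp_pos _), Real.log_exp]
  exact this

/-- Passage from Lagrangian to Eulerian derivatives; `hasDerivWithinAt_along` is the converse
passage. -/
theorem hasDerivWithinAt_of_moving {f : ℝ → ℝ → ℝ} {t₁ t : ℝ} (ht : t ∈ Icc 0 t₁)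
    (hf : JointC 1 fun t => f (clampTime t₁ t)) {X : ℝ → ℝ} {X' D : ℝ}
    (hX : HasDerivWithinAt X X' (Icc 0 t₁) t)
    (hD : HasDerivWithinAt (fun τ => f τ (X τ)) D (Icc 0 t₁) t) :
    HasDerivWithinAt (fun τ => f τ (X t)) (D - X' * deriv (f t) (X t)) (Icc 0 t₁) t := by
  have h1 := hasDerivWithinAt_moving hf hX
  rw [clampTime_of_mem ht] at h1
  have h2 := hD.sub h1
  rw [mul_comm] at h2
  refine h2.congr (fun τ hτ => ?_) ?_
  · simp only [Pi.sub_apply]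
    rw [clampTime_of_mem hτ]; ring
  · simp only [Pi.sub_apply]
    rw [clampTime_of_mem ht]; ring

theorem IsFlow.isSolution (hβ₁ : 0 < β₁) (hβ₂ : 0 < β₂)
    (h : IsFlow hR (Real.log β₁) (Real.log β₂) (Ico 0 T) α)
    (hedge : ∀ t ∈ Ico 0 T, position (α t).1 (-2) ≤ -1)
    (hv : ∀ t ∈ Ico 0 T, logVel (Real.log β₁) (Real.log β₂) (vorticity A (α t)) 0 = 0) (n : ℕ) :
    IsSolution β₁ β₂ n T (eulerVort A α 0) (eulerDens R α 0) (eulerVort A α) (eulerDens R α) where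
  omega_path := h.isKPath_eulerVort hedge n
  rho_path := h.isKPath_eulerDens hedge n
  omega_init := rfl
  rho_init := rfl
  omega_eq t ht x hx := by
    set t₁ := (t + T) / 2 with ht₁
    have h1 : t < t₁ := by linarith [ht.2]
    have h2 : t₁ < T := by linarith [ht.2]
    have h0 : 0 ≤ t₁ := ht.1.trans h1.le
    have htm : t ∈ Icc 0 t₁ := ⟨ht.1, h1.le⟩
    have hf := h.restrict h2
    set a := label (α t).1 (Real.log x) with ha
    have hxa : Real.exp (position (α t).1 a) = x := by
      rw [ha, position_label (α t).1.continuous (abs_fst_le _), Real.exp_log hx.1]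
    have hX := hf.hasDerivWithinAt_exp_position hβ₁ hβ₂
      (fun t ht => hv t ⟨ht.1, ht.2.trans_lt h2⟩) htm a
    have hco : ContinuousOn (fun τ => Real.exp (-position (α τ).1 a)) (Icc 0 t₁) :=
      (hf.continuousOn_position a).neg.rexp
    have hD : HasDerivWithinAt (fun τ => eulerVort A α τ (Real.exp (position (α τ).1 a)))
        (R a * Real.exp (-position (α t).1 a)) (Icc 0 t₁) t := by
      have : Fact (t ∈ Icc 0 t₁) := ⟨htm⟩
      have h3 := (intervalIntegral.integral_hasDerivWithinAt_right (s := Icc 0 t₁) (t := Icc 0 t₁)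
        ((hco.mono (Icc_subset_Icc_right h1.le)).intervalIntegrable_of_Icc ht.1)
        (hco.stronglyMeasurableAtFilter_nhdsWithin measurableSet_Icc t) (hco t htm)).const_mul (R a)
      refine h3.congr (fun τ hτ => ?_) ?_
      · rw [eulerVort_exp, hf.vorticity_position hτ]
      · rw [eulerVort_exp, hf.vorticity_position htm]
    have h4 := hasDerivWithinAt_of_moving htm (hf.jointC_eulerVort h0 1) hX hD
    rw [hxa] at h4
    have h5 : R a * Real.exp (-position (α t).1 a) = eulerDens R α t x / x := by
      rw [Real.exp_neg, hxa, ← hxa, eulerDens_exp, label_position (α t).1.continuous, hxa,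
        div_eq_mul_inv]
    rw [h5] at h4
    refine h4.mono_of_mem_nhdsWithin ?_
    filter_upwards [self_mem_nhdsWithin, mem_nhdsWithin_of_mem_nhds (Iio_mem_nhds h1)] with y hy hy'
    exact ⟨hy.1, le_of_lt hy'⟩
  rho_eq t ht x hx := by
    set t₁ := (t + T) / 2 with ht₁
    have h1 : t < t₁ := by linarith [ht.2]
    have h2 : t₁ < T := by linarith [ht.2]
    have h0 : 0 ≤ t₁ := ht.1.trans h1.le
    have htm : t ∈ Icc 0 t₁ := ⟨ht.1, h1.le⟩
    have hf := h.restrict h2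
    set a := label (α t).1 (Real.log x) with ha
    have hxa : Real.exp (position (α t).1 a) = x := by
      rw [ha, position_label (α t).1.continuous (abs_fst_le _), Real.exp_log hx.1]
    have hX := hf.hasDerivWithinAt_exp_position hβ₁ hβ₂
      (fun t ht => hv t ⟨ht.1, ht.2.trans_lt h2⟩) htm a
    have hD : HasDerivWithinAt (fun τ => eulerDens R α τ (Real.exp (position (α τ).1 a)))
        0 (Icc 0 t₁) t := by
      have : (fun τ => eulerDens R α τ (Real.exp (position (α τ).1 a))) = fun _ => R a := by
        ext τ
        rw [eulerDens_exp, label_position (α τ).1.continuous]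
      rw [this]
      exact hasDerivWithinAt_const _ _ _
    have h4 := hasDerivWithinAt_of_moving htm (hf.jointC_eulerDens h0 1) hX hD
    rw [hxa, zero_sub] at h4
    refine h4.mono_of_mem_nhdsWithin ?_
    filter_upwards [self_mem_nhdsWithin, mem_nhdsWithin_of_mem_nhds (Iio_mem_nhds h1)] with y hy hy'
    exact ⟨hy.1, le_of_lt hy'⟩

end Euler

/-! ### Uniqueness -/

theorem cNorm_mono {n m : ℕ} (h : n ≤ m) (f : ℝ → ℝ) : cNorm n f ≤ cNorm m f :=
  Finset.sum_le_sum_of_subset (Finset.range_subset_range.2 (by omega))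

theorem IsKPath.of_le {n m : ℕ} (h : n ≤ m) {T : ℝ} {f : ℝ → ℝ → ℝ} (hf : IsKPath m T f) :
    IsKPath n T f where
  mem t ht := ⟨(hf.mem t ht).1.of_le (by exact_mod_cast h), (hf.mem t ht).2⟩
  cont t ht := tendsto_of_tendsto_of_tendsto_of_le_of_le tendsto_const_nhds (hf.cont t ht)
    (fun _ => zero_le) fun _ => cNorm_mono h _
  bdd T' hT' := by
    obtain ⟨M, hM, hb⟩ := hf.bdd T' hT'
    exact ⟨M, hM, fun t ht => (add_le_add (cNorm_mono h _) le_rfl).trans (hb t ht)⟩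

theorem IsSolution.of_le {β₁ β₂ : ℝ} {n m : ℕ} (h : n ≤ m) {T : ℝ} {ω₀ ρ₀ : ℝ → ℝ}
    {ω ρ : ℝ → ℝ → ℝ} (hs : IsSolution β₁ β₂ m T ω₀ ρ₀ ω ρ) : IsSolution β₁ β₂ n T ω₀ ρ₀ ω ρ :=
  ⟨hs.1.of_le h, hs.2.of_le h, hs.3, hs.4, hs.5, hs.6⟩

theorem MemK.eq_zero {n : ℕ} {f : ℝ → ℝ} (hf : MemK n f) {x : ℝ} (hx : x ∉ Ioo (0 : ℝ) 1) :
    f x = 0 := by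
  by_contra h
  exact hx (hf.2.2 (subset_tsupport f h))

theorem continuous_div_self {f : ℝ → ℝ} (hf : Continuous f) {m : ℝ} (hm : 0 < m)
    (h0 : ∀ x < m, f x = 0) : Continuous fun x => f x / x := by
  rw [continuous_iff_continuousAt]
  intro x
  rcases lt_or_ge x m with h | h
  · refine (continuousAt_const (y := (0 : ℝ))).congr ?_
    filter_upwards [Iio_mem_nhds h] with y hy
    rw [h0 y hy, zero_div]
  · exact hf.continuousAt.div continuousAt_id (hm.trans_le h).ne'

/-- Supports bounded away from `0` make the kernel `1 / y` bounded by `1 / m`, and each of the two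
integrals runs over a subinterval of `[0, 1]`. -/
theorem abs_velocity_sub_le {β₁ β₂ : ℝ} (hβ₁ : 0 < β₁) (hβ₂ : 0 < β₂) {f g : ℝ → ℝ}
    (hf : Continuous f) (hg : Continuous g) {m D : ℝ} (hm : 0 < m) (hf0 : ∀ x < m, f x = 0)
    (hg0 : ∀ x < m, g x = 0) (hD : ∀ x, |f x - g x| ≤ D) {x : ℝ} (hx : x ∈ Ioo (0 : ℝ) 1) :
    |velocity β₁ β₂ f x - velocity β₁ β₂ g x| ≤ 2 * D / m := by
  have hD0 : 0 ≤ D := (abs_nonneg _).trans (hD 0)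
  have hfc := continuous_div_self hf hm hf0
  have hgc := continuous_div_self hg hm hg0
  have hb : ∀ y, ‖f y / y - g y / y‖ ≤ D / m := fun y => by
    rcases lt_or_ge y m with h | h
    · rw [hf0 y h, hg0 y h]; simp; positivity
    · rw [← sub_div, Real.norm_eq_abs, abs_div, abs_of_pos (hm.trans_le h)]
      exact div_le_div₀ hD0 (hD y) hm h
  have hint : ∀ u v, u ∈ Icc (0 : ℝ) 1 → v ∈ Icc (0 : ℝ) 1 →
      |(∫ y in u..v, f y / y) - ∫ y in u..v, g y / y| ≤ D / m := fun u v hu hv => by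
    rw [← intervalIntegral.integral_sub (hfc.intervalIntegrable _ _) (hgc.intervalIntegrable _ _)]
    refine (intervalIntegral.norm_integral_le_of_norm_le_const
      (f := fun y => f y / y - g y / y) fun y _ => hb y).trans ?_
    have h1 : |v - u| ≤ 1 := abs_le.2 ⟨by linarith [hu.2, hv.1], by linarith [hu.1, hv.2]⟩
    calc D / m * |v - u| ≤ D / m * 1 := mul_le_mul_of_nonneg_left h1 (by positivity)
      _ = _ := mul_one _
  have hmem : ∀ β : ℝ, 0 < β → min (β * x) 1 ∈ Icc (0 : ℝ) 1 := fun β hβ =>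
    ⟨le_min (mul_pos hβ hx.1).le zero_le_one, min_le_right _ _⟩
  have h1 := hint _ _ (hmem β₂ hβ₂) (hmem β₁ hβ₁)
  have h2 := hint _ 1 (hmem β₁ hβ₁) ⟨zero_le_one, le_rfl⟩
  set a := (∫ y in (min (β₂ * x) 1)..(min (β₁ * x) 1), f y / y)
    - ∫ y in (min (β₂ * x) 1)..(min (β₁ * x) 1), g y / y
  set b := (∫ y in (min (β₁ * x) 1)..1, f y / y) - ∫ y in (min (β₁ * x) 1)..1, g y / y
  have h3 : velocity β₁ β₂ f x - velocity β₁ β₂ g x = x * (a - b) := by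
    simp only [velocity, a, b]; ring
  rw [h3, abs_mul, abs_of_pos hx.1]
  have h4 : |a - b| ≤ 2 * D / m := by
    refine (abs_sub _ _).trans ((add_le_add h1 h2).trans_eq ?_)
    ring
  calc x * |a - b| ≤ 1 * (2 * D / m) := mul_le_mul hx.2.le h4 (abs_nonneg _) zero_le_one
    _ = _ := one_mul _

theorem hasDerivWithinAt_along {f : ℝ → ℝ → ℝ} {t₁ t : ℝ} (ht : t ∈ Icc 0 t₁)
    (hf : JointC 1 fun t => f (clampTime t₁ t)) {X : ℝ → ℝ} {X' D : ℝ}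
    (hX : HasDerivWithinAt X X' (Icc 0 t₁) t)
    (hD : HasDerivWithinAt (fun τ => f τ (X t)) D (Icc 0 t₁) t) :
    HasDerivWithinAt (fun τ => f τ (X τ)) (D + deriv (f t) (X t) * X') (Icc 0 t₁) t := by
  have h1 := hasDerivWithinAt_moving hf hX
  rw [clampTime_of_mem ht] at h1
  refine (hD.add h1).congr (fun τ hτ => ?_) ?_
  · simp only [Pi.add_apply]
    rw [clampTime_of_mem hτ]; ring
  · simp only [Pi.add_apply]
    rw [clampTime_of_mem ht]; ring

/-- The existence of backward particle trajectories inside `(0, 1)`. -/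
def HasTrajectories (β₁ β₂ T : ℝ) (ω : ℝ → ℝ → ℝ) : Prop :=
  ∀ t ∈ Ico 0 T, ∀ x ∈ Ioo (0 : ℝ) 1, ∃ X : ℝ → ℝ, X t = x ∧ ∀ σ ∈ Icc 0 t, X σ ∈ Ioo (0 : ℝ) 1 ∧
    HasDerivWithinAt X (velocity β₁ β₂ (ω σ) (X σ)) (Icc 0 t) σ

/-- Both solutions are followed along the trajectories of the first, so none are needed for the
second. The mismatch is the difference of velocities times a bounded space derivative of the second
solution, plus the difference of the sources `ρ / x`; both are bounded by the sup norm of the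
difference of solutions. -/
theorem IsSolution.eq_of_hasTrajectories {β₁ β₂ T T' : ℝ} (hβ₁ : 0 < β₁) (hβ₂ : 0 < β₂)
    {ω₀ ρ₀ : ℝ → ℝ} {ω ρ ω' ρ' : ℝ → ℝ → ℝ} (h : IsSolution β₁ β₂ 1 T ω₀ ρ₀ ω ρ)
    (h' : IsSolution β₁ β₂ 1 T' ω₀ ρ₀ ω' ρ') (htraj : HasTrajectories β₁ β₂ T ω) {t : ℝ}
    (h0 : 0 ≤ t) (ht : t < T) (ht' : t < T') : ω' t = ω t ∧ ρ' t = ρ t := by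
  obtain ⟨M₁, m₁, hm₁, hω⟩ := h.omega_path.exists_bounds ht
  obtain ⟨M₂, m₂, hm₂, hρ⟩ := h.rho_path.exists_bounds ht
  obtain ⟨M₃, m₃, hm₃, hω'⟩ := h'.omega_path.exists_bounds ht'
  obtain ⟨M₄, m₄, hm₄, hρ'⟩ := h'.rho_path.exists_bounds ht'
  set m := min (min m₁ m₂) (min m₃ m₄) with hm
  have hm0 : 0 < m := lt_min (lt_min hm₁ hm₂) (lt_min hm₃ hm₄)
  have hmm₁ : m ≤ m₁ := (min_le_left _ _).trans (min_le_left _ _)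
  have hmm₂ : m ≤ m₂ := (min_le_left _ _).trans (min_le_right _ _)
  have hmm₃ : m ≤ m₃ := (min_le_right _ _).trans (min_le_left _ _)
  have hmm₄ : m ≤ m₄ := (min_le_right _ _).trans (min_le_right _ _)
  set M := |M₁| + |M₂| + |M₃| + |M₄| with hM
  have hM0 : 0 ≤ M := by positivity
  have hMM₁ : M₁ ≤ M := by linarith [le_abs_self M₁, abs_nonneg M₂, abs_nonneg M₃, abs_nonneg M₄]
  have hMM₂ : M₂ ≤ M := by linarith [le_abs_self M₂, abs_nonneg M₁, abs_nonneg M₃, abs_nonneg M₄]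
  have hMM₃ : M₃ ≤ M := by linarith [le_abs_self M₃, abs_nonneg M₂, abs_nonneg M₁, abs_nonneg M₄]
  have hMM₄ : M₄ ≤ M := by linarith [le_abs_self M₄, abs_nonneg M₂, abs_nonneg M₃, abs_nonneg M₁]
  -- The `1 / m` comes from the source `ρ / x`, the `2 * M / m` from the velocity difference times a
  -- space derivative. Iterating the resulting integral inequality gives `B n`, which tends to zero
  -- because of the factorial.
  set C := (1 + 2 * M) / m with hC
  have hC0 : 0 ≤ C := by positivity
  set B : ℕ → ℝ → ℝ := fun n s => 2 * M * ((C * s) ^ n / n.factorial) with hB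
  have hIcc : ∀ {s}, s ∈ Icc 0 t → s ∈ Ico 0 T := fun hs => ⟨hs.1, hs.2.trans_lt ht⟩
  have hIcc' : ∀ {s}, s ∈ Icc 0 t → s ∈ Ico 0 T' := fun hs => ⟨hs.1, hs.2.trans_lt ht'⟩
  have hBd : ∀ n s, HasDerivAt (B (n + 1)) (C * B n s) s := fun n s => by
    have h1 := ((((hasDerivAt_id s).const_mul C).pow (n + 1)).div_const
      ((n + 1).factorial : ℝ)).const_mul (2 * M)
    refine h1.congr_deriv ?_
    simp only [hB, Nat.factorial_succ, Nat.cast_mul, id, Nat.add_sub_cancel]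
    push_cast
    field_simp
  have key : ∀ n, ∀ s ∈ Icc 0 t, ∀ x, |ω' s x - ω s x| ≤ B n s ∧ |ρ' s x - ρ s x| ≤ B n s := by
    intro n
    induction n with
    | zero =>
      intro s hs x
      simp only [hB, pow_zero, Nat.factorial_zero, Nat.cast_one, div_one, mul_one]
      exact ⟨(abs_sub _ _).trans (by linarith [(hω s hs).1 x, (hω' s hs).1 x]),
        (abs_sub _ _).trans (by linarith [(hρ s hs).1 x, (hρ' s hs).1 x])⟩
    | succ n ih =>
      intro s hs x
      have hBn : 0 ≤ B (n + 1) s := by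
        have := hs.1
        simp only [hB]; positivity
      by_cases hx : x ∈ Ioo (0 : ℝ) 1
      swap
      · rw [(h.omega_path.mem s (hIcc hs)).eq_zero hx, (h.rho_path.mem s (hIcc hs)).eq_zero hx,
          (h'.omega_path.mem s (hIcc' hs)).eq_zero hx, (h'.rho_path.mem s (hIcc' hs)).eq_zero hx]
        simpa using hBn
      obtain ⟨X, hXs, hX⟩ := htraj s (hIcc hs) x hx
      have hsub : ∀ {σ}, σ ∈ Icc 0 s → σ ∈ Icc 0 t := fun hσ => ⟨hσ.1, hσ.2.trans hs.2⟩
      have hIs : Icc 0 s ⊆ Ico 0 T := fun σ hσ => hIcc (hsub hσ)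
      have hIs' : Icc 0 s ⊆ Ico 0 T' := fun σ hσ => hIcc' (hsub hσ)
      have hd₁ : ∀ σ ∈ Icc 0 s, HasDerivWithinAt (fun τ => ω τ (X τ))
          (ρ σ (X σ) / X σ) (Icc 0 s) σ := fun σ hσ =>
        (hasDerivWithinAt_along hσ (h.omega_path.jointC hs.1 (hIcc hs).2) (hX σ hσ).2
          ((h.omega_eq σ (hIs hσ) _ (hX σ hσ).1).mono hIs)).congr_deriv (by ring)
      have hd₂ : ∀ σ ∈ Icc 0 s, HasDerivWithinAt (fun τ => ρ τ (X τ)) 0 (Icc 0 s) σ := fun σ hσ =>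
        (hasDerivWithinAt_along hσ (h.rho_path.jointC hs.1 (hIcc hs).2) (hX σ hσ).2
          ((h.rho_eq σ (hIs hσ) _ (hX σ hσ).1).mono hIs)).congr_deriv (by ring)
      have hd₃ : ∀ σ ∈ Icc 0 s, HasDerivWithinAt (fun τ => ω' τ (X τ))
          (ρ' σ (X σ) / X σ + (velocity β₁ β₂ (ω σ) (X σ) - velocity β₁ β₂ (ω' σ) (X σ))
            * deriv (ω' σ) (X σ)) (Icc 0 s) σ := fun σ hσ =>
        (hasDerivWithinAt_along hσ (h'.omega_path.jointC hs.1 (hIcc' hs).2) (hX σ hσ).2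
          ((h'.omega_eq σ (hIs' hσ) _ (hX σ hσ).1).mono hIs')).congr_deriv (by ring)
      have hd₄ : ∀ σ ∈ Icc 0 s, HasDerivWithinAt (fun τ => ρ' τ (X τ))
          ((velocity β₁ β₂ (ω σ) (X σ) - velocity β₁ β₂ (ω' σ) (X σ))
            * deriv (ρ' σ) (X σ)) (Icc 0 s) σ := fun σ hσ =>
        (hasDerivWithinAt_along hσ (h'.rho_path.jointC hs.1 (hIcc' hs).2) (hX σ hσ).2
          ((h'.rho_eq σ (hIs' hσ) _ (hX σ hσ).1).mono hIs')).congr_deriv (by ring)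
      have hvel : ∀ σ ∈ Icc 0 s,
          |velocity β₁ β₂ (ω σ) (X σ) - velocity β₁ β₂ (ω' σ) (X σ)| ≤ 2 * B n σ / m :=
        fun σ hσ => abs_velocity_sub_le hβ₁ hβ₂ (h.omega_path.mem σ (hIs hσ)).1.continuous
          (h'.omega_path.mem σ (hIs' hσ)).1.continuous hm0
          (fun y hy => (hω σ (hsub hσ)).2.2 y (hy.trans_le hmm₁))
          (fun y hy => (hω' σ (hsub hσ)).2.2 y (hy.trans_le hmm₃))
          (fun y => by rw [abs_sub_comm]; exact (ih σ (hsub hσ) y).1) (hX σ hσ).1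
      have hB0 : ∀ σ ∈ Icc 0 s, 0 ≤ B n σ := fun σ hσ =>
        (abs_nonneg _).trans (ih σ (hsub hσ) 0).1
      have hprod : ∀ σ ∈ Icc 0 s, ∀ d, |d| ≤ M →
          |(velocity β₁ β₂ (ω σ) (X σ) - velocity β₁ β₂ (ω' σ) (X σ)) * d|
            ≤ 2 * M / m * B n σ := fun σ hσ d hd => by
        rw [abs_mul]
        calc _ ≤ 2 * B n σ / m * M := mul_le_mul (hvel σ hσ) hd (abs_nonneg _)
              (by have := hB0 σ hσ; positivity)
          _ = _ := by ring
      have hquot : ∀ σ ∈ Icc 0 s, |ρ' σ (X σ) / X σ - ρ σ (X σ) / X σ| ≤ 1 / m * B n σ :=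
        fun σ hσ => by
          rw [← sub_div]
          rcases lt_or_ge (X σ) m with hlt | hge
          · rw [(hρ σ (hsub hσ)).2.2 _ (hlt.trans_le hmm₂),
              (hρ' σ (hsub hσ)).2.2 _ (hlt.trans_le hmm₄)]
            have := hB0 σ hσ
            simp only [sub_zero, zero_div, abs_zero]
            positivity
          · rw [abs_div, abs_of_pos (hm0.trans_le hge)]
            calc _ ≤ B n σ / m := div_le_div₀ (hB0 σ hσ) (ih σ (hsub hσ) _).2 hm0 hge
              _ = _ := by ring
      have hCeq : C = 1 / m + 2 * M / m := by rw [hC]; ring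
      have hfinal : ∀ {φ φ' : ℝ → ℝ},
          (∀ σ ∈ Icc 0 s, HasDerivWithinAt φ (φ' σ) (Icc 0 s) σ) → φ 0 = 0 →
          (∀ σ ∈ Icc 0 s, |φ' σ| ≤ C * B n σ) → |φ s| ≤ B (n + 1) s := by
        intro φ φ' hφ hφ0 hb
        refine image_norm_le_of_norm_deriv_right_le_deriv_boundary (a := 0) (b := s) (f := φ)
          (f' := φ') (fun σ hσ => (hφ σ hσ).continuousWithinAt)
          (fun σ hσ => ((hφ σ (Ico_subset_Icc_self hσ)).mono_of_mem_nhdsWithin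
            (Icc_mem_nhdsGE_of_mem hσ))) ?_ (hBd n) (fun σ hσ => hb σ (Ico_subset_Icc_self hσ))
          ⟨hs.1, le_rfl⟩
        rw [hφ0]; simp [hB]
      rw [← hXs]
      constructor
      · refine hfinal (φ := fun τ => ω' τ (X τ) - ω τ (X τ))
          (fun σ hσ => (hd₃ σ hσ).sub (hd₁ σ hσ)) ?_ fun σ hσ => ?_
        · simp only [h.omega_init, h'.omega_init, sub_self]
        · have h1 := hprod σ hσ _ (((hω' σ (hsub hσ)).2.1 (X σ)).trans hMM₃)
          have h2 := hquot σ hσ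
          rw [hCeq, add_mul, add_sub_right_comm]
          exact (abs_add_le _ _).trans (add_le_add h2 h1)
      · refine hfinal (φ := fun τ => ρ' τ (X τ) - ρ τ (X τ))
          (fun σ hσ => (hd₄ σ hσ).sub (hd₂ σ hσ)) ?_ fun σ hσ => ?_
        · simp only [h.rho_init, h'.rho_init, sub_self]
        · have h1 := hprod σ hσ _ (((hρ' σ (hsub hσ)).2.1 (X σ)).trans hMM₄)
          rw [sub_zero, hCeq, add_mul]
          have : 0 ≤ 1 / m * B n σ := mul_nonneg (by positivity) (hB0 σ hσ)
          linarith
  have hlim : Tendsto (fun n => B n t) atTop (𝓝 0) := by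
    have := (FloorSemiring.tendsto_pow_div_factorial_atTop (C * t)).const_mul (2 * M)
    rwa [mul_zero] at this
  have hz : ∀ y : ℝ, (∀ n, |y| ≤ B n t) → y = 0 := fun y hy =>
    abs_nonpos_iff.1 (ge_of_tendsto' hlim hy)
  exact ⟨funext fun x => sub_eq_zero.1 (hz _ fun n => (key n t ⟨h0, le_rfl⟩ x).1),
    funext fun x => sub_eq_zero.1 (hz _ fun n => (key n t ⟨h0, le_rfl⟩ x).2)⟩

/-! ### Blow-up -/

/-- By continuity, exceeding the essential supremum at one point would mean exceeding it on a
nonempty open set. -/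
theorem enorm_le_supNorm {f : ℝ → ℝ} (hf : ContinuousOn f (Ioo 0 1)) {x : ℝ}
    (hx : x ∈ Ioo (0 : ℝ) 1) : ‖f x‖ₑ ≤ supNorm f := by
  by_contra! h
  have hopen : IsOpen (Ioo (0 : ℝ) 1 ∩ f ⁻¹' {y | supNorm f < ‖y‖ₑ}) :=
    hf.isOpen_inter_preimage isOpen_Ioo (isOpen_lt continuous_const continuous_enorm)
  refine (hopen.measure_pos volume ⟨x, hx, h⟩).ne' ?_
  have h1 : ∀ᵐ y ∂volume.restrict (Ioo (0 : ℝ) 1), ‖f y‖ₑ ≤ supNorm f := by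
    rw [supNorm, eLpNorm_exponent_top]
    exact enorm_ae_le_eLpNormEssSup f _
  rw [ae_restrict_iff' measurableSet_Ioo, ae_iff] at h1
  refine measure_mono_null (fun y hy => ?_) h1
  exact fun hle => (hle hy.1).not_gt hy.2

theorem supNorm_le {f : ℝ → ℝ} {M : ℝ} (hM : ∀ x, |f x| ≤ M) : supNorm f ≤ ENNReal.ofReal M := by
  rw [supNorm, eLpNorm_exponent_top]
  refine eLpNormEssSup_le_of_ae_enorm_bound (Eventually.of_forall fun x => ?_)
  rw [Real.enorm_eq_ofReal_abs]
  exact ENNReal.ofReal_le_ofReal (hM x)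

theorem enorm_integral_le {F : ℝ → ℝ≥0∞} {g : ℝ → ℝ} {T t : ℝ} (h0 : 0 ≤ t) (ht : t < T)
    (h : ∀ τ ∈ Ioc 0 t, ‖g τ‖ₑ ≤ F τ) :
    ‖∫ τ in (0 : ℝ)..t, g τ‖ₑ ≤ ∫⁻ τ in Ioo 0 T, F τ := by
  rw [intervalIntegral.integral_of_le h0]
  refine (enorm_integral_le_lintegral_enorm _).trans ?_
  refine (setLIntegral_mono' measurableSet_Ioc h).trans ?_
  exact lintegral_mono_set fun τ hτ => ⟨hτ.1, hτ.2.trans_lt ht⟩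

theorem lintegral_supNorm_lt_top {f : ℝ → ℝ → ℝ} {T M : ℝ}
    (hM : ∀ t ∈ Ico 0 T, ∀ x, |f t x| ≤ M) : ∫⁻ t in Ioo 0 T, supNorm (f t) < ∞ := by
  refine (setLIntegral_mono' measurableSet_Ioo fun t ht =>
    supNorm_le (hM t ⟨ht.1.le, ht.2⟩)).trans_lt ?_
  rw [setLIntegral_const]
  exact ENNReal.mul_lt_top ENNReal.ofReal_lt_top (by simp)

/-- The mean value theorem for functions vanishing at the origin. -/
theorem enorm_div_le_supNorm_deriv {f : ℝ → ℝ} (hf : Continuous f)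
    (hd : ∀ x ∈ Ioo (0 : ℝ) 1, DifferentiableAt ℝ f x) (hc : ContinuousOn (deriv f) (Ioo 0 1))
    (h0 : f 0 = 0) {x : ℝ} (hx : x ∈ Ioo (0 : ℝ) 1) : ‖f x / x‖ₑ ≤ supNorm (deriv f) := by
  obtain ⟨c, hc', h⟩ := exists_deriv_eq_slope f hx.1 hf.continuousOn
    fun y hy => (hd y ⟨hy.1, hy.2.trans hx.2⟩).differentiableWithinAt
  rw [h0, sub_zero, sub_zero] at h
  rw [← h]
  exact enorm_le_supNorm hc ⟨hc'.1, hc'.2.trans hx.2⟩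

theorem continuous_velocity (β₁ β₂ : ℝ) {f : ℝ → ℝ} (hf : Continuous f) {m : ℝ} (hm : 0 < m)
    (h0 : ∀ x < m, f x = 0) : Continuous (velocity β₁ β₂ f) := by
  have hc := continuous_div_self hf hm h0
  have hp : Continuous fun b => ∫ y in (0 : ℝ)..b, f y / y :=
    intervalIntegral.continuous_primitive (fun _ _ => hc.intervalIntegrable _ _) 0
  have h : velocity β₁ β₂ f = fun x =>
      x * ((∫ y in (0 : ℝ)..min (β₁ * x) 1, f y / y) - ∫ y in (0 : ℝ)..min (β₂ * x) 1, f y / y)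
        - x * ((∫ y in (0 : ℝ)..1, f y / y) - ∫ y in (0 : ℝ)..min (β₁ * x) 1, f y / y) := by
    ext x
    rw [intervalIntegral.integral_interval_sub_left (hc.intervalIntegrable _ _)
      (hc.intervalIntegrable _ _), intervalIntegral.integral_interval_sub_left
      (hc.intervalIntegrable _ _) (hc.intervalIntegrable _ _)]
    rfl
  rw [h]
  have h1 : Continuous fun x : ℝ => ∫ y in (0 : ℝ)..min (β₁ * x) 1, f y / y :=
    hp.comp (by fun_prop : Continuous fun x : ℝ => min (β₁ * x) 1)
  have h2 : Continuous fun x : ℝ => ∫ y in (0 : ℝ)..min (β₂ * x) 1, f y / y :=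
    hp.comp (by fun_prop : Continuous fun x : ℝ => min (β₂ * x) 1)
  fun_prop

theorem exp_mem_Ioo {s : ℝ} (hs : s < 0) : Real.exp s ∈ Ioo (0 : ℝ) 1 :=
  ⟨Real.exp_pos s, Real.exp_lt_one_iff.2 hs⟩

/-! ### Quantities whose time integral controls the flow. -/

section Blowup

variable {A : ℝ} {R : ℝ → ℝ} {hR : IsProfile A R} {b₁ b₂ : ℝ} {α : ℝ → FlowState} {T : ℝ}

theorem position_neg (x : FlowState) {a : ℝ} (ha : a < 0) : position x.1 a < 0 := by
  have := position_strictMono x.1.continuous ha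
  rwa [position_zero] at this

theorem enorm_vorticity_le (hR : IsProfile A R) (t s : ℝ) :
    ‖vorticity A (α t) s‖ₑ ≤ supNorm (eulerVort A α t) := by
  rcases lt_or_ge s 0 with hs | hs
  · rw [← eulerVort_exp]
    refine enorm_le_supNorm ?_ (exp_mem_Ioo hs)
    refine ContinuousOn.congr (f := fun x => vorticity A (α t) (Real.log x))
      ((continuous_vorticity (α t)).comp_continuousOn
        (Real.continuousOn_log.mono fun x hx => hx.1.ne')) fun x hx => if_pos hx.1
  · rw [vorticity_of_nonneg (by linarith [hR.le]) _ hs]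
    simp

theorem enorm_rate_le (hR : IsProfile A R) (t a : ℝ) :
    ‖rate A b₁ b₂ (α t).1 (α t).2 a‖ₑ ≤ 3 * supNorm (eulerVort A α t) := by
  have h : rate A b₁ b₂ (α t).1 (α t).2 a = vorticity A (α t) (position (α t).1 a + b₁)
      + vorticity A (α t) (position (α t).1 a + b₁)
      - vorticity A (α t) (position (α t).1 a + b₂) := by
    rw [← two_mul]; rfl
  rw [h]
  refine enorm_sub_le.trans ((add_le_add (enorm_add_le _ _) le_rfl).trans ?_)
  refine (add_le_add (add_le_add (enorm_vorticity_le hR t _) (enorm_vorticity_le hR t _))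
    (enorm_vorticity_le hR t _)).trans_eq ?_
  ring

/-- A flow with bounded Jacobian is bounded on bounded time intervals. -/
theorem IsFlow.exists_bound_of_fst (h : IsFlow hR b₁ b₂ (Ico 0 T) α) {N : ℝ}
    (hN : ∀ t ∈ Ico 0 T, ∀ a, |(α t).1 a| ≤ N) : ∃ C, ∀ t ∈ Ico 0 T, ‖α t‖ ≤ C := by
  obtain ⟨C, hC1, hC⟩ := hR.exists_bound
  set D := Real.exp (Real.exp N * -A) * (C + Real.exp N) with hD
  have hD0 : 0 ≤ D := by positivity
  refine ⟨max |N| (D * T), fun t ht => ?_⟩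
  refine norm_flowState_le ((abs_nonneg N).trans (le_max_left _ _))
    (fun a => (hN t ht a).trans ((le_abs_self N).trans (le_max_left _ _))) fun a => ?_
  refine le_trans ?_ (le_max_right _ _)
  have h1 := (convex_Icc (0 : ℝ) t).norm_image_sub_le_of_norm_hasDerivWithin_le
    (f := fun τ => (α τ).2 a) (f' := fun τ => source R (α τ).1 a) (C := D)
    (fun τ hτ => (BoundedContinuousFunction.evalCLM ℝ a :
        (ℝ →ᵇ ℝ) →L[ℝ] ℝ).hasFDerivAt.comp_hasDerivWithinAt τ
      (hasDerivWithinAt_snd ((h.restrict ht.2).2 τ hτ)))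
    (fun τ hτ => abs_source_le hR hC1 hC (α τ).1.continuous
      (hN τ ⟨hτ.1, hτ.2.trans_lt ht.2⟩) a) (left_mem_Icc.2 ht.1) (right_mem_Icc.2 ht.1)
  simp only [h.1, Prod.snd_zero, BoundedContinuousFunction.coe_zero, Pi.zero_apply, sub_zero,
    Real.norm_eq_abs, abs_of_nonneg ht.1] at h1
  exact h1.trans (mul_le_mul_of_nonneg_left ht.2.le hD0)

/-- A finite integral would bound the logarithm of the Jacobian, whose rate is `2 ω - ω` at two
shifted points, and then the whole state. -/
theorem IsFlow.lintegral_supNorm_eulerVort (h : IsFlow hR b₁ b₂ (Ico 0 T) α)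
    (hunb : ∀ N : ℕ, ∃ t ∈ Ico 0 T, N < ‖α t‖) :
    ∫⁻ t in Ioo 0 T, supNorm (eulerVort A α t) = ∞ := by
  by_contra hfin
  set I := ∫⁻ t in Ioo 0 T, 3 * supNorm (eulerVort A α t) with hI
  have hIfin : I ≠ ∞ := by
    rw [hI, lintegral_const_mul' _ _ (by simp)]
    exact ENNReal.mul_ne_top (by simp) hfin
  obtain ⟨C, hC⟩ := h.exists_bound_of_fst (N := I.toReal) fun t ht a => by
    rw [(h.restrict ht.2).fst_eq_integral ht.1 ⟨ht.1, le_rfl⟩ a]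
    have := enorm_integral_le ht.1 ht.2 fun τ _ => enorm_rate_le (b₁ := b₁) (b₂ := b₂) (α := α) hR τ a
    rwa [Real.enorm_eq_ofReal_abs, ENNReal.ofReal_le_iff_le_toReal hIfin] at this
  obtain ⟨N, hN⟩ := exists_nat_ge C
  obtain ⟨t, ht, hlt⟩ := hunb N
  linarith [hC t ht]

theorem IsFlow.false_of_vorticity_le (h : IsFlow hR b₁ b₂ (Ico 0 T) α)
    (hunb : ∀ N : ℕ, ∃ t ∈ Ico 0 T, N < ‖α t‖) {M : ℝ} (hM0 : 0 ≤ M)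
    (hM : ∀ t ∈ Ico 0 T, ∀ a < 0, |vorticity A (α t) (position (α t).1 a)| ≤ M) : False := by
  refine (lintegral_supNorm_lt_top (M := M) fun t ht x => ?_).ne (h.lintegral_supNorm_eulerVort hunb)
  unfold eulerVort
  split_ifs with hx
  · set a := label (α t).1 (Real.log x) with ha
    have hxa : position (α t).1 a = Real.log x :=
      position_label (α t).1.continuous (abs_fst_le _) _
    rw [← hxa]
    rcases lt_or_ge a 0 with ha0 | ha0
    · exact hM t ht a ha0
    · rw [(h.restrict ht.2).vorticity_position ⟨ht.1, le_rfl⟩, hR.zero_of_ge a (by linarith)]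
      simpa using hM0
  · simpa using hM0

/-- The left side is `ρ / x` at the particle, a difference quotient of the density from the origin.
Its time integral bounds the vorticity. -/
theorem enorm_profile_mul_exp_le {t : ℝ} (hρ : ContDiff ℝ 1 (eulerDens R α t)) {a : ℝ}
    (ha : a < 0) :
    ‖R a * Real.exp (-position (α t).1 a)‖ₑ ≤ supNorm (deriv (eulerDens R α t)) := by
  have h := enorm_div_le_supNorm_deriv hρ.continuous
    (fun x _ => hρ.differentiable one_ne_zero x) (hρ.continuous_deriv le_rfl).continuousOn
    (by simp [eulerDens]) (exp_mem_Ioo (position_neg (α t) ha))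
  rwa [eulerDens_exp, label_position (α t).1.continuous, div_eq_mul_inv, ← Real.exp_neg] at h

theorem IsFlow.lintegral_supNorm_deriv_eulerDens (h : IsFlow hR b₁ b₂ (Ico 0 T) α)
    (hunb : ∀ N : ℕ, ∃ t ∈ Ico 0 T, N < ‖α t‖)
    (hρ : ∀ t ∈ Ico 0 T, ContDiff ℝ 1 (eulerDens R α t)) :
    ∫⁻ t in Ioo 0 T, supNorm (deriv (eulerDens R α t)) = ∞ := by
  by_contra hfin
  refine h.false_of_vorticity_le hunb
    (M := (∫⁻ t in Ioo 0 T, supNorm (deriv (eulerDens R α t))).toReal)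
    ENNReal.toReal_nonneg fun t ht a ha => ?_
  rw [(h.restrict ht.2).vorticity_position ⟨ht.1, le_rfl⟩, ← intervalIntegral.integral_const_mul]
  have := enorm_integral_le ht.1 ht.2 fun τ hτ =>
    enorm_profile_mul_exp_le (hρ τ ⟨hτ.1.le, hτ.2.trans_lt ht.2⟩) ha
  rwa [Real.enorm_eq_ofReal_abs, ENNReal.ofReal_le_iff_le_toReal hfin] at this

variable {β₁ β₂ : ℝ}

theorem hasDerivAt_velocity_eulerVort (hR : IsProfile A R) (hβ₁ : 0 < β₁) (hβ₂ : 0 < β₂) (t : ℝ)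
    {x : ℝ} (hx : 0 < x) : HasDerivAt (velocity β₁ β₂ (eulerVort A α t))
      (logVel (Real.log β₁) (Real.log β₂) (vorticity A (α t)) (Real.log x)
        + (2 * vorticity A (α t) (Real.log x + Real.log β₁)
          - vorticity A (α t) (Real.log x + Real.log β₂))) x := by
  have h1 := (hasDerivAt_id x).mul ((hasDerivAt_logVel (continuous_vorticity (A := A) (α t))
    (Real.log β₁) (Real.log β₂) (Real.log x)).comp x (Real.hasDerivAt_log hx.ne'))
  refine (h1.congr_of_eventuallyEq ?_).congr_deriv ?_
  · filter_upwards [Ioi_mem_nhds hx] with y hy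
    exact velocity_eulerVort hR hβ₁ hβ₂ t hy
  · simp only [id, one_mul, Function.comp]
    field_simp

/-- The rate equals `∂ₓu - u / x` at the particle, and `u / x` is bounded by the sup of `∂ₓu`
because `u` vanishes at the origin. -/
theorem enorm_rate_le_deriv_velocity (hR : IsProfile A R) (hβ₁ : 0 < β₁) (hβ₂ : 0 < β₂) {t : ℝ}
    (hω : Continuous (eulerVort A α t)) {m : ℝ} (hm : 0 < m)
    (hω0 : ∀ x < m, eulerVort A α t x = 0) {a : ℝ} (ha : a < 0) :
    ‖rate A (Real.log β₁) (Real.log β₂) (α t).1 (α t).2 a‖ₑ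
      ≤ 2 * supNorm (deriv (velocity β₁ β₂ (eulerVort A α t))) := by
  have hd := fun x (hx : 0 < x) => hasDerivAt_velocity_eulerVort (α := α) hR hβ₁ hβ₂ t hx
  have hw := continuous_vorticity (A := A) (α t)
  have hl : Continuous (logVel (Real.log β₁) (Real.log β₂) (vorticity A (α t))) :=
    continuous_iff_continuousAt.2 fun s => (hasDerivAt_logVel hw _ _ s).continuousAt
  have hlog : ContinuousOn Real.log (Ioo 0 1) := Real.continuousOn_log.mono fun x hx => hx.1.ne'
  have hc : ContinuousOn (deriv (velocity β₁ β₂ (eulerVort A α t))) (Ioo 0 1) := by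
    refine ContinuousOn.congr ?_ fun x hx => (hd x hx.1).deriv
    exact (by fun_prop : Continuous fun s =>
      logVel (Real.log β₁) (Real.log β₂) (vorticity A (α t)) s
        + (2 * vorticity A (α t) (s + Real.log β₁)
          - vorticity A (α t) (s + Real.log β₂))).comp_continuousOn hlog
  have hX := exp_mem_Ioo (position_neg (α t) ha)
  have h1 := enorm_div_le_supNorm_deriv (continuous_velocity β₁ β₂ hω hm hω0)
    (fun x hx => (hd x hx.1).differentiableAt) hc (by simp [velocity]) hX
  have h2 := enorm_le_supNorm hc hX
  rw [(hd _ hX.1).deriv] at h2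
  rw [velocity_eulerVort hR hβ₁ hβ₂ t hX.1, mul_div_cancel_left₀ _ hX.1.ne'] at h1
  rw [Real.log_exp] at h1 h2
  have h3 : rate A (Real.log β₁) (Real.log β₂) (α t).1 (α t).2 a
      = (logVel (Real.log β₁) (Real.log β₂) (vorticity A (α t)) (position (α t).1 a)
        + (2 * vorticity A (α t) (position (α t).1 a + Real.log β₁)
          - vorticity A (α t) (position (α t).1 a + Real.log β₂)))
        - logVel (Real.log β₁) (Real.log β₂) (vorticity A (α t)) (position (α t).1 a) := by
    rw [add_sub_cancel_left]; rfl
  rw [h3, two_mul (supNorm _)]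
  exact enorm_sub_le.trans (add_le_add h2 h1)

theorem neg_position_le_of_abs_le {j : ℝ → ℝ} (hj : Continuous j) {N : ℝ}
    (hN : ∀ a < 0, |j a| ≤ N) {a : ℝ} (ha : a ≤ 0) : -position j a ≤ Real.exp N * -a := by
  have h0 : ∀ a ≤ 0, |j a| ≤ N := fun a ha => by
    rcases ha.lt_or_eq with h | rfl
    · exact hN a h
    · exact le_of_tendsto (hj.abs.continuousWithinAt (s := Iio 0))
        (eventually_mem_nhdsWithin.mono hN)
  have := intervalIntegral.norm_integral_le_of_norm_le_const (a := 0) (b := a)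
    (f := fun x => Real.exp (j x)) (C := Real.exp N) fun x hx => by
      rw [uIoc_of_ge ha] at hx
      rw [Real.norm_eq_abs, Real.abs_exp]
      exact Real.exp_le_exp.2 (le_of_abs_le (h0 x hx.2))
  rw [sub_zero, abs_of_nonpos ha] at this
  exact (neg_le_abs _).trans this

/-- A finite integral would bound the Jacobian for negative labels, hence keep the particles of
label in `[A, 0]` away from `-∞`; their histories, and with them the vorticity, would stay bounded.
-/
theorem IsFlow.lintegral_supNorm_deriv_velocity (hβ₁ : 0 < β₁) (hβ₂ : 0 < β₂)
    (h : IsFlow hR (Real.log β₁) (Real.log β₂) (Ico 0 T) α)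
    (hunb : ∀ N : ℕ, ∃ t ∈ Ico 0 T, N < ‖α t‖) (hω : IsKPath 1 T (eulerVort A α)) :
    ∫⁻ t in Ioo 0 T, supNorm (deriv (velocity β₁ β₂ (eulerVort A α t))) = ∞ := by
  by_contra hfin
  have hA : A ≤ 0 := by linarith [hR.le]
  set I := ∫⁻ t in Ioo 0 T, 2 * supNorm (deriv (velocity β₁ β₂ (eulerVort A α t))) with hI
  have hIfin : I ≠ ∞ := by
    rw [hI, lintegral_const_mul' _ _ (by simp)]
    exact ENNReal.mul_ne_top (by simp) hfin
  have hj : ∀ t ∈ Ico 0 T, ∀ a < 0, |(α t).1 a| ≤ I.toReal := fun t ht a ha => by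
    rw [(h.restrict ht.2).fst_eq_integral ht.1 ⟨ht.1, le_rfl⟩ a]
    obtain ⟨M, m, hm, hb⟩ := hω.exists_bounds ht.2
    have := enorm_integral_le ht.1 ht.2 fun τ hτ =>
      enorm_rate_le_deriv_velocity (α := α) hR hβ₁ hβ₂
        (hω.mem τ ⟨hτ.1.le, hτ.2.trans_lt ht.2⟩).1.continuous hm
        (hb τ ⟨hτ.1.le, hτ.2⟩).2.2 ha
    rwa [Real.enorm_eq_ofReal_abs, ENNReal.ofReal_le_iff_le_toReal hIfin] at this
  set E := Real.exp (Real.exp I.toReal * -A) with hE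
  obtain ⟨t₀, ht₀, -⟩ := hunb 0
  have hT : 0 ≤ T := ht₀.1.trans ht₀.2.le
  refine h.false_of_vorticity_le hunb (M := E * T) (by positivity) fun t ht a ha => ?_
  rw [(h.restrict ht.2).vorticity_position ⟨ht.1, le_rfl⟩]
  rcases le_total a A with haA | haA
  · rw [hR.zero_of_le a haA, zero_mul, abs_zero]; positivity
  have h1 : |∫ τ in (0 : ℝ)..t, Real.exp (-position (α τ).1 a)| ≤ E * |t - 0| := by
    refine intervalIntegral.norm_integral_le_of_norm_le_const
      (f := fun τ => Real.exp (-position (α τ).1 a)) fun τ hτ => ?_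
    rw [uIoc_of_le ht.1] at hτ
    rw [Real.norm_eq_abs, Real.abs_exp, hE, Real.exp_le_exp]
    refine (neg_position_le_of_abs_le (α τ).1.continuous
      (hj τ ⟨hτ.1.le, hτ.2.trans_lt ht.2⟩) ha.le).trans ?_
    exact mul_le_mul_of_nonneg_left (by linarith) (Real.exp_pos _).le
  rw [sub_zero, abs_of_nonneg ht.1] at h1
  rw [abs_mul, ← one_mul (E * T)]
  refine mul_le_mul ?_ (h1.trans ?_) (abs_nonneg _) zero_le_one
  · rw [abs_of_nonneg (hR.nonneg a)]; exact hR.le_one a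
  · exact mul_le_mul_of_nonneg_left ht.2.le (Real.exp_pos _).le

theorem IsFlow.hasTrajectories (hβ₁ : 0 < β₁) (hβ₂ : 0 < β₂)
    (h : IsFlow hR (Real.log β₁) (Real.log β₂) (Ico 0 T) α)
    (hv : ∀ t ∈ Ico 0 T, logVel (Real.log β₁) (Real.log β₂) (vorticity A (α t)) 0 = 0) :
    HasTrajectories β₁ β₂ T (eulerVort A α) := by
  intro t ht x hx
  set a := label (α t).1 (Real.log x) with ha
  have hxa : position (α t).1 a = Real.log x :=
    position_label (α t).1.continuous (abs_fst_le _) _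
  have ha0 : a < 0 := by
    rw [← (position_strictMono (α t).1.continuous).lt_iff_lt, hxa, position_zero]
    exact Real.log_neg hx.1 hx.2
  refine ⟨fun σ => Real.exp (position (α σ).1 a), ?_, fun σ hσ =>
    ⟨exp_mem_Ioo (position_neg (α σ) ha0), ?_⟩⟩
  · simp only
    rw [hxa, Real.exp_log hx.1]
  · exact (h.restrict ht.2).hasDerivWithinAt_exp_position hβ₁ hβ₂
      (fun τ hτ => hv τ ⟨hτ.1, hτ.2.trans_lt ht.2⟩) hσ a

end Blowup

/-! ### Existence of profiles, maximality, and the conclusion. -/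

theorem exists_isProfile {A : ℝ} (hA : A ≤ -10) : ∃ R, IsProfile A R := by
  refine ⟨fun a => Real.smoothTransition (a - A) * Real.smoothTransition (-2 - a), hA, fun n => ?_,
    fun a => ?_, fun a => ?_, fun a ha => ?_, fun a ha => ?_, fun a a' haa' ha' => ?_,
    fun a ha => ?_⟩
  · exact (Real.smoothTransition.contDiff.comp (contDiff_id.sub contDiff_const)).mul
      (Real.smoothTransition.contDiff.comp (contDiff_const.sub contDiff_id))
  · exact mul_nonneg (Real.smoothTransition.nonneg _) (Real.smoothTransition.nonneg _)
  · exact mul_le_one₀ (Real.smoothTransition.le_one _) (Real.smoothTransition.nonneg _)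
      (Real.smoothTransition.le_one _)
  · rw [Real.smoothTransition.zero_of_nonpos (by linarith), zero_mul]
  · rw [Real.smoothTransition.zero_of_nonpos (x := -2 - a) (by linarith), mul_zero]
  · rw [Real.smoothTransition.one_of_one_le (x := -2 - a) (by linarith),
      Real.smoothTransition.one_of_one_le (x := -2 - a') (by linarith), mul_one, mul_one]
    exact Real.smoothTransition.monotone (by linarith)
  · rw [Real.smoothTransition.one_of_one_le (x := -2 - a) (by linarith [ha.2]),
      Real.smoothTransition.one_of_one_le (by linarith [ha.1]), mul_one]

theorem isShiftPair_log {β₁ β₂ : ℝ} (hβ₂ : β₂ ≤ 1) (hβ₁ : 1 ≤ β₁) (hβ : β₁ < 2 * β₂) :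
    IsShiftPair (Real.log β₁) (Real.log β₂) where
  nonneg := Real.log_nonneg hβ₁
  nonpos := Real.log_nonpos (by linarith) hβ₂
  lt_log := by
    have := Real.log_lt_log (by linarith) hβ
    rw [Real.log_mul two_ne_zero (by linarith)] at this
    linarith

/-- A solution with unbounded vorticity and with particle trajectories is maximal and unique. -/
theorem IsSolution.eq_restriction {β₁ β₂ T T' : ℝ} (hβ₁ : 0 < β₁) (hβ₂ : 0 < β₂)
    {ω₀ ρ₀ : ℝ → ℝ} {ω ρ ω' ρ' : ℝ → ℝ → ℝ} (h : IsSolution β₁ β₂ 1 T ω₀ ρ₀ ω ρ)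
    (htraj : HasTrajectories β₁ β₂ T ω) (hω : ∫⁻ t in Ioo 0 T, supNorm (ω t) = ∞)
    (h' : IsSolution β₁ β₂ 1 T' ω₀ ρ₀ ω' ρ') :
    T' ≤ T ∧ ∀ t ∈ Ico (0 : ℝ) T', ω' t = ω t ∧ ρ' t = ρ t := by
  have hT : T' ≤ T := by
    -- A solution living past `T` has bounded vorticity on `[0, T]` and agrees with `ω` before `T`,
    -- against the divergence of the integral.
    by_contra! hlt
    obtain ⟨M, m, hm, hb⟩ := h'.omega_path.exists_bounds hlt
    refine (lintegral_supNorm_lt_top (M := M) fun t ht x => ?_).ne hω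
    rw [← (h.eq_of_hasTrajectories hβ₁ hβ₂ h' htraj ht.1 ht.2 (ht.2.trans hlt)).1]
    exact (hb t ⟨ht.1, ht.2.le⟩).1 x
  exact ⟨hT, fun t ht =>
    h.eq_of_hasTrajectories hβ₁ hβ₂ h' htraj ht.1 (ht.2.trans_le hT) ht.2⟩

theorem theorem2 (β₁ β₂ : ℝ) (hβ₂ : β₂ ≤ 1) (hβ₁ : 1 ≤ β₁) (hβ : β₁ < 2 * β₂) :
    ∃ ω₀ ρ₀ : ℝ → ℝ, MemKInf ω₀ ∧ MemKInf ρ₀ ∧ (∀ x, 0 ≤ ω₀ x) ∧ (∀ x, 0 ≤ ρ₀ x) ∧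
      ∃ T : ℝ, 0 < T ∧ ∃ ω ρ : ℝ → ℝ → ℝ,
        -- `(ω, ρ)` is a smooth solution on `[0,T)` with the given data,
        (∀ n : ℕ, 1 ≤ n → IsSolution β₁ β₂ n T ω₀ ρ₀ ω ρ) ∧
        -- it is the maximal one, and every other solution is a restriction of it,
        (∀ n : ℕ, 1 ≤ n → ∀ (T' : ℝ) (ω' ρ' : ℝ → ℝ → ℝ),
          IsSolution β₁ β₂ n T' ω₀ ρ₀ ω' ρ' →
            T' ≤ T ∧ ∀ t ∈ Ico (0 : ℝ) T', ω' t = ω t ∧ ρ' t = ρ t) ∧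
        -- and it blows up at time `T`.
        (∫⁻ t in Ioo (0 : ℝ) T, supNorm (ω t)) = ∞ ∧
        (∫⁻ t in Ioo (0 : ℝ) T, supNorm (deriv (ρ t))) = ∞ ∧
        (∫⁻ t in Ioo (0 : ℝ) T, supNorm (deriv (velocity β₁ β₂ (ω t)))) = ∞ := by
  have hβ₁' : 0 < β₁ := by linarith
  have hβ₂' : 0 < β₂ := by linarith
  obtain ⟨T₀, hT₀, A, hA, hno, hctrl⟩ :=
    exists_forall_not_isLagrangian (isShiftPair_log hβ₂ hβ₁ hβ)
  obtain ⟨R, hR⟩ := exists_isProfile hA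
  -- A flow on all of `[0, T₀]` is excluded by the collapse, so the maximal flow is unbounded.
  obtain ⟨T, hT, hTT₀, α, h, hunb⟩ := exists_unbounded_flow hR (Real.log β₁) (Real.log β₂) hT₀
    fun ⟨α, hα⟩ => hno R hR _ _ hα.isLagrangian
  have hc : ∀ t ∈ Ico 0 T, position (α t).1 (-2) ≤ -1
      ∧ logVel (Real.log β₁) (Real.log β₂) (vorticity A (α t)) 0 = 0 := fun t ht =>
    hctrl A R hR t (ht.2.le.trans hTT₀) _ _ (h.restrict ht.2).isLagrangian t ⟨ht.1, le_rfl⟩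
  have hsol := h.isSolution hβ₁' hβ₂' (fun t ht => (hc t ht).1) fun t ht => (hc t ht).2
  have hω := h.lintegral_supNorm_eulerVort hunb
  have h0 : (0 : ℝ) ∈ Ico 0 T := ⟨le_rfl, hT⟩
  -- The initial state is zero, so the initial vorticity vanishes identically and labels are the
  -- initial logarithmic positions.
  refine ⟨eulerVort A α 0, eulerDens R α 0, fun n _ => (hsol n).omega_path.mem 0 h0,
    fun n _ => (hsol n).rho_path.mem 0 h0, fun x => ?_, fun x => ?_, T, hT, eulerVort A α,
    eulerDens R α, fun n _ => hsol n, fun n hn T' ω' ρ' h' => ?_, hω, ?_, ?_⟩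
  · unfold eulerVort
    split_ifs
    · simp [vorticity, h.1]
    · exact le_rfl
  · unfold eulerDens
    split_ifs
    · exact hR.nonneg _
    · exact le_rfl
  · exact (hsol 1).eq_restriction hβ₁' hβ₂'
      (h.hasTrajectories hβ₁' hβ₂' fun t ht => (hc t ht).2) hω (h'.of_le hn)
  · exact h.lintegral_supNorm_deriv_eulerDens hunb fun t ht =>
      ((hsol 1).rho_path.mem t ht).1
  · exact h.lintegral_supNorm_deriv_velocity hβ₁' hβ₂' hunb (hsol 1).omega_path
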